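/- **Setting.** Vocabularies consist of relation symbols only, and equality is not built in. Structures have finite nonempty universes. A *pp-formula* is built from atoms $R(v_1,\dots,v_k)$ and the true formula $\top$ (the empty conjunction) by $\wedge$ and $\exists$; it is *prenex* if all its quantifiers occur in front. A formula $\varphi(V)$ comes with a finite set $V\supseteq\mathrm{free}(\varphi)$ of *liberal* variables, and $\varphi(\mathbf B)$ is the set of assignments $f:V\to B$ with $\mathbf B,f\models\varphi$. *$\sharp$-formulas* $\psi$, their free variables $\mathrm{free}(\psi)$, closed variables $\mathrm{closed}(\psi)$ and values $[\mathbf B,\psi](h)\in\mathbb Z$ for $h:\mathrm{free}(\psi)\to B$ are defined inductively ($V$ and $L$ are finite sets of variables). - $C(\varphi,L)$, for a first-order formula $\varphi$ with $\mathrm{free}(\varphi)\subseteq L$: free variables $L$, closed variables $\emptyset$; the value is $1$ if $\mathbf B,h\models\varphi$ and $0$ otherwise. - $PV\psi$, if $V\cap\mathrm{closed}(\psi)=\emptyset$: free variables $\mathrm{free}(\psi)\setminus V$, closed variables $V\cup\mathrm{closed}(\psi)$; the value is $\sum_{h'}[\mathbf B,\psi](h')$ over all extensions $h':\mathrm{free}(\psi)\cup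 V\to B$ of $h$ (where $[\mathbf B,\psi](h')$ uses only the restriction of $h'$ to $\mathrm{free}(\psi)$). - $EV\psi$, if $V\cap(\mathrm{free}(\psi)\cup\mathrm{closed}(\psi))=\emptyset$: free variables $V\cup\mathrm{free}(\psi)$, closed variables $\mathrm{closed}(\psi)$; the value is $[\mathbf B,\psi](h\upharpoonright\mathrm{free}(\psi))$. - $\psi\times\psi'$, if $\mathrm{free}(\psi)=\mathrm{free}(\psi')$ and $\mathrm{closed}(\psi)\cap\mathrm{closed}(\psi')=\emptyset$; and $\psi+\psi'$, if $\mathrm{free}(\psi)=\mathrm{free}(\psi')$: free variables $\mathrm{free}(\psi)$, closed variables $\mathrm{closed}(\psi)\cup\mathrm{closed}(\psi')$; the value is the product, respectively the sum, of the two values. - $n\in\mathbb Z$: no free and no closed variables; the value is $n$. A *$\sharp\mathsf{PP}$-formula* is a $\sharp$-formula in which $\varphi$ is a pp-formula for every subformula of the form $C(\varphi,L)$. The *width* of a $\sharp$-formula $\psi$ is the maximum of $|\mathrm{free}(\theta)|$ over all subformulas $\theta$ of $\psi$, that is, over all $\sharp$-subformulas of $\psi$ and all subformulas of the first-order formulas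 $\varphi$ for which some $C(\varphi,L)$ occurs in $\psi$. A *$\sharp\mathsf{PP}$-representation* of $\varphi(V)$ is a $\sharp\mathsf{PP}$-formula $\psi$ with $\mathrm{free}(\psi)=\emptyset$ such that the value of $\psi$ on $\mathbf B$ is $|\varphi(\mathbf B)|$ for every finite structure $\mathbf B$. **Theorem 4.2.** There is an algorithm that, given a prenex pp-formula $\varphi(V)$, outputs a $\sharp\mathsf{PP}$-representation $\psi$ of $\varphi(V)$, over the vocabulary of the relation symbols occurring in $\varphi$, whose width is minimum among all $\sharp\mathsf{PP}$-representations of $\varphi(V)$. -/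

import Mathlib

namespace SharpLogic

/-- Variables are named by natural numbers. -/
abbrev Var : Type := ℕ

/-- Relation symbols: for every arity there are countably infinitely many of them. A vocabulary is a
set of relation symbols; there are no function symbols and equality is not built in. -/
structure RelSymbol where
  name : ℕ
  arity : ℕ

/-- A finite structure with nonempty universe. It interprets all relation symbols; the
interpretations of symbols outside of a vocabulary are irrelevant to formulas over it. -/
structure FinStructure where
  carrier : Type
  [fintype : Fintype carrier]
  [nonempty : Nonempty carrier]
  rel : (R : RelSymbol) → Set (Fin R.arity → carrier)

attribute [instance] FinStructure.fintype FinStructure.nonempty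

/-! ### First-order formulas -/

/-- First-order formulas (fo-formulas); `tru` is the empty conjunction `⊤`. -/
inductive FOFormula : Type where
  | tru : FOFormula
  | atom (R : RelSymbol) (v : Fin R.arity → Var) : FOFormula
  | neg (φ : FOFormula) : FOFormula
  | and (φ ψ : FOFormula) : FOFormula
  | or (φ ψ : FOFormula) : FOFormula
  | ex (x : Var) (φ : FOFormula) : FOFormula
  | all (x : Var) (φ : FOFormula) : FOFormula

namespace FOFormula

/-- The set of free variables. -/
def free : FOFormula → Finset Var
  | tru => ∅
  | atom _ v => Finset.univ.image v
  | neg φ => φ.free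
  | and φ ψ => φ.free ∪ ψ.free
  | or φ ψ => φ.free ∪ ψ.free
  | ex x φ => φ.free.erase x
  | all x φ => φ.free.erase x

/-- `φ.Sat B g`: the structure `B` satisfies `φ` under the assignment `g`. -/
def Sat (B : FinStructure) : FOFormula → (Var → B.carrier) → Prop
  | tru, _ => True
  | atom R v, g => (fun i => g (v i)) ∈ B.rel R
  | neg φ, g => ¬ φ.Sat B g
  | and φ ψ, g => φ.Sat B g ∧ ψ.Sat B g
  | or φ ψ, g => φ.Sat B g ∨ ψ.Sat B g
  | ex x φ, g => ∃ b : B.carrier, φ.Sat B (Function.update g x b)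
  | all x φ, g => ∀ b : B.carrier, φ.Sat B (Function.update g x b)

/-- pp-formulas: built from atoms, conjunction (including the empty one) and `∃`. -/
def IsPP : FOFormula → Prop
  | tru => True
  | atom _ _ => True
  | neg _ => False
  | and φ ψ => φ.IsPP ∧ ψ.IsPP
  | or _ _ => False
  | ex _ φ => φ.IsPP
  | all _ _ => False

/-- Quantifier-free formulas. -/
def IsQF : FOFormula → Prop
  | tru => True
  | atom _ _ => True
  | neg φ => φ.IsQF
  | and φ ψ => φ.IsQF ∧ ψ.IsQF
  | or φ ψ => φ.IsQF ∧ ψ.IsQF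
  | ex _ _ => False
  | all _ _ => False

/-- Prenex formulas: a block of quantifiers followed by a quantifier-free formula. -/
inductive IsPrenex : FOFormula → Prop where
  | qf {φ : FOFormula} (h : φ.IsQF) : IsPrenex φ
  | ex (x : Var) {φ : FOFormula} (h : IsPrenex φ) : IsPrenex (FOFormula.ex x φ)
  | all (x : Var) {φ : FOFormula} (h : IsPrenex φ) : IsPrenex (FOFormula.all x φ)

/-- The set of relation symbols that occur in a formula. -/
def symbols : FOFormula → Set RelSymbol
  | tru => ∅
  | atom R _ => {R}
  | neg φ => φ.symbols
  | and φ ψ => φ.symbols ∪ ψ.symbols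
  | or φ ψ => φ.symbols ∪ ψ.symbols
  | ex _ φ => φ.symbols
  | all _ φ => φ.symbols

/-- The width: the maximum number of free variables of a subformula. -/
def width : FOFormula → ℕ
  | tru => 0
  | atom R v => (atom R v).free.card
  | neg φ => max (neg φ).free.card φ.width
  | and φ ψ => max (and φ ψ).free.card (max φ.width ψ.width)
  | or φ ψ => max (or φ ψ).free.card (max φ.width ψ.width)
  | ex x φ => max (ex x φ).free.card φ.width
  | all x φ => max (all x φ).free.card φ.width

/-- An explicit Gödel numbering of fo-formulas. -/
def code : FOFormula → ℕ
  | tru => Nat.pair 0 0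
  | atom R v => Nat.pair 1 (Nat.pair R.name (Encodable.encode (List.ofFn v)))
  | neg φ => Nat.pair 2 φ.code
  | and φ ψ => Nat.pair 3 (Nat.pair φ.code ψ.code)
  | or φ ψ => Nat.pair 4 (Nat.pair φ.code ψ.code)
  | ex x φ => Nat.pair 5 (Nat.pair x φ.code)
  | all x φ => Nat.pair 6 (Nat.pair x φ.code)

theorem code_injective : Function.Injective code := by
  intro φ
  induction φ with
  | tru => intro ψ h; cases ψ <;> simp [code, Nat.pair_eq_pair] at h ⊢
  | atom R v =>
    intro ψ h
    cases ψ with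
    | atom S w =>
      obtain ⟨n, a⟩ := R
      obtain ⟨m, b⟩ := S
      simp only [code, Nat.pair_eq_pair, Encodable.encode_inj, true_and] at h
      obtain ⟨rfl, h⟩ := h
      have hab : a = b := by simpa using congrArg List.length h
      subst hab
      rw [List.ofFn_injective h]
    | _ => simp [code, Nat.pair_eq_pair] at h
  | neg φ ih => intro ψ h; cases ψ <;> simp [code, Nat.pair_eq_pair] at h ⊢; exact ih h
  | and φ₁ φ₂ ih₁ ih₂ =>
    intro ψ h; cases ψ <;> simp [code, Nat.pair_eq_pair] at h ⊢; exact ⟨ih₁ h.1, ih₂ h.2⟩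
  | or φ₁ φ₂ ih₁ ih₂ =>
    intro ψ h; cases ψ <;> simp [code, Nat.pair_eq_pair] at h ⊢; exact ⟨ih₁ h.1, ih₂ h.2⟩
  | ex x φ ih => intro ψ h; cases ψ <;> simp [code, Nat.pair_eq_pair] at h ⊢; exact ⟨h.1, ih h.2⟩
  | all x φ ih => intro ψ h; cases ψ <;> simp [code, Nat.pair_eq_pair] at h ⊢; exact ⟨h.1, ih h.2⟩

end FOFormula

/-- A finite set of variables is coded by the increasing list of its elements. -/
def codeVars (V : Finset Var) : ℕ := Encodable.encode (V.sort (· ≤ ·))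

theorem codeVars_injective : Function.Injective codeVars := by
  intro V W h
  have h' := Encodable.encode_injective h
  simpa using congrArg List.toFinset h'

/-- A prenex pp-formula `φ(V)`, given with its set `V ⊇ free(φ)` of liberal variables. -/
structure PrenexPP where
  formula : FOFormula
  lib : Finset Var
  isPP : formula.IsPP
  isPrenex : formula.IsPrenex
  free_subset : formula.free ⊆ lib

namespace PrenexPP

/-- The set `φ(B)` of assignments `f : V → B` of the liberal variables that satisfy `φ` on `B`.
As `free(φ) ⊆ V`, the choice of the values `g` takes outside of `V` is irrelevant. -/
def answers (φ : PrenexPP) (B : FinStructure) : Set (φ.lib → B.carrier) :=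
  {f | ∃ g : Var → B.carrier, (∀ x : φ.lib, g x = f x) ∧ φ.formula.Sat B g}

/-- The Gödel number of a prenex pp-formula with liberal variables. -/
def code (φ : PrenexPP) : ℕ := Nat.pair φ.formula.code (codeVars φ.lib)

theorem code_injective : Function.Injective code := by
  rintro ⟨φ, V, _, _, _⟩ ⟨ψ, W, _, _, _⟩ h
  simp only [code, Nat.pair_eq_pair] at h
  obtain rfl := FOFormula.code_injective h.1
  obtain rfl := codeVars_injective h.2
  rfl

end PrenexPP

/-! ### ♯-logic -/

/-- Raw syntax of ♯-formulas; the formation rules are imposed by `SharpFormula.WellFormed`. -/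
inductive SharpFormula : Type where
  /-- casting `C(φ, L)` -/
  | cast (φ : FOFormula) (L : Finset Var) : SharpFormula
  /-- projection `P V ψ` -/
  | proj (V : Finset Var) (ψ : SharpFormula) : SharpFormula
  /-- expansion `E V ψ` -/
  | expand (V : Finset Var) (ψ : SharpFormula) : SharpFormula
  /-- product `ψ × ψ'` -/
  | mul (ψ ψ' : SharpFormula) : SharpFormula
  /-- sum `ψ + ψ'` -/
  | add (ψ ψ' : SharpFormula) : SharpFormula
  /-- integer constant -/
  | const (n : ℤ) : SharpFormula

/-- The assignment that agrees with `k` on `V` and with `h` elsewhere. -/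
def override {B : Type} (h : Var → B) (V : Finset Var) (k : V → B) : Var → B :=
  fun x => if hx : x ∈ V then k ⟨x, hx⟩ else h x

namespace SharpFormula

/-- The set of free variables of a ♯-formula. -/
def free : SharpFormula → Finset Var
  | cast _ L => L
  | proj V ψ => ψ.free \ V
  | expand V ψ => V ∪ ψ.free
  | mul ψ _ => ψ.free
  | add ψ _ => ψ.free
  | const _ => ∅

/-- The set of closed variables of a ♯-formula. -/
def closed : SharpFormula → Finset Var
  | cast _ _ => ∅
  | proj V ψ => V ∪ ψ.closed
  | expand _ ψ => ψ.closed
  | mul ψ ψ' => ψ.closed ∪ ψ'.closed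
  | add ψ ψ' => ψ.closed ∪ ψ'.closed
  | const _ => ∅

/-- The formation rules of ♯-logic. -/
def WellFormed : SharpFormula → Prop
  | cast φ L => φ.free ⊆ L
  | proj V ψ => ψ.WellFormed ∧ Disjoint V ψ.closed
  | expand V ψ => ψ.WellFormed ∧ Disjoint V (ψ.free ∪ ψ.closed)
  | mul ψ ψ' => ψ.WellFormed ∧ ψ'.WellFormed ∧ ψ.free = ψ'.free ∧ Disjoint ψ.closed ψ'.closed
  | add ψ ψ' => ψ.WellFormed ∧ ψ'.WellFormed ∧ ψ.free = ψ'.free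
  | const _ => True

/-- Every fo-formula under a cast is a pp-formula. -/
def CastsPP : SharpFormula → Prop
  | cast φ _ => φ.IsPP
  | proj _ ψ => ψ.CastsPP
  | expand _ ψ => ψ.CastsPP
  | mul ψ ψ' => ψ.CastsPP ∧ ψ'.CastsPP
  | add ψ ψ' => ψ.CastsPP ∧ ψ'.CastsPP
  | const _ => True

/-- ♯PP-formulas. -/
def IsSharpPP (ψ : SharpFormula) : Prop := ψ.WellFormed ∧ ψ.CastsPP

/-- The set of relation symbols that occur in a ♯-formula. -/
def symbols : SharpFormula → Set RelSymbol
  | cast φ _ => φ.symbols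
  | proj _ ψ => ψ.symbols
  | expand _ ψ => ψ.symbols
  | mul ψ ψ' => ψ.symbols ∪ ψ'.symbols
  | add ψ ψ' => ψ.symbols ∪ ψ'.symbols
  | const _ => ∅

/-- The width: the maximum of `|free θ|` over all subformulas `θ`, both the ♯-subformulas and the
subformulas of the fo-formulas under casts. -/
def width : SharpFormula → ℕ
  | cast φ L => max L.card φ.width
  | proj V ψ => max (proj V ψ).free.card ψ.width
  | expand V ψ => max (expand V ψ).free.card ψ.width
  | mul ψ ψ' => max (mul ψ ψ').free.card (max ψ.width ψ'.width)
  | add ψ ψ' => max (add ψ ψ').free.card (max ψ.width ψ'.width)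
  | const _ => 0

open Classical in
/-- The value `[B, ψ](h)`. Assignments are defined on all variables, but by `eval_congr` below the
value only depends on the restriction of `h` to the free variables of `ψ`. In the case of a
projection, the sum ranges over all ways to assign values to the variables in `V`. -/
noncomputable def eval (B : FinStructure) : SharpFormula → (Var → B.carrier) → ℤ
  | cast φ _, h => if φ.Sat B h then 1 else 0
  | proj V ψ, h => ∑ k : V → B.carrier, ψ.eval B (override h V k)
  | expand _ ψ, h => ψ.eval B h
  | mul ψ ψ', h => ψ.eval B h * ψ'.eval B h
  | add ψ ψ', h => ψ.eval B h + ψ'.eval B h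
  | const n, _ => n

/-- The ♯-formula `ψ` is a representation of the prenex pp-formula `φ(V)`: it is a (well-formed)
♯-sentence, and for each finite structure `B` its value on `B` is `|φ(B)|`. -/
def Represents (ψ : SharpFormula) (φ : PrenexPP) : Prop :=
  ψ.WellFormed ∧ ψ.free = ∅ ∧
    ∀ (B : FinStructure) (h : Var → B.carrier), ψ.eval B h = ((φ.answers B).ncard : ℤ)

/-- An explicit Gödel numbering of ♯-formulas. -/
def code : SharpFormula → ℕ
  | cast φ L => Nat.pair 0 (Nat.pair φ.code (codeVars L))
  | proj V ψ => Nat.pair 1 (Nat.pair (codeVars V) ψ.code)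
  | expand V ψ => Nat.pair 2 (Nat.pair (codeVars V) ψ.code)
  | mul ψ ψ' => Nat.pair 3 (Nat.pair ψ.code ψ'.code)
  | add ψ ψ' => Nat.pair 4 (Nat.pair ψ.code ψ'.code)
  | const n => Nat.pair 5 (Encodable.encode n)

theorem code_injective : Function.Injective code := by
  intro φ
  induction φ with
  | cast φ L =>
    intro ψ h; cases ψ <;> simp [code, Nat.pair_eq_pair] at h ⊢
    exact ⟨FOFormula.code_injective h.1, codeVars_injective h.2⟩
  | proj V φ ih =>
    intro ψ h; cases ψ <;> simp [code, Nat.pair_eq_pair] at h ⊢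
    exact ⟨codeVars_injective h.1, ih h.2⟩
  | expand V φ ih =>
    intro ψ h; cases ψ <;> simp [code, Nat.pair_eq_pair] at h ⊢
    exact ⟨codeVars_injective h.1, ih h.2⟩
  | mul φ₁ φ₂ ih₁ ih₂ =>
    intro ψ h; cases ψ <;> simp [code, Nat.pair_eq_pair] at h ⊢; exact ⟨ih₁ h.1, ih₂ h.2⟩
  | add φ₁ φ₂ ih₁ ih₂ =>
    intro ψ h; cases ψ <;> simp [code, Nat.pair_eq_pair] at h ⊢; exact ⟨ih₁ h.1, ih₂ h.2⟩
  | const n => intro ψ h; cases ψ <;> simp [code, Nat.pair_eq_pair] at h ⊢; exact h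

end SharpFormula

/-! ### Values only depend on the free variables -/

theorem FOFormula.sat_congr (B : FinStructure) (φ : FOFormula) :
    ∀ g g' : Var → B.carrier, (∀ x ∈ φ.free, g x = g' x) → (φ.Sat B g ↔ φ.Sat B g') := by
  have upd : ∀ (s : Finset Var) (x : Var) (g g' : Var → B.carrier) (b : B.carrier),
      (∀ y ∈ s.erase x, g y = g' y) →
        ∀ y ∈ s, Function.update g x b y = Function.update g' x b y := by
    intro s x g g' b h y hy
    by_cases hyx : y = x
    · subst hyx; simp
    · simp [hyx, h y (Finset.mem_erase.2 ⟨hyx, hy⟩)]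
  induction φ with
  | tru => intro g g' _; exact Iff.rfl
  | atom R v =>
    intro g g' h
    have : (fun i => g (v i)) = fun i => g' (v i) :=
      funext fun i => h _ (Finset.mem_image_of_mem v (Finset.mem_univ i))
    simp only [Sat, this]
  | neg φ ih => intro g g' h; exact not_congr (ih g g' h)
  | and φ ψ ih₁ ih₂ =>
    intro g g' h
    exact and_congr (ih₁ g g' fun x hx => h x (Finset.mem_union_left _ hx))
      (ih₂ g g' fun x hx => h x (Finset.mem_union_right _ hx))
  | or φ ψ ih₁ ih₂ =>
    intro g g' h
    exact or_congr (ih₁ g g' fun x hx => h x (Finset.mem_union_left _ hx))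
      (ih₂ g g' fun x hx => h x (Finset.mem_union_right _ hx))
  | ex x φ ih => intro g g' h; exact exists_congr fun b => ih _ _ (upd _ x g g' b h)
  | all x φ ih => intro g g' h; exact forall_congr' fun b => ih _ _ (upd _ x g g' b h)

theorem SharpFormula.eval_congr (B : FinStructure) (ψ : SharpFormula) :
    ψ.WellFormed → ∀ h h' : Var → B.carrier, (∀ x ∈ ψ.free, h x = h' x) →
      ψ.eval B h = ψ.eval B h' := by
  induction ψ with
  | cast φ L =>
    intro wf h h' hh
    have e := FOFormula.sat_congr B φ h h' fun x hx => hh x (wf hx)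
    unfold eval
    split_ifs <;> simp_all
  | proj V ψ ih =>
    intro wf h h' hh
    refine Finset.sum_congr rfl fun k _ => ih wf.1 _ _ fun x hx => ?_
    by_cases hxV : x ∈ V
    · simp [override, hxV]
    · simpa [override, hxV] using hh x (Finset.mem_sdiff.2 ⟨hx, hxV⟩)
  | expand V ψ ih =>
    intro wf h h' hh
    exact ih wf.1 h h' fun x hx => hh x (Finset.mem_union_right _ hx)
  | mul ψ ψ' ih ih' =>
    intro wf h h' hh
    simp only [eval]
    rw [ih wf.1 h h' hh, ih' wf.2.1 h h' fun x hx => hh x (by rw [free, wf.2.2.1]; exact hx)]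
  | add ψ ψ' ih ih' =>
    intro wf h h' hh
    simp only [eval]
    rw [ih wf.1 h h' hh, ih' wf.2.1 h h' fun x hx => hh x (by rw [free, wf.2.2]; exact hx)]
  | const n => intro _ _ _ _; rfl

end SharpLogic

/-! Lower bound. A ♯PP-sentence of width `k` can be multiplied out into an integer linear
combination of counting functions of conjunctive queries. The nesting of the sentence gives each of
these queries an elimination order, quantified variables before liberal ones, whose bags have size
at most `k` (`FOFormula.IsPP.exists_flat`, `SharpFormula.exists_flat`). Counting functions are
multiplicative under direct products of structures, so they are characters, and distinct characters
are linearly independent. Hence, if the sentence counts the answers of the given query, a single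
query of the combination already does so (`exists_queryCount_eq_of_sum`).

Two queries with equal counts on all structures are compared through blow-ups, which refine the
counts to a polynomial whose monomials record the values of the answers. The squarefree monomial of
the identity answer on the canonical structure yields homomorphisms in both directions that are
bijective on the liberal variables (`exists_hom_of_queryCount_eq`). Among the endomorphisms of the
given query that permute its liberal variables, take one with smallest image. The homomorphism into
the other query is injective on this image, so the elimination order can be pulled back to it
(`Elim.pullback`, `exists_candidate`).

Upper bound. From such an endomorphism together with elimination orders, a ♯PP-representation is
built by eliminating quantified variables with `∃` over conjunctions and liberal ones with `P` over
products. Its width is at most the largest bag or atom (`IsCandidate.formula_spec`). There are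
finitely many candidates up to an explicit bound, so the best one is found by search, and the search
on Gödel numbers is primitive recursive. -/

namespace SharpLogic

/-! ### Conjunctive queries -/

/-- An atom, given by the name of its relation symbol and the list of its arguments. -/
abbrev QAtom : Type := ℕ × List ℕ

/-- The relation symbol of an atom. -/
def QAtom.symbol (a : QAtom) : RelSymbol := ⟨a.1, a.2.length⟩

/-- Substitution of variables in an atom. -/
def QAtom.map (h : ℕ → ℕ) (a : QAtom) : QAtom := (a.1, a.2.map h)

/-- The tuple `l` belongs to the relation with name `n` and arity the length of `l`. -/
def FinStructure.Holds (B : FinStructure) (n : ℕ) (l : List B.carrier) : Prop :=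
  l.get ∈ B.rel ⟨n, l.length⟩

theorem FinStructure.holds_ofFn (B : FinStructure) (n : ℕ) {a : ℕ} (v : Fin a → B.carrier) :
    B.Holds n (List.ofFn v) ↔ v ∈ B.rel ⟨n, a⟩ := by
  -- Generalizing over the list lets the equation between the arities be substituted, so no cast
  -- between tuple types remains.
  have key : ∀ (l : List B.carrier) (h : l.length = a), (∀ i : Fin a, l.get (i.cast h.symm) = v i) →
      (B.Holds n l ↔ v ∈ B.rel ⟨n, a⟩) := by
    rintro l rfl h
    have : v = l.get := funext fun i => (h i).symm
    rw [this]; rfl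
  exact key _ (by simp) (by simp)

/-- The structure `B` satisfies all atoms of the list `A` under the assignment `g`. -/
def FinStructure.Models (B : FinStructure) (g : ℕ → B.carrier) (A : List QAtom) : Prop :=
  ∀ a ∈ A, B.Holds a.1 (a.2.map g)

theorem FinStructure.models_congr {B : FinStructure} {g g' : ℕ → B.carrier} {A : List QAtom}
    (h : ∀ a ∈ A, ∀ x ∈ a.2, g x = g' x) : B.Models g A ↔ B.Models g' A := by
  refine forall₂_congr fun a ha => ?_
  rw [List.map_congr_left (h a ha)]

theorem FinStructure.models_append {B : FinStructure} {g : ℕ → B.carrier} {A C : List QAtom} :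
    B.Models g (A ++ C) ↔ B.Models g A ∧ B.Models g C := by
  simp [Models, or_imp, forall_and]

theorem FinStructure.models_map {B : FinStructure} {g : ℕ → B.carrier} {A : List QAtom}
    (h : ℕ → ℕ) : B.Models g (A.map (QAtom.map h)) ↔ B.Models (g ∘ h) A := by
  simp only [Models, List.forall_mem_map, QAtom.map, List.map_map]

/-- The answers of the conjunctive query with atoms `A` and liberal variables `V`; all variables
outside of `V` are existentially quantified. -/
def queryAnswers (V : Finset ℕ) (A : List QAtom) (B : FinStructure) : Set (V → B.carrier) :=
  {k | ∃ g : ℕ → B.carrier, (∀ x : V, g x = k x) ∧ B.Models g A}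

/-- The number of answers of a conjunctive query. -/
noncomputable def queryCount (V : Finset ℕ) (A : List QAtom) (B : FinStructure) : ℕ :=
  (queryAnswers V A B).ncard

/-! ### Products and linear independence -/

/-- The direct product of two structures. -/
abbrev FinStructure.prod (B C : FinStructure) : FinStructure where
  carrier := B.carrier × C.carrier
  rel R := {f | (fun i => (f i).1) ∈ B.rel R ∧ (fun i => (f i).2) ∈ C.rel R}

theorem FinStructure.holds_prod (B C : FinStructure) (n : ℕ) (l : List (B.carrier × C.carrier)) :
    (B.prod C).Holds n l ↔ B.Holds n (l.map Prod.fst) ∧ C.Holds n (l.map Prod.snd) := by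
  rw [← List.ofFn_get l, List.map_ofFn, List.map_ofFn, B.holds_ofFn, C.holds_ofFn]
  exact (B.prod C).holds_ofFn n l.get

theorem FinStructure.models_prod (B C : FinStructure) (g : ℕ → B.carrier × C.carrier)
    (A : List QAtom) :
    (B.prod C).Models g A ↔ B.Models (Prod.fst ∘ g) A ∧ C.Models (Prod.snd ∘ g) A := by
  simp only [Models, ← forall_and]
  refine forall₂_congr fun a _ => ?_
  have := holds_prod B C a.1 (a.2.map g)
  rw [List.map_map, List.map_map] at this
  exact this

/-- The one-element structure in which all relations are full. -/
abbrev FinStructure.unit : FinStructure where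
  carrier := Unit
  rel _ := Set.univ

/-- Witnesses for quantified variables can be chosen in each coordinate separately, so an answer in
the product is a pair of answers. -/
theorem queryCount_prod (V : Finset ℕ) (A : List QAtom) (B C : FinStructure) :
    queryCount V A (B.prod C) = queryCount V A B * queryCount V A C := by
  unfold queryCount
  rw [← Set.ncard_prod]
  refine Set.ncard_congr (fun k _ => (Prod.fst ∘ k, Prod.snd ∘ k)) ?_ ?_ ?_
  · rintro k ⟨g, hg, hA⟩
    rw [FinStructure.models_prod] at hA
    exact ⟨⟨_, fun x => congrArg Prod.fst (hg x), hA.1⟩, ⟨_, fun x => congrArg Prod.snd (hg x), hA.2⟩⟩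
  · intro k k' _ _ h
    have h := Prod.mk.inj h
    exact funext fun x => Prod.ext (congrFun h.1 x) (congrFun h.2 x)
  · rintro ⟨k, k'⟩ ⟨⟨g, hg, hA⟩, ⟨g', hg', hA'⟩⟩
    refine ⟨fun x => (k x, k' x), ⟨fun x => (g x, g' x), fun x => ?_, ?_⟩, rfl⟩
    · exact Prod.ext (hg x) (hg' x)
    · exact (FinStructure.models_prod B C (fun x => (g x, g' x)) A).2 ⟨hA, hA'⟩

theorem queryCount_unit (V : Finset ℕ) (A : List QAtom) :
    queryCount V A FinStructure.unit = 1 := by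
  rw [queryCount, Set.ncard_eq_one]
  refine ⟨fun _ => (), Set.eq_singleton_iff_unique_mem.2 ⟨?_, fun _ _ => rfl⟩⟩
  exact ⟨fun _ => (), fun _ => rfl, fun _ _ => trivial⟩

/-- The product of a list of structures. -/
def FinStructure.listProd (w : List FinStructure) : FinStructure := w.foldr FinStructure.prod .unit

/-- The number of answers as a character of the free monoid on the finite structures. -/
noncomputable def queryCharacter (V : Finset ℕ) (A : List QAtom) : FreeMonoid FinStructure →* ℤ :=
  FreeMonoid.lift fun B => (queryCount V A B : ℤ)

/-- Structures form a monoid under products only up to isomorphism. Words avoid this, and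
multiplicativity turns the value at a word into a count on a genuine structure, so a relation
between counts on all structures becomes one between characters. -/
theorem queryCharacter_apply (V : Finset ℕ) (A : List QAtom) (w : FreeMonoid FinStructure) :
    queryCharacter V A w = queryCount V A (FinStructure.listProd w.toList) := by
  refine FreeMonoid.inductionOn' w ?_ fun B w ih => ?_
  · simp [FinStructure.listProd, queryCount_unit]
  · rw [map_mul, ih, queryCharacter, FreeMonoid.lift_eval_of]
    simp [FinStructure.listProd, queryCount_prod]

/-- If the count of a query is a linear combination of counts of queries, then it is equal to one
of those counts. -/
theorem exists_queryCount_eq_of_sum {ι : Type*} (V : Finset ℕ) (A : List QAtom) (T : List ι)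
    (c : ι → ℤ) (W : ι → Finset ℕ) (C : ι → List QAtom)
    (h : ∀ B, (queryCount V A B : ℤ) = (T.map fun t => c t * queryCount (W t) (C t) B).sum) :
    ∃ t ∈ T, ∀ B, queryCount V A B = queryCount (W t) (C t) B := by
  by_contra! hne
  -- Dedekind's theorem on the independence of characters.
  have hli := linearIndependent_monoidHom (FreeMonoid FinStructure) ℤ
  let s : Set (FreeMonoid FinStructure →* ℤ) := {f | ∃ t ∈ T, f = queryCharacter (W t) (C t)}
  have hs : queryCharacter V A ∉ s := by
    rintro ⟨t, ht, he⟩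
    -- A structure on which the counts differ, read as a one-letter word, separates the two
    -- characters.
    obtain ⟨B, hB⟩ := hne t ht
    apply hB
    have := DFunLike.congr_fun he (FreeMonoid.of B)
    simpa [queryCharacter] using this
  refine hli.notMem_span_image hs ?_
  have he : (queryCharacter V A : FreeMonoid FinStructure → ℤ) =
      (T.map fun t => c t • (queryCharacter (W t) (C t) : FreeMonoid FinStructure → ℤ)).sum := by
    funext w
    rw [queryCharacter_apply, h]
    have : ∀ T' : List ι,
        (T'.map fun t => c t • (queryCharacter (W t) (C t) : FreeMonoid FinStructure → ℤ)).sum w =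
        (T'.map fun t => c t *
          (queryCount (W t) (C t) (FinStructure.listProd w.toList) : ℤ)).sum := by
      intro T'
      induction T' with
      | nil => simp
      | cons t T' ih => simp only [List.map_cons, List.sum_cons, Pi.add_apply, ih, Pi.smul_apply,
          smul_eq_mul, queryCharacter_apply]
    rw [this]
  rw [he]
  refine list_sum_mem fun f hf => ?_
  obtain ⟨t, ht, rfl⟩ := List.mem_map.1 hf
  exact Submodule.smul_mem _ _ (Submodule.subset_span ⟨_, ⟨t, ht, rfl⟩, rfl⟩)

/-! ### Blow-ups and renaming equivalence -/

/-- The structure obtained from `B` by replacing each element `b` by `w b + 1` copies. -/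
abbrev FinStructure.blowup (B : FinStructure) (w : B.carrier → ℕ) : FinStructure where
  carrier := Σ b, Fin (w b + 1)
  nonempty := ⟨⟨Classical.arbitrary _, 0⟩⟩
  rel R := {f | (fun i => (f i).1) ∈ B.rel R}

theorem FinStructure.models_blowup (B : FinStructure) (w : B.carrier → ℕ)
    (g : ℕ → (Σ b, Fin (w b + 1))) (A : List QAtom) :
    (B.blowup w).Models g A ↔ B.Models (Sigma.fst ∘ g) A := by
  refine forall₂_congr fun a _ => ?_
  rw [← List.ofFn_get a.2, List.map_ofFn, List.map_ofFn, B.holds_ofFn]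
  exact (B.blowup w).holds_ofFn a.1 (g ∘ a.2.get)

-- Whether an assignment into the blow-up is an answer depends only on its projection `f` to `B`,
-- and `f` has one lift for each choice of copies of the values of the liberal variables.
open Classical in
theorem queryCount_blowup (V : Finset ℕ) (A : List QAtom) (B : FinStructure) (w : B.carrier → ℕ) :
    queryCount V A (B.blowup w) =
      ∑ f : V → B.carrier, if f ∈ queryAnswers V A B then ∏ v, (w (f v) + 1) else 0 := by
  have hmem : ∀ k : V → (Σ b, Fin (w b + 1)),
      k ∈ queryAnswers V A (B.blowup w) ↔ (fun v => (k v).1) ∈ queryAnswers V A B := by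
    intro k
    constructor
    · rintro ⟨g, hg, hA⟩
      exact ⟨_, fun x => congrArg Sigma.fst (hg x), (B.models_blowup w g A).1 hA⟩
    · rintro ⟨g, hg, hA⟩
      -- Outside of `V` any copy will do; copy `0` is always there because `b` has `w b + 1` copies.
      refine ⟨fun x => if hx : x ∈ V then k ⟨x, hx⟩ else ⟨g x, 0⟩, fun x => by simp, ?_⟩
      rw [B.models_blowup w]
      convert hA using 1
      funext x
      by_cases hx : x ∈ V
      · simp [hx, ← hg ⟨x, hx⟩]
      · simp [hx]
  let e : queryAnswers V A (B.blowup w) ≃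
      Σ f : queryAnswers V A B, ∀ v, Fin (w (f.1 v) + 1) :=
    { toFun := fun k => ⟨⟨_, (hmem k.1).1 k.2⟩, fun v => (k.1 v).2⟩
      invFun := fun p => ⟨fun v => ⟨p.1.1 v, p.2 v⟩, (hmem _).2 p.1.2⟩
      left_inv := fun k => rfl
      right_inv := fun p => rfl }
  rw [queryCount, ← Nat.card_coe_set_eq, Nat.card_congr e, Nat.card_eq_fintype_card,
    Fintype.card_sigma, ← Finset.sum_filter]
  simp only [Fintype.card_pi, Fintype.card_fin]
  exact (Finset.sum_subtype _ (p := fun f => f ∈ queryAnswers V A B) (by simp)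
    fun f => ∏ v, (w (f v) + 1)).symm

open Classical in
/-- The polynomial whose monomials are the multisets of values of the answers of a query. -/
noncomputable def queryPoly (V : Finset ℕ) (A : List QAtom) (B : FinStructure) :
    MvPolynomial B.carrier ℚ :=
  ∑ f : V → B.carrier, if f ∈ queryAnswers V A B then
    MvPolynomial.monomial (∑ v, Finsupp.single (f v) 1) 1 else 0

/-- The numbers of copies become the coordinates of the evaluation point. -/
theorem eval_queryPoly (V : Finset ℕ) (A : List QAtom) (B : FinStructure) (w : B.carrier → ℕ) :
    MvPolynomial.eval (fun b => (w b + 1 : ℚ)) (queryPoly V A B) =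
      queryCount V A (B.blowup w) := by
  classical
  rw [queryCount_blowup, queryPoly, map_sum, Nat.cast_sum]
  refine Finset.sum_congr rfl fun f _ => ?_
  split_ifs with h
  · rw [MvPolynomial.monomial_sum_one, map_prod]
    simp only [Nat.cast_prod]
    refine Finset.prod_congr rfl fun v _ => ?_
    simp [MvPolynomial.eval_monomial]
  · simp

/-- Equal counts on all blow-ups mean that the polynomials agree at all points with positive integer
coordinates, an infinite grid. -/
theorem queryPoly_eq {V W : Finset ℕ} {A C : List QAtom}
    (h : ∀ B, queryCount V A B = queryCount W C B) (B : FinStructure) :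
    queryPoly V A B = queryPoly W C B := by
  refine MvPolynomial.funext_set (fun _ => Set.range fun n : ℕ => (n + 1 : ℚ)) (fun _ => ?_) ?_
  · exact Set.infinite_range_of_injective fun a b hab => by simpa using hab
  · intro x hx
    choose w hw using fun b => hx b (Set.mem_univ b)
    obtain rfl : (fun b => (w b + 1 : ℚ)) = x := funext hw
    rw [eval_queryPoly, eval_queryPoly, h]

/-- The canonical structure of a list of atoms with variables below `M + 1`. -/
abbrev canonicalStructure (M : ℕ) (A : List QAtom) : FinStructure where
  carrier := Fin (M + 1)
  rel R := {f | (R.name, List.ofFn fun i => (f i).val) ∈ A}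

/-- Satisfying assignments in the canonical structure are homomorphisms into `A`, as in the
Chandra–Merlin theorem. -/
theorem models_canonicalStructure (M : ℕ) (A C : List QAtom) (g : ℕ → Fin (M + 1)) :
    (canonicalStructure M A).Models g C ↔ ∀ c ∈ C, c.map (fun x => (g x).val) ∈ A := by
  refine forall₂_congr fun c _ => ?_
  have := (canonicalStructure M A).holds_ofFn c.1 (g ∘ c.2.get)
  rw [← List.map_ofFn, List.ofFn_get] at this
  rw [this]
  simp only [canonicalStructure, Set.mem_ofPred_eq, QAtom.map]
  rw [show (fun i => ((g ∘ c.2.get) i).val) = (fun x => (g x).val) ∘ c.2.get from rfl,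
    ← List.map_ofFn, List.ofFn_get]

/-- Queries with the same counts are equivalent up to a renaming of the liberal variables. -/
theorem exists_hom_of_queryCount_eq {V W : Finset ℕ} {A C : List QAtom} (M : ℕ)
    (hV : ∀ x ∈ V, x < M + 1) (hA : ∀ a ∈ A, ∀ x ∈ a.2, x < M + 1)
    (h : ∀ B, queryCount V A B = queryCount W C B) :
    ∃ g : ℕ → ℕ, (∀ x, g x < M + 1) ∧ (∀ c ∈ C, c.map g ∈ A) ∧ Set.BijOn g W V := by
  classical
  set B := canonicalStructure M A with hB
  -- The identity answer: its monomial is squarefree, with one factor for each liberal variable.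
  let f₀ : V → Fin (M + 1) := fun v => ⟨v.1, hV v v.2⟩
  have hf₀ : f₀ ∈ queryAnswers V A B := by
    refine ⟨fun x => if hx : x < M + 1 then ⟨x, hx⟩ else 0, fun x => ?_, ?_⟩
    · simp [hV x x.2, f₀]
    · rw [models_canonicalStructure]
      intro c hc
      have : c.map (fun x => ((if hx : x < M + 1 then ⟨x, hx⟩ else 0 : Fin (M + 1))).val) = c := by
        refine Prod.ext rfl ?_
        conv_rhs => rw [← List.map_id c.2]
        refine List.map_congr_left fun x hx => ?_
        simp [hA c hc x hx]
      rwa [this]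
  have hcoeff : ∀ (U : Finset ℕ) (D : List QAtom) (m : B.carrier →₀ ℕ),
      MvPolynomial.coeff m (queryPoly U D B) =
      ∑ f : U → B.carrier,
        if f ∈ queryAnswers U D B ∧ ∑ v, Finsupp.single (f v) 1 = m then (1 : ℚ) else 0 := by
    intro U D m
    rw [queryPoly, MvPolynomial.coeff_sum]
    refine Finset.sum_congr rfl fun f _ => ?_
    split_ifs with h1 h2 h3
    · rw [MvPolynomial.coeff_monomial, if_pos h2.2]
    · rw [MvPolynomial.coeff_monomial, if_neg fun h => h2 ⟨h1, h⟩]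
    · exact absurd h3.1 h1
    · simp
  -- Coefficients count answers, so nothing cancels, and the other query must have an answer with
  -- the same monomial.
  have hpos : 0 < MvPolynomial.coeff (∑ v, Finsupp.single (f₀ v) 1) (queryPoly W C B) := by
    rw [← queryPoly_eq h, hcoeff]
    refine Finset.sum_pos' (fun _ _ => by positivity) ⟨f₀, Finset.mem_univ _, ?_⟩
    rw [if_pos ⟨hf₀, rfl⟩]; exact one_pos
  rw [hcoeff] at hpos
  obtain ⟨f, -, hf⟩ := Finset.exists_ne_zero_of_sum_ne_zero hpos.ne'
  rw [ne_eq, ite_eq_right_iff, Classical.not_imp] at hf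
  obtain ⟨⟨⟨g, hg, hC⟩, hm⟩, -⟩ := hf
  rw [models_canonicalStructure] at hC
  have hcount : ∀ j : Fin (M + 1), (Finset.univ.filter fun w : W => f w = j).card =
      (Finset.univ.filter fun v : V => f₀ v = j).card := by
    intro j
    have := DFunLike.congr_fun hm j
    rw [Finsupp.finsetSum_apply, Finsupp.finsetSum_apply] at this
    simp only [Finsupp.single_apply] at this
    rw [Finset.card_filter, Finset.card_filter]
    exact this
  -- Squarefreeness. Together with `hcount` it makes the answer of the other query a bijection from
  -- `W` onto `V`.
  have hle : ∀ j : Fin (M + 1), (Finset.univ.filter fun v : V => f₀ v = j).card ≤ 1 := by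
    intro j
    rw [Finset.card_le_one]
    intro a ha b hb
    simp only [Finset.mem_filter, Finset.mem_univ, true_and] at ha hb
    exact Subtype.ext (by simpa [f₀] using ha.trans hb.symm)
  refine ⟨fun x => (g x).val, fun x => (g x).isLt, hC, ?_, ?_, ?_⟩
  · intro w hw
    have h1 : 0 < (Finset.univ.filter fun w' : W => f w' = g w).card :=
      Finset.card_pos.2 ⟨⟨w, hw⟩, by simpa using (hg ⟨w, hw⟩).symm⟩
    rw [hcount] at h1
    obtain ⟨v, hv⟩ := Finset.card_pos.1 h1
    simp only [Finset.mem_filter, Finset.mem_univ, true_and] at hv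
    have : (g w).val = v := by rw [← hv]
    exact Set.mem_of_eq_of_mem this v.2
  · intro w hw w' hw' he
    have h1 := hle (g w)
    rw [← hcount, Finset.card_le_one] at h1
    have h2 := h1 ⟨w, hw⟩ (by simpa using (hg ⟨w, hw⟩).symm) ⟨w', hw'⟩
      (by simpa [← hg ⟨w', hw'⟩] using (Fin.ext he).symm)
    simpa using h2
  · intro v hv
    have h1 : 0 < (Finset.univ.filter fun v' : V => f₀ v' = f₀ ⟨v, hv⟩).card :=
      Finset.card_pos.2 ⟨⟨v, hv⟩, by simp⟩
    rw [← hcount] at h1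
    obtain ⟨w, hw⟩ := Finset.card_pos.1 h1
    simp only [Finset.mem_filter, Finset.mem_univ, true_and] at hw
    refine ⟨w, w.2, ?_⟩
    have := hg w
    simp only [this, hw, f₀]


/-! ### Iterated sums -/

/-- The sum of `F` over all ways to change the values of `g` on `V`. -/
noncomputable def sumOver {β : Type} [Fintype β] (V : Finset ℕ) (F : (ℕ → β) → ℤ) (g : ℕ → β) : ℤ :=
  ∑ k : V → β, F (override g V k)

section sumOver

variable {β : Type} [Fintype β]

theorem sumOver_congr {V : Finset ℕ} {F G : (ℕ → β) → ℤ} {g : ℕ → β}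
    (h : ∀ f, (∀ x ∉ V, f x = g x) → F f = G f) : sumOver V F g = sumOver V G g :=
  Finset.sum_congr rfl fun k _ => h _ fun x hx => by simp [override, hx]

theorem sumOver_congr_assignment {V : Finset ℕ} {F : (ℕ → β) → ℤ} {g g' : ℕ → β} {W : Finset ℕ}
    (hF : ∀ f f', (∀ x ∉ W, f x = f' x) → F f = F f') (hg : ∀ x ∉ W, g x = g' x) :
    sumOver V F g = sumOver V F g' := by
  refine Finset.sum_congr rfl fun k _ => hF _ _ fun x hx => ?_
  simp [override, hg x hx]

theorem sumOver_empty (F : (ℕ → β) → ℤ) (g : ℕ → β) : sumOver ∅ F g = F g := by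
  have : ∀ k : (∅ : Finset ℕ) → β, override g ∅ k = g := fun k => by funext x; simp [override]
  simp [sumOver, this]

theorem sumOver_insert {V : Finset ℕ} {x : ℕ} (hx : x ∉ V) (F : (ℕ → β) → ℤ) (g : ℕ → β) :
    sumOver (insert x V) F g = ∑ b, sumOver V F (Function.update g x b) := by
  unfold sumOver
  rw [← Fintype.sum_prod_type']
  let e : (↥(insert x V) → β) ≃ β × (V → β) :=
    { toFun := fun k => (k ⟨x, Finset.mem_insert_self x V⟩,
        fun v => k ⟨v, Finset.mem_insert_of_mem v.2⟩)
      invFun := fun p y => if h : y.1 ∈ V then p.2 ⟨y, h⟩ else p.1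
      left_inv := by
        intro k
        funext ⟨y, hy⟩
        by_cases h : y ∈ V
        · simp [h]
        · obtain rfl : y = x := (Finset.mem_insert.1 hy).resolve_right h
          simp [h]
      right_inv := by
        rintro ⟨b, k⟩
        simp [hx] }
  refine Fintype.sum_equiv e _ _ fun k => congrArg F ?_
  funext y
  by_cases hy : y ∈ V
  · simp [override, hy, e]
  · by_cases hyx : y = x
    · subst hyx; simp [override, hy, e]
    · simp [override, hy, hyx]

theorem sumOver_union {V W : Finset ℕ} (h : Disjoint V W) (F : (ℕ → β) → ℤ) (g : ℕ → β) :
    sumOver (V ∪ W) F g = sumOver V (sumOver W F) g := by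
  induction V using Finset.induction_on generalizing g with
  | empty => rw [Finset.empty_union, sumOver_empty]
  | insert x V hx ih =>
    rw [Finset.disjoint_insert_left] at h
    rw [Finset.insert_union, sumOver_insert (by simp [hx, h.1]), sumOver_insert hx]
    exact Finset.sum_congr rfl fun b _ => ih h.2 _

theorem sumOver_const_mul (V : Finset ℕ) (c : ℤ) (F : (ℕ → β) → ℤ) (g : ℕ → β) :
    sumOver V (fun f => c * F f) g = c * sumOver V F g :=
  (Finset.mul_sum _ _ _).symm

theorem sumOver_list_sum {ι : Type*} (V : Finset ℕ) (T : List ι) (F : ι → (ℕ → β) → ℤ)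
    (g : ℕ → β) :
    sumOver V (fun f => (T.map fun t => F t f).sum) g = (T.map fun t => sumOver V (F t) g).sum := by
  induction T with
  | nil => simp [sumOver]
  | cons t T ih =>
    simp only [List.map_cons, List.sum_cons, ← ih]
    exact Finset.sum_add_distrib

/-- Each factor ignores the variables over which the other one is summed, so this is distributivity.
-/
theorem sumOver_mul {V W : Finset ℕ} (h : Disjoint V W) {F G : (ℕ → β) → ℤ}
    (hF : ∀ f f', (∀ x ∉ W, f x = f' x) → F f = F f')
    (hG : ∀ f f', (∀ x ∉ V, f x = f' x) → G f = G f') (g : ℕ → β) :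
    sumOver V F g * sumOver W G g = sumOver (V ∪ W) (fun f => F f * G f) g := by
  rw [sumOver_union h, mul_comm, ← sumOver_const_mul]
  refine sumOver_congr fun f hf => ?_
  rw [sumOver_congr_assignment hG fun x hx => (hf x hx).symm, mul_comm, ← sumOver_const_mul]
  exact sumOver_congr fun f' hf' => by rw [hF f f' fun x hx => (hf' x hx).symm]

end sumOver

/-! ### Elimination of variables in hypergraphs -/

/-- Each edge of `H` is contained in an edge of `H'`. -/
def Dominated (H H' : Set (Finset ℕ)) : Prop := ∀ e ∈ H, ∃ e' ∈ H', e ⊆ e'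

theorem Dominated.trans {H H' H'' : Set (Finset ℕ)} (h : Dominated H H') (h' : Dominated H' H'') :
    Dominated H H'' := fun e he => by
  obtain ⟨e', he', h1⟩ := h e he
  obtain ⟨e'', he'', h2⟩ := h' e' he'
  exact ⟨e'', he'', h1.trans h2⟩

/-- The hypergraph `H` can be turned into one dominated by `H'` by eliminating the variables of the
list in order, where the edges at an eliminated variable fit into a bag of size at most `k`. -/
inductive Elim (k : ℕ) : Set (Finset ℕ) → List ℕ → Set (Finset ℕ) → Prop
  | nil {H H' : Set (Finset ℕ)} (h : Dominated H H') : Elim k H [] H'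
  | cons {H H' : Set (Finset ℕ)} {l : List ℕ} (x : ℕ) (U : Finset ℕ)
      (hU : ∀ e ∈ H, x ∈ e → e ⊆ U) (hk : U.card ≤ k)
      (h : Elim k (insert (U.erase x) {e | e ∈ H ∧ x ∉ e}) l H') : Elim k H (x :: l) H'

/-- The same bags work. An edge without `x` whose dominating edge contains `x` is absorbed by the
new edge `U.erase x`. -/
theorem Elim.mono_left {k : ℕ} {H H' : Set (Finset ℕ)} {l : List ℕ} (h : Elim k H l H') :
    ∀ {H₁ : Set (Finset ℕ)}, Dominated H₁ H → Elim k H₁ l H' := by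
  induction h with
  | nil h => intro H₁ h₁; exact .nil (h₁.trans h)
  | cons x U hU hk _ ih =>
    intro H₁ h₁
    have hU' : ∀ e ∈ H₁, x ∈ e → e ⊆ U := fun e he hx => by
      obtain ⟨e', he', h2⟩ := h₁ e he
      exact h2.trans (hU e' he' (h2 hx))
    refine .cons x U hU' hk (ih ?_)
    rintro e (rfl | ⟨he, hx⟩)
    · exact ⟨_, Or.inl rfl, subset_rfl⟩
    · obtain ⟨e', he', h2⟩ := h₁ e he
      by_cases hx' : x ∈ e'
      · exact ⟨_, Or.inl rfl, fun y hy => Finset.mem_erase.2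
          ⟨fun h => hx (h ▸ hy), hU e' he' hx' (h2 hy)⟩⟩
      · exact ⟨e', Or.inr ⟨he', hx'⟩, h2⟩

theorem Elim.append {k : ℕ} {H H' H'' : Set (Finset ℕ)} {l l' : List ℕ} (h : Elim k H l H')
    (h' : Elim k H' l' H'') : Elim k H (l ++ l') H'' := by
  induction h with
  | nil h => exact h'.mono_left h
  | cons x U hU hk _ ih => exact .cons x U hU hk (ih h')

theorem Elim.mono_right {k : ℕ} {H H' H'' : Set (Finset ℕ)} {l : List ℕ} (h : Elim k H l H')
    (h' : Dominated H' H'') : Elim k H l H'' := by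
  simpa using h.append (.nil h')

/-- Edges that avoid the eliminated variables never enter a bag. This lets eliminations in different
parts of a hypergraph be run one after the other. -/
theorem Elim.frame {k : ℕ} {H H' : Set (Finset ℕ)} {l : List ℕ} (h : Elim k H l H')
    {K : Set (Finset ℕ)} (hK : ∀ e ∈ K, ∀ x ∈ l, x ∉ e) : Elim k (H ∪ K) l (H' ∪ K) := by
  induction h with
  | nil h =>
    refine .nil ?_
    rintro e (he | he)
    · obtain ⟨e', he', h'⟩ := h e he
      exact ⟨e', Or.inl he', h'⟩
    · exact ⟨e, Or.inr he, subset_rfl⟩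
  | cons x U hU hk _ ih =>
    refine .cons x U ?_ hk ((ih fun e he y hy => hK e he y (List.mem_cons_of_mem _ hy)).mono_left ?_)
    · rintro e (he | he) hx
      · exact hU e he hx
      · exact absurd hx (hK e he x List.mem_cons_self)
    · rintro e (rfl | ⟨he | he, hx⟩)
      · exact ⟨_, Or.inl (Or.inl rfl), subset_rfl⟩
      · exact ⟨e, Or.inl (Or.inr ⟨he, hx⟩), subset_rfl⟩
      · exact ⟨e, Or.inr he, subset_rfl⟩

/-- A single small edge serves as its own bag throughout. It will be the edge of the free variables
of a ♯-formula from which some variables are projected away. -/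
theorem Elim.singleton {k : ℕ} (l : List ℕ) : ∀ {F : Finset ℕ}, F.card ≤ k →
    Elim k {F} l {F \ l.toFinset} := by
  induction l with
  | nil => intro F _; exact .nil fun e he => ⟨F, by simp, by rw [he]⟩
  | cons x l ih =>
    intro F hF
    refine .cons x F (fun e he _ => by rw [he]) hF
      ((ih ((Finset.card_le_card (Finset.erase_subset x F)).trans hF)).mono_left ?_
        |>.mono_right ?_)
    · rintro e (rfl | ⟨he, hx⟩)
      · exact ⟨_, rfl, subset_rfl⟩
      · obtain rfl : e = F := he
        exact ⟨_, rfl, fun y hy => Finset.mem_erase.2 ⟨fun h => hx (h ▸ hy), hy⟩⟩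
    · rintro e rfl
      refine ⟨_, rfl, fun y hy => ?_⟩
      simp only [Finset.mem_sdiff, Finset.mem_erase, List.mem_toFinset, List.mem_cons] at hy ⊢
      tauto

/-- The hypergraph of a list of atoms. -/
def atomEdges (A : List QAtom) : Set (Finset ℕ) := {e | ∃ a ∈ A, e = a.2.toFinset}

theorem atomEdges_append (A C : List QAtom) : atomEdges (A ++ C) = atomEdges A ∪ atomEdges C := by
  ext e
  simp only [atomEdges, List.mem_append, Set.mem_ofPred_eq, Set.mem_union]
  constructor
  · rintro ⟨a, ha | ha, rfl⟩
    exacts [Or.inl ⟨a, ha, rfl⟩, Or.inr ⟨a, ha, rfl⟩]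
  · rintro (⟨a, ha, rfl⟩ | ⟨a, ha, rfl⟩)
    exacts [⟨a, Or.inl ha, rfl⟩, ⟨a, Or.inr ha, rfl⟩]

/-! ### Flattening of pp-formulas -/

/-- The values of `f` on the variables in `l` can be changed such that the atoms in `A` hold. -/
def FinStructure.Solves (B : FinStructure) (A : List QAtom) (l : List ℕ) (f : ℕ → B.carrier) :
    Prop := ∃ g : ℕ → B.carrier, (∀ x ∉ l, g x = f x) ∧ B.Models g A

theorem FinStructure.solves_of_agree {B : FinStructure} {A : List QAtom} {l : List ℕ}
    {f f' : ℕ → B.carrier} (h : ∀ a ∈ A, ∀ x ∈ a.2, x ∉ l → f x = f' x) (hf : B.Solves A l f) :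
    B.Solves A l f' := by
  classical
  obtain ⟨g, hg, hA⟩ := hf
  refine ⟨fun x => if x ∈ l then g x else f' x, fun x hx => by simp [hx], ?_⟩
  refine (FinStructure.models_congr fun a ha x hx => ?_).1 hA
  by_cases hl : x ∈ l
  · simp [hl]
  · simp [hl, hg x hl, h a ha x hx hl]

theorem FinStructure.solves_congr {B : FinStructure} {A : List QAtom} {l : List ℕ}
    {f f' : ℕ → B.carrier} (h : ∀ a ∈ A, ∀ x ∈ a.2, x ∉ l → f x = f' x) :
    B.Solves A l f ↔ B.Solves A l f' :=
  ⟨solves_of_agree h, solves_of_agree fun a ha x hx hl => (h a ha x hx hl).symm⟩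

/-- Witnesses for disjoint sets of quantified variables can be merged when neither part mentions
those of the other. -/
theorem FinStructure.solves_append {B : FinStructure} {A C : List QAtom} {l l' : List ℕ}
    {f : ℕ → B.carrier} (hA : ∀ a ∈ A, ∀ x ∈ a.2, x ∉ l') (hC : ∀ a ∈ C, ∀ x ∈ a.2, x ∉ l) :
    B.Solves (A ++ C) (l ++ l') f ↔ B.Solves A l f ∧ B.Solves C l' f := by
  classical
  constructor
  · rintro ⟨g, hg, h⟩
    rw [models_append] at h
    simp only [List.mem_append, not_or] at hg
    exact ⟨solves_of_agree (fun a ha x hx hl => hg x ⟨hl, hA a ha x hx⟩) ⟨g, fun _ _ => rfl, h.1⟩,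
      solves_of_agree (fun a ha x hx hl => hg x ⟨hC a ha x hx, hl⟩) ⟨g, fun _ _ => rfl, h.2⟩⟩
  · rintro ⟨⟨g, hg, h⟩, ⟨g', hg', h'⟩⟩
    refine ⟨fun x => if x ∈ l then g x else if x ∈ l' then g' x else f x, fun x hx => ?_, ?_⟩
    · simp only [List.mem_append, not_or] at hx
      simp [hx.1, hx.2]
    · rw [models_append]
      refine ⟨(models_congr fun a ha x hx => ?_).1 h, (models_congr fun a ha x hx => ?_).1 h'⟩
      · by_cases hl : x ∈ l
        · simp [hl]
        · simp [hl, hA a ha x hx, hg x hl]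
      · by_cases hl : x ∈ l'
        · simp [hl, hC a ha x hx]
        · simp [hl, hC a ha x hx, hg' x hl]

theorem FOFormula.free_card_le_width (φ : FOFormula) : φ.free.card ≤ φ.width := by
  cases φ <;> simp [width, free]

/-- A pp-formula of width `k` is a conjunctive query whose quantified variables can be eliminated
at width `k`. -/
theorem FOFormula.IsPP.exists_flat {k : ℕ} {θ : FOFormula} :
    θ.IsPP → θ.width ≤ k → ∀ (ρ : ℕ → ℕ) (m : ℕ), (∀ x ∈ θ.free, ρ x < m) →
    ∃ (A : List QAtom) (l : List ℕ) (m' : ℕ), m ≤ m' ∧ (∀ x ∈ l, m ≤ x ∧ x < m') ∧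
      (∀ a ∈ A, ∀ x ∈ a.2, x ∈ θ.free.image ρ ∨ x ∈ l) ∧
      (∀ a ∈ A, a.2.toFinset.card ≤ k) ∧
      (∀ (B : FinStructure) (g : ℕ → B.carrier), θ.Sat B (g ∘ ρ) ↔ B.Solves A l g) ∧
      Elim k (atomEdges A) l {θ.free.image ρ} := by
  induction θ with
  | tru =>
    intro _ _ ρ m _
    refine ⟨[], [], m, le_rfl, by simp, by simp, by simp, fun B g => ?_, .nil ?_⟩
    · simpa [Sat, FinStructure.Solves, FinStructure.Models] using ⟨g, fun _ => rfl⟩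
    · rintro e ⟨a, ha, -⟩; simp at ha
  | atom R v =>
    intro _ hk ρ m _
    have hfree : (List.ofFn (ρ ∘ v)).toFinset = (atom R v).free.image ρ := by
      ext x; simp [free, List.mem_ofFn]
    refine ⟨[(R.name, List.ofFn (ρ ∘ v))], [], m, le_rfl, by simp, ?_, ?_, fun B g => ?_, .nil ?_⟩
    · intro a ha x hx
      rw [List.mem_singleton] at ha
      subst ha
      exact Or.inl (by rw [← hfree]; simpa using hx)
    · intro a ha
      rw [List.mem_singleton] at ha
      subst ha
      rw [hfree]
      exact Finset.card_image_le.trans ((free_card_le_width _).trans hk)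
    · have h1 : B.Solves [(R.name, List.ofFn (ρ ∘ v))] [] g ↔
          B.Models g [(R.name, List.ofFn (ρ ∘ v))] := by
        constructor
        · rintro ⟨g', hg', h⟩
          obtain rfl : g' = g := funext fun x => hg' x (by simp)
          exact h
        · intro h; exact ⟨g, fun _ _ => rfl, h⟩
      rw [h1]
      simp only [FinStructure.Models, List.forall_mem_singleton, List.map_ofFn, B.holds_ofFn]
      rfl
    · rintro e ⟨a, ha, rfl⟩
      rw [List.mem_singleton] at ha
      subst ha
      exact ⟨_, rfl, hfree.subset⟩
  | neg φ _ => intro h; exact h.elim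
  | or φ ψ _ _ => intro h; exact h.elim
  | all x φ _ => intro h; exact h.elim
  | and φ ψ ih ih' =>
    intro hpp hk ρ m hm
    simp only [width, max_le_iff] at hk
    obtain ⟨A, l, m₁, hm₁, hl, hA, hAk, hs, he⟩ := ih hpp.1 hk.2.1 ρ m
      fun x hx => hm x (Finset.mem_union_left _ hx)
    obtain ⟨A', l', m₂, hm₂, hl', hA', hAk', hs', he'⟩ := ih' hpp.2 hk.2.2 ρ m₁
      fun x hx => (hm x (Finset.mem_union_right _ hx)).trans_le hm₁
    have him : ∀ x ∈ (and φ ψ).free.image ρ, x < m := by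
      simpa only [Finset.forall_mem_image] using hm
    have himφ : φ.free.image ρ ⊆ (and φ ψ).free.image ρ :=
      Finset.image_subset_image Finset.subset_union_left
    have himψ : ψ.free.image ρ ⊆ (and φ ψ).free.image ρ :=
      Finset.image_subset_image Finset.subset_union_right
    -- Both recursive calls draw the names of quantified variables from disjoint intervals above the
    -- names of the free variables.
    have hAl' : ∀ a ∈ A, ∀ x ∈ a.2, x ∉ l' := fun a ha x hx hxl => by
      rcases hA a ha x hx with h | h
      · have := him x (himφ h); have := hl' x hxl; omega
      · have := hl x h; have := hl' x hxl; omega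
    have hAl : ∀ a ∈ A', ∀ x ∈ a.2, x ∉ l := fun a ha x hx hxl => by
      rcases hA' a ha x hx with h | h
      · have := him x (himψ h); have := hl x hxl; omega
      · have := hl x hxl; have := hl' x h; omega
    refine ⟨A ++ A', l ++ l', m₂, hm₁.trans hm₂, ?_, ?_, ?_, fun B g => ?_, ?_⟩
    · intro x hx
      rcases List.mem_append.1 hx with h | h
      · have := hl x h; omega
      · have := hl' x h; omega
    · intro a ha x hx
      rcases List.mem_append.1 ha with h | h
      · exact (hA a h x hx).imp (@himφ x) (List.mem_append_left _)
      · exact (hA' a h x hx).imp (@himψ x) (List.mem_append_right _)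
    · intro a ha
      exact (List.mem_append.1 ha).elim (hAk a) (hAk' a)
    · rw [FinStructure.solves_append hAl' hAl, ← hs, ← hs']; rfl
    · rw [atomEdges_append]
      -- While one conjunct is processed, the other is a frame. What remains are two edges within
      -- the free variables of the conjunction.
      have h1 : Elim k (atomEdges A ∪ atomEdges A') l ({φ.free.image ρ} ∪ atomEdges A') := by
        refine he.frame ?_
        rintro e ⟨a, ha, rfl⟩ x hx hxe
        exact hAl a ha x (List.mem_toFinset.1 hxe) hx
      have h2 : Elim k (atomEdges A' ∪ {φ.free.image ρ}) l'
          ({ψ.free.image ρ} ∪ {φ.free.image ρ}) := by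
        refine he'.frame ?_
        rintro e rfl x hx hxe
        have := him x (himφ hxe); have := hl' x hx; omega
      rw [Set.union_comm] at h2
      refine (h1.append h2).mono_right ?_
      rintro e (rfl | rfl)
      exacts [⟨_, rfl, himψ⟩, ⟨_, rfl, himφ⟩]
  | ex x φ ih =>
    intro hpp hk ρ m hm
    simp only [width, max_le_iff] at hk
    have hρ : ∀ y ∈ φ.free, y ≠ x → ρ y < m := fun y hy hyx =>
      hm y (Finset.mem_erase.2 ⟨hyx, hy⟩)
    -- `m` is the fresh name of `x`; the variables quantified inside are named from `m + 1` on.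
    obtain ⟨A, l, m₁, hm₁, hl, hA, hAk, hs, he⟩ := ih hpp hk.2 (Function.update ρ x m) (m + 1)
      fun y hy => by
        by_cases hyx : y = x
        · subst hyx; simp
        · have := hρ y hy hyx; simp [hyx]; omega
    have him : ∀ y ∈ φ.free.image (Function.update ρ x m), y = m ∨
        y ∈ (ex x φ).free.image ρ := by
      simp only [Finset.forall_mem_image]
      intro y hy
      by_cases hyx : y = x
      · subst hyx; simp
      · right
        rw [Function.update_of_ne hyx]
        exact Finset.mem_image_of_mem ρ (Finset.mem_erase.2 ⟨hyx, hy⟩)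
    refine ⟨A, l ++ [m], m₁, by omega, ?_, ?_, hAk, fun B g => ?_, ?_⟩
    · intro y hy
      rcases List.mem_append.1 hy with h | h
      · have := hl y h; omega
      · rw [List.mem_singleton] at h; omega
    · intro a ha y hy
      rcases hA a ha y hy with h | h
      · rcases him y h with h | h
        · right; simp [h]
        · exact Or.inl h
      · right; simp [h]
    · have key : ∀ b, φ.Sat B (Function.update (g ∘ ρ) x b) ↔
          B.Solves A l (Function.update g m b) := by
        intro b
        rw [← hs]
        refine sat_congr B φ _ _ fun y hy => ?_
        by_cases hyx : y = x
        · subst hyx; simp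
        · have := hρ y hy hyx
          simp [hyx, this.ne]
      simp only [Sat, key]
      constructor
      · rintro ⟨b, g', hg', h⟩
        refine ⟨g', fun y hy => ?_, h⟩
        simp only [List.mem_append, List.mem_singleton, not_or] at hy
        rw [hg' y hy.1, Function.update_of_ne hy.2]
      · rintro ⟨g', hg', h⟩
        refine ⟨g' m, g', fun y hy => ?_, h⟩
        by_cases hym : y = m
        · subst hym; simp
        · rw [Function.update_of_ne hym]
          exact hg' y (by simp [hy, hym])
    -- Once the inner variables are gone, all edges lie within the free variables of `φ`. These form
    -- the bag for `m`, and the width of `φ` bounds its size.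
    · refine he.append (.cons m (φ.free.image (Function.update ρ x m)) (fun e he _ => by rw [he])
        (Finset.card_image_le.trans ((free_card_le_width _).trans hk.2)) (.nil ?_))
      rintro e (rfl | ⟨he, hx⟩)
      · refine ⟨_, rfl, fun y hy => ?_⟩
        rw [Finset.mem_erase] at hy
        exact (him y hy.2).resolve_left hy.1
      · obtain rfl := he
        refine ⟨_, rfl, fun y hy => (him y hy).resolve_left fun h => hx (h ▸ hy)⟩


/-! ### Flattening of ♯PP-formulas -/

/-- A conjunctive query with an integer coefficient, with lists of quantified and of liberal
variables. -/
structure WeightedQuery where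
  coeff : ℤ
  atoms : List QAtom
  bound : List ℕ
  lib : List ℕ

open Classical in
/-- The number of ways to change an assignment on `V` such that it solves the atoms. -/
noncomputable def solutionCount (B : FinStructure) (A : List QAtom) (l : List ℕ) (V : Finset ℕ)
    (g : ℕ → B.carrier) : ℤ :=
  sumOver V (fun f => if B.Solves A l f then 1 else 0) g

namespace WeightedQuery

/-- The weighted number of answers. -/
noncomputable def value (q : WeightedQuery) (B : FinStructure) (g : ℕ → B.carrier) : ℤ :=
  q.coeff * solutionCount B q.atoms q.bound q.lib.toFinset g

/-- The query has bound and liberal variables in the interval `[m, m')`, free variables in `F`, and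
allows for elimination at width `k`. -/
structure Fits (q : WeightedQuery) (k m m' : ℕ) (F : Finset ℕ) : Prop where
  bound_mem : ∀ x ∈ q.bound, m ≤ x ∧ x < m'
  lib_mem : ∀ x ∈ q.lib, m ≤ x ∧ x < m'
  disj : ∀ x ∈ q.bound, x ∉ q.lib
  vars : ∀ a ∈ q.atoms, ∀ x ∈ a.2, x ∈ F ∨ x ∈ q.lib ∨ x ∈ q.bound
  card_le : ∀ a ∈ q.atoms, a.2.toFinset.card ≤ k
  elim : ∃ H : Set (Finset ℕ), (∀ e ∈ H, ∀ x ∈ e, x ∈ F ∨ x ∈ q.lib) ∧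
    Elim k (atomEdges q.atoms) q.bound H ∧ Elim k H q.lib {F}

theorem Fits.mono {q : WeightedQuery} {k m m' m₁ m₁' : ℕ} {F F' : Finset ℕ} (h : q.Fits k m m' F)
    (hm : m₁ ≤ m) (hm' : m' ≤ m₁') (hF : F ⊆ F') : q.Fits k m₁ m₁' F' where
  bound_mem x hx := by have := h.bound_mem x hx; omega
  lib_mem x hx := by have := h.lib_mem x hx; omega
  disj := h.disj
  vars a ha x hx := (h.vars a ha x hx).imp_left (@hF x)
  card_le := h.card_le
  elim := by
    obtain ⟨H, h1, h2, h3⟩ := h.elim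
    exact ⟨H, fun e he x hx => (h1 e he x hx).imp_left (@hF x), h2,
      h3.mono_right fun e he => ⟨F', rfl, by rw [he]; exact hF⟩⟩

/-- The query that counts pairs of answers. -/
def mul (q r : WeightedQuery) : WeightedQuery :=
  ⟨q.coeff * r.coeff, q.atoms ++ r.atoms, q.bound ++ r.bound, q.lib ++ r.lib⟩

/-- The variables of the factors lie in disjoint intervals, so each elimination sees the other
factor as a frame. The intermediate hypergraph recorded in `Fits` makes it possible to put the
quantified variables of both factors before all liberal ones. -/
theorem Fits.mul {q r : WeightedQuery} {k m m' m'' : ℕ} {F : Finset ℕ} (hq : q.Fits k m m' F)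
    (hr : r.Fits k m' m'' F) (hF : ∀ x ∈ F, x < m) (hm : m ≤ m') (hm' : m' ≤ m'') :
    (q.mul r).Fits k m m'' F where
  bound_mem x hx := by
    rcases List.mem_append.1 hx with h | h
    · have := hq.bound_mem x h; omega
    · have := hr.bound_mem x h; omega
  lib_mem x hx := by
    rcases List.mem_append.1 hx with h | h
    · have := hq.lib_mem x h; omega
    · have := hr.lib_mem x h; omega
  disj x hx hx' := by
    rcases List.mem_append.1 hx with h | h <;> rcases List.mem_append.1 hx' with h' | h'
    · exact hq.disj x h h'
    · have := hq.bound_mem x h; have := hr.lib_mem x h'; omega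
    · have := hr.bound_mem x h; have := hq.lib_mem x h'; omega
    · exact hr.disj x h h'
  vars a ha x hx := by
    simp only [WeightedQuery.mul, List.mem_append] at ha ⊢
    rcases ha with h | h
    · have := hq.vars a h x hx; tauto
    · have := hr.vars a h x hx; tauto
  card_le a ha := (List.mem_append.1 ha).elim (hq.card_le a) (hr.card_le a)
  elim := by
    obtain ⟨H, h1, h2, h3⟩ := hq.elim
    obtain ⟨H', h1', h2', h3'⟩ := hr.elim
    refine ⟨H ∪ H', ?_, ?_, ?_⟩
    · simp only [WeightedQuery.mul, List.mem_append]
      rintro e (he | he) x hx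
      · have := h1 e he x hx; tauto
      · have := h1' e he x hx; tauto
    · have e1 : Elim k (atomEdges q.atoms ∪ atomEdges r.atoms) q.bound
          (H ∪ atomEdges r.atoms) := by
        refine h2.frame ?_
        rintro e ⟨a, ha, rfl⟩ x hx hxe
        have := hq.bound_mem x hx
        rcases hr.vars a ha x (List.mem_toFinset.1 hxe) with h | h | h
        · have := hF x h; omega
        · have := hr.lib_mem x h; omega
        · have := hr.bound_mem x h; omega
      have e2 : Elim k (atomEdges r.atoms ∪ H) r.bound (H' ∪ H) := by
        refine h2'.frame fun e he x hx hxe => ?_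
        have := hr.bound_mem x hx
        rcases h1 e he x hxe with h | h
        · have := hF x h; omega
        · have := hq.lib_mem x h; omega
      rw [Set.union_comm, Set.union_comm H'] at e2
      simpa only [WeightedQuery.mul, atomEdges_append] using e1.append e2
    · have e1 : Elim k (H ∪ H') q.lib ({F} ∪ H') := by
        refine h3.frame fun e he x hx hxe => ?_
        have := hq.lib_mem x hx
        rcases h1' e he x hxe with h | h
        · have := hF x h; omega
        · have := hr.lib_mem x h; omega
      have e2 : Elim k (H' ∪ {F}) r.lib ({F} ∪ {F}) := by
        refine h3'.frame ?_
        rintro e rfl x hx hxe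
        have := hr.lib_mem x hx; have := hF x hxe; omega
      rw [Set.union_comm, Set.union_self] at e2
      exact e1.append e2

/-- No atom of one factor contains a bound or liberal variable of the other. So solvability splits
by `solves_append` and the sum factors by `sumOver_mul`. -/
theorem value_mul {q r : WeightedQuery} {k m m' m'' : ℕ} {F : Finset ℕ} (hq : q.Fits k m m' F)
    (hr : r.Fits k m' m'' F) (hF : ∀ x ∈ F, x < m) (hm : m ≤ m')
    (B : FinStructure) (g : ℕ → B.carrier) : (q.mul r).value B g = q.value B g * r.value B g := by
  have h1 : ∀ a ∈ q.atoms, ∀ x ∈ a.2, x ∉ r.bound ∧ x ∉ r.lib := by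
    intro a ha x hx
    have hx' : x < m' := by
      rcases hq.vars a ha x hx with h | h | h
      · have := hF x h; omega
      · exact (hq.lib_mem x h).2
      · exact (hq.bound_mem x h).2
    exact ⟨fun h => absurd (hr.bound_mem x h).1 (by omega),
      fun h => absurd (hr.lib_mem x h).1 (by omega)⟩
  have h2 : ∀ a ∈ r.atoms, ∀ x ∈ a.2, x ∉ q.bound ∧ x ∉ q.lib := by
    intro a ha x hx
    have hx' : x < m ∨ m' ≤ x := by
      rcases hr.vars a ha x hx with h | h | h
      · exact Or.inl (hF x h)
      · exact Or.inr (hr.lib_mem x h).1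
      · exact Or.inr (hr.bound_mem x h).1
    exact ⟨fun h => absurd (hq.bound_mem x h) (by omega),
      fun h => absurd (hq.lib_mem x h) (by omega)⟩
  have hd : Disjoint q.lib.toFinset r.lib.toFinset := by
    rw [Finset.disjoint_left]
    intro x hx hx'
    have := hq.lib_mem x (List.mem_toFinset.1 hx)
    have := hr.lib_mem x (List.mem_toFinset.1 hx')
    omega
  simp only [value, WeightedQuery.mul, solutionCount, List.toFinset_append]
  rw [mul_mul_mul_comm, sumOver_mul hd]
  · congr 1
    refine sumOver_congr fun f _ => ?_
    have := B.solves_append (f := f) (fun a ha x hx => (h1 a ha x hx).1)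
      (fun a ha x hx => (h2 a ha x hx).1)
    by_cases h3 : B.Solves q.atoms q.bound f <;> by_cases h4 : B.Solves r.atoms r.bound f <;>
      simp [this, h3, h4]
  · intro f f' hf
    rw [B.solves_congr fun a ha x hx _ => hf x (by simpa using (h1 a ha x hx).2)]
  · intro f f' hf
    rw [B.solves_congr fun a ha x hx _ => hf x (by simpa using (h2 a ha x hx).2)]

/-- The query in which additional variables are made liberal. -/
def proj (q : WeightedQuery) (l : List ℕ) : WeightedQuery :=
  ⟨q.coeff, q.atoms, q.bound, q.lib ++ l⟩

/-- Eliminating the variables of `q` leaves only edges inside `F`, which fits into one bag; the new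
liberal variables are then removed by `Elim.singleton`. -/
theorem Fits.proj {q : WeightedQuery} {k m₀ m m' : ℕ} {F F' : Finset ℕ} {l : List ℕ}
    (hq : q.Fits k m m' F) (hk : F.card ≤ k) (hm : m₀ ≤ m) (hm' : m ≤ m')
    (hl : ∀ x ∈ l, m₀ ≤ x ∧ x < m) (hF : ∀ x ∈ F, x ∈ F' ∨ x ∈ l) :
    (q.proj l).Fits k m₀ m' F' where
  bound_mem x hx := by have := hq.bound_mem x hx; omega
  lib_mem x hx := by
    rcases List.mem_append.1 hx with h | h
    · have := hq.lib_mem x h; omega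
    · have := hl x h; omega
  disj x hx hx' := by
    rcases List.mem_append.1 hx' with h | h
    · exact hq.disj x hx h
    · have := hl x h; have := hq.bound_mem x hx; omega
  vars a ha x hx := by
    simp only [WeightedQuery.proj, List.mem_append]
    have := hq.vars a ha x hx
    have := hF x
    tauto
  card_le := hq.card_le
  elim := by
    obtain ⟨H, h1, h2, h3⟩ := hq.elim
    refine ⟨H, fun e he x hx => ?_, h2, h3.append ((Elim.singleton l hk).mono_right ?_)⟩
    · simp only [WeightedQuery.proj, List.mem_append]
      have := h1 e he x hx
      have := hF x
      tauto
    · rintro e rfl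
      refine ⟨_, rfl, fun x hx => ?_⟩
      rw [Finset.mem_sdiff, List.mem_toFinset] at hx
      exact (hF x hx.1).resolve_right hx.2

theorem value_proj {q : WeightedQuery} {l : List ℕ} (h : ∀ x ∈ q.lib, x ∉ l)
    (B : FinStructure) (g : ℕ → B.carrier) :
    (q.proj l).value B g = sumOver l.toFinset (fun f => q.value B f) g := by
  have hd : Disjoint l.toFinset q.lib.toFinset := by
    rw [Finset.disjoint_right]
    simpa using h
  simp only [value, WeightedQuery.proj, solutionCount, List.toFinset_append]
  rw [sumOver_const_mul, Finset.union_comm, sumOver_union hd]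
  rfl

end WeightedQuery

namespace SharpFormula

theorem free_card_le_width (ψ : SharpFormula) : ψ.free.card ≤ ψ.width := by
  cases ψ <;> simp [width, free]

/-- Renaming of the summation variables in the value of a projection. -/
theorem eval_proj_eq_sumOver {V : Finset Var} {ψ : SharpFormula} (hψ : ψ.WellFormed)
    (B : FinStructure) (ρ : ℕ → ℕ) (m : ℕ) (hρ : ∀ x ∈ ψ.free, x ∉ V → ρ x < m)
    (g : ℕ → B.carrier) :
    (proj V ψ).eval B (g ∘ ρ) = sumOver (V.image (m + ·))
      (fun f => ψ.eval B (f ∘ fun x => if x ∈ V then m + x else ρ x)) g := by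
  let e : V ≃ V.image (m + ·) := Equiv.ofBijective
    (fun x => ⟨m + x, Finset.mem_image_of_mem _ x.2⟩) ⟨fun x y h =>
      Subtype.ext (Nat.add_left_cancel (congrArg Subtype.val h)), fun ⟨y, hy⟩ => by
        obtain ⟨x, hx, rfl⟩ := Finset.mem_image.1 hy
        exact ⟨⟨x, hx⟩, rfl⟩⟩
  simp only [eval, sumOver]
  symm
  refine Fintype.sum_equiv (Equiv.arrowCongr e.symm (Equiv.refl _)) _ _ fun k => ?_
  refine eval_congr B ψ hψ _ _ fun x hx => ?_
  by_cases hxV : x ∈ V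
  · simp [override, hxV, Equiv.arrowCongr]
    rfl
  · have := hρ x hx hxV
    have h2 : ρ x ∉ V.image (m + ·) := by
      simp only [Finset.mem_image, not_exists, not_and]; intros; omega
    rw [Function.comp_apply, if_neg hxV]
    simp only [override, hxV, h2, dif_neg, not_false_eq_true, Function.comp_apply]

theorem sum_map_mul_sum_map {ι κ : Type*} (S : List ι) (T : List κ) (f : ι → ℤ) (g : κ → ℤ) :
    (S.map f).sum * (T.map g).sum = (S.flatMap fun s => T.map fun t => f s * g t).sum := by
  induction S with
  | nil => simp
  | cons s S ih => simp [add_mul, ih, List.sum_map_mul_left]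

/-- A ♯PP-formula of width `k` is a linear combination of conjunctive queries with eliminations of
width `k`. -/
theorem exists_flat {k : ℕ} {ψ : SharpFormula} :
    ψ.WellFormed → ψ.CastsPP → ψ.width ≤ k → ∀ (ρ : ℕ → ℕ) (m : ℕ), (∀ x ∈ ψ.free, ρ x < m) →
    ∃ (T : List WeightedQuery) (m' : ℕ), m ≤ m' ∧ (∀ q ∈ T, q.Fits k m m' (ψ.free.image ρ)) ∧
      ∀ (B : FinStructure) (g : ℕ → B.carrier),
        ψ.eval B (g ∘ ρ) = (T.map fun q => q.value B g).sum := by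
  induction ψ with
  | cast φ L =>
    intro wf hpp hk ρ m hm
    simp only [width, max_le_iff] at hk
    obtain ⟨A, l, m', hm', hl, hA, hAk, hs, he⟩ := FOFormula.IsPP.exists_flat hpp hk.2 ρ m
      fun x hx => hm x (wf hx)
    -- Nothing is counted yet: without liberal variables the value is the indicator of solvability.
    refine ⟨[⟨1, A, l, []⟩], m', hm', ?_, fun B g => ?_⟩
    · rw [List.forall_mem_singleton]
      have hL : φ.free.image ρ ⊆ L.image ρ := Finset.image_subset_image wf
      refine ⟨hl, by simp, by simp, fun a ha x hx => ?_, hAk, _, ?_, he, .nil ?_⟩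
      · exact (hA a ha x hx).imp (@hL x) Or.inr
      · rintro e rfl x hx; exact Or.inl (hL hx)
      · rintro e rfl; exact ⟨_, rfl, hL⟩
    · simp only [eval, List.map_cons, List.map_nil, List.sum_singleton, WeightedQuery.value,
        solutionCount, List.toFinset_nil, sumOver_empty, one_mul]
      congr 1
      exact propext (hs B g)
  | proj V ψ ih =>
    intro wf hpp hk ρ m hm
    simp only [width, max_le_iff] at hk
    have hρ : ∀ x ∈ ψ.free, x ∉ V → ρ x < m := fun x hx hV => hm x (Finset.mem_sdiff.2 ⟨hx, hV⟩)
    -- The variables in `V` get the names `m + x`, clear of the free ones. With `s` a bound for `V`,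
    -- the names from `m + s + 1` on are still unused.
    set ρ' : ℕ → ℕ := fun x => if x ∈ V then m + x else ρ x with hρ'
    obtain ⟨s, hV⟩ : ∃ s : ℕ, ∀ x : ℕ, x ∈ V → x ≤ s :=
      ⟨V.sup id, fun x hx => Finset.le_sup (f := id) hx⟩
    obtain ⟨T, m', hm', hT, hs⟩ := ih wf.1 hpp hk.2 ρ' (m + s + 1) fun x hx => by
      by_cases hxV : x ∈ V
      · have := hV x hxV; simp [ρ', hxV]; omega
      · have := hρ x hx hxV; simp [ρ', hxV]; omega
    refine ⟨T.map fun q => q.proj (V.image (m + ·)).toList, m', by omega, ?_, fun B g => ?_⟩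
    · simp only [List.forall_mem_map]
      intro q hq
      refine (hT q hq).proj (Finset.card_image_le.trans ((free_card_le_width _).trans hk.2))
        (by omega) hm' ?_ ?_
      · simp only [Finset.mem_toList, Finset.forall_mem_image]
        intro x hx
        have := hV x hx; omega
      · simp only [Finset.mem_toList, Finset.forall_mem_image]
        intro x hx
        by_cases hxV : x ∈ V
        · right; simp [ρ', hxV]
        · left
          simp only [ρ', hxV, if_false]
          exact Finset.mem_image_of_mem ρ (Finset.mem_sdiff.2 ⟨hx, hxV⟩)
    · rw [eval_proj_eq_sumOver wf.1 B ρ m hρ]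
      simp only [← hρ', hs, List.map_map]
      rw [sumOver_list_sum]
      congr 1
      refine List.map_congr_left fun q hq => ?_
      rw [Function.comp_apply, WeightedQuery.value_proj, Finset.toList_toFinset]
      intro x hx
      have := (hT q hq).lib_mem x hx
      simp only [Finset.mem_toList, Finset.mem_image, not_exists, not_and]
      intro y hy
      have := hV y hy; omega
  | expand V ψ ih =>
    intro wf hpp hk ρ m hm
    simp only [width, max_le_iff] at hk
    obtain ⟨T, m', hm', hT, hs⟩ := ih wf.1 hpp hk.2 ρ m
      fun x hx => hm x (Finset.mem_union_right _ hx)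
    exact ⟨T, m', hm', fun q hq => (hT q hq).mono le_rfl le_rfl
      (Finset.image_subset_image Finset.subset_union_right), hs⟩
  | mul ψ ψ' ih ih' =>
    intro wf hpp hk ρ m hm
    simp only [width, max_le_iff] at hk
    obtain ⟨T, m₁, hm₁, hT, hs⟩ := ih wf.1 hpp.1 hk.2.1 ρ m hm
    -- Factors need disjoint names, so the second one starts where the first one stopped; the
    -- summands of a sum may share names.
    obtain ⟨T', m₂, hm₂, hT', hs'⟩ := ih' wf.2.1 hpp.2 hk.2.2 ρ m₁
      fun x hx => (hm x (by rw [free, wf.2.2.1]; exact hx)).trans_le hm₁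
    rw [← wf.2.2.1] at hT'
    have him : ∀ x ∈ ψ.free.image ρ, x < m := by
      rw [Finset.forall_mem_image]; exact hm
    refine ⟨T.flatMap fun q => T'.map fun r => q.mul r, m₂, hm₁.trans hm₂, ?_, fun B g => ?_⟩
    · simp only [List.mem_flatMap, List.mem_map]
      rintro _ ⟨q, hq, r, hr, rfl⟩
      exact (hT q hq).mul (hT' r hr) him hm₁ hm₂
    · simp only [eval]
      rw [hs, hs', sum_map_mul_sum_map, List.map_flatMap]
      congr 1
      refine List.flatMap_congr fun q hq => ?_
      rw [List.map_map]
      exact List.map_congr_left fun r hr =>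
        (WeightedQuery.value_mul (hT q hq) (hT' r hr) him hm₁ B g).symm
  | add ψ ψ' ih ih' =>
    intro wf hpp hk ρ m hm
    simp only [width, max_le_iff] at hk
    obtain ⟨T, m₁, hm₁, hT, hs⟩ := ih wf.1 hpp.1 hk.2.1 ρ m hm
    obtain ⟨T', m₂, hm₂, hT', hs'⟩ := ih' wf.2.1 hpp.2 hk.2.2 ρ m
      fun x hx => hm x (by rw [free, wf.2.2]; exact hx)
    rw [← wf.2.2] at hT'
    refine ⟨T ++ T', max m₁ m₂, by omega, ?_, fun B g => ?_⟩
    · intro q hq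
      rcases List.mem_append.1 hq with h | h
      · exact (hT q h).mono le_rfl (le_max_left _ _) subset_rfl
      · exact (hT' q h).mono le_rfl (le_max_right _ _) subset_rfl
    · simp only [eval]
      rw [hs, hs', List.map_append, List.sum_append]
  | const n =>
    intro _ _ _ ρ m _
    refine ⟨[⟨n, [], [], []⟩], m, le_rfl, ?_, fun B g => ?_⟩
    · rw [List.forall_mem_singleton]
      refine ⟨by simp, by simp, by simp, by simp, by simp, ∅, by simp, .nil ?_, .nil ?_⟩
      · rintro e ⟨a, ha, -⟩; simp at ha
      · rintro e he; simp at he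
    · have : B.Solves [] [] g := ⟨g, fun _ _ => rfl, by simp [FinStructure.Models]⟩
      simp [eval, WeightedQuery.value, solutionCount, sumOver_empty, this]

end SharpFormula

/-- Every variable of the atoms is liberal or quantified, so the ambient assignment `g` has no
influence. -/
theorem solutionCount_eq_queryCount (B : FinStructure) {A : List QAtom} {l : List ℕ}
    {V : Finset ℕ} (hV : ∀ x ∈ l, x ∉ V) (hA : ∀ a ∈ A, ∀ x ∈ a.2, x ∈ V ∨ x ∈ l)
    (g : ℕ → B.carrier) : solutionCount B A l V g = queryCount V A B := by
  classical
  have key : ∀ k : V → B.carrier, B.Solves A l (override g V k) ↔ k ∈ queryAnswers V A B := by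
    intro k
    constructor
    · rintro ⟨g', hg', h⟩
      refine ⟨g', fun x => ?_, h⟩
      rw [hg' x fun hx => hV x hx x.2]
      simp [override]
    · rintro ⟨g', hg', h⟩
      refine FinStructure.solves_of_agree (fun a ha x hx hl => ?_) ⟨g', fun _ _ => rfl, h⟩
      have hxV := (hA a ha x hx).resolve_right hl
      simpa [override, hxV] using hg' ⟨x, hxV⟩
  simp only [solutionCount, sumOver, key]
  rw [Finset.sum_boole, queryCount, Set.ncard_eq_toFinset_card']
  congr 2
  ext k
  simp

/-- If a ♯PP-formula counts the answers of a query, then it does so because of a query with an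
elimination of the width of the formula. -/
theorem SharpFormula.exists_query {ψ : SharpFormula} (hψ : ψ.IsSharpPP) (hfree : ψ.free = ∅)
    {V : Finset ℕ} {A : List QAtom}
    (h : ∀ (B : FinStructure) (g : Var → B.carrier), ψ.eval B g = queryCount V A B) :
    ∃ (q : WeightedQuery) (m : ℕ), q.Fits ψ.width 0 m ∅ ∧
      ∀ B, queryCount V A B = queryCount q.lib.toFinset q.atoms B := by
  obtain ⟨T, m, -, hT, hs⟩ := exists_flat hψ.1 hψ.2 le_rfl id 0 (by simp [hfree])
  rw [hfree, Finset.image_empty] at hT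
  have hval : ∀ q ∈ T, ∀ (B : FinStructure) (g : ℕ → B.carrier),
      q.value B g = q.coeff * queryCount q.lib.toFinset q.atoms B := by
    intro q hq B g
    rw [WeightedQuery.value, solutionCount_eq_queryCount]
    · simpa using (hT q hq).disj
    · simpa using (hT q hq).vars
  obtain ⟨q, hq, hc⟩ := exists_queryCount_eq_of_sum V A T (fun q => q.coeff)
    (fun q => q.lib.toFinset) (fun q => q.atoms) fun B => by
      let g : ℕ → B.carrier := fun _ => Classical.arbitrary _
      rw [← h B g]
      refine (hs B g).trans ?_
      congr 1
      exact List.map_congr_left fun q hq => hval q hq B g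
  exact ⟨q, m, hT q hq, hc⟩


/-! ### Elimination orders for lists of edges -/

/-- The variables below `N` that share an edge with `x`. -/
def bag (N x : ℕ) (H : List (List ℕ)) : List ℕ :=
  (List.range N).filter fun y => ∃ e ∈ H, x ∈ e ∧ y ∈ e

/-- Elimination of a variable: the edges that contain it are replaced by their union. -/
def elimEdges (N : ℕ) (H : List (List ℕ)) (x : ℕ) : List (List ℕ) :=
  (bag N x H).filter (fun y => y ≠ x) :: H.filter (fun e => x ∉ e)

/-- The maximum size of a bag during the elimination of a list of variables. -/
def elimCost (N : ℕ) : List (List ℕ) → List ℕ → ℕ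
  | _, [] => 0
  | H, x :: l => max (bag N x H).length (elimCost N (elimEdges N H x) l)

theorem elimCost_append (N : ℕ) (l l' : List ℕ) : ∀ H : List (List ℕ),
    elimCost N H (l ++ l') = max (elimCost N H l) (elimCost N (l.foldl (elimEdges N) H) l') := by
  induction l with
  | nil => intro H; simp [elimCost]
  | cons x l ih => intro H; simp [elimCost, ih, max_assoc]

theorem mem_bag {N x y : ℕ} {H : List (List ℕ)} :
    y ∈ bag N x H ↔ y < N ∧ ∃ e ∈ H, x ∈ e ∧ y ∈ e := by
  simp [bag]

theorem bag_nodup (N x : ℕ) (H : List (List ℕ)) : (bag N x H).Nodup :=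
  List.Nodup.filter _ List.nodup_range

theorem length_le_of_injOn {l : List ℕ} (hl : l.Nodup) {U : Finset ℕ} {h : ℕ → ℕ}
    (hU : ∀ x ∈ l, h x ∈ U) (hinj : ∀ x ∈ l, ∀ y ∈ l, h x = h y → x = y) : l.length ≤ U.card := by
  rw [← List.toFinset_card_of_nodup hl]
  refine Finset.card_le_card_of_injOn h (fun x hx => hU x (by simpa using hx)) ?_
  intro x hx y hy hxy
  exact hinj x (by simpa using hx) y (by simpa using hy) hxy

/-- Each edge of the list `H₀` is mapped by `h` into an edge of `H`. -/
def DominatedVia (h : ℕ → ℕ) (H₀ : List (List ℕ)) (H : Set (Finset ℕ)) : Prop :=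
  ∀ e ∈ H₀, ∃ e' ∈ H, ∀ x ∈ e, h x ∈ e'

/-- Eliminations can be pulled back along injective maps. -/
theorem Elim.pullback {k N : ℕ} {h : ℕ → ℕ} {H H' : Set (Finset ℕ)} {l : List ℕ}
    (hE : Elim k H l H') : ∀ (H₀ : List (List ℕ)) (R : Finset ℕ), Set.InjOn h R →
    (∀ e ∈ H₀, ∀ x ∈ e, x ∈ R) → DominatedVia h H₀ H →
    ∃ l₀ : List ℕ, l₀.Nodup ∧ (∀ x, x ∈ l₀ ↔ x ∈ R ∧ h x ∈ l) ∧ elimCost N H₀ l₀ ≤ k ∧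
      DominatedVia h (l₀.foldl (elimEdges N) H₀) H' ∧
      ∀ e ∈ l₀.foldl (elimEdges N) H₀, ∀ x ∈ e, x ∈ R ∧ x ∉ l₀ := by
  induction hE with
  | nil hd =>
    intro H₀ R _ hR hdom
    refine ⟨[], List.nodup_nil, by simp, by simp [elimCost], fun e he => ?_, fun e he x hx =>
      ⟨hR e he x hx, by simp⟩⟩
    obtain ⟨e', he', h1⟩ := hdom e he
    obtain ⟨e'', he'', h2⟩ := hd e' he'
    exact ⟨e'', he'', fun x hx => h2 (h1 x hx)⟩
  | @cons H H' l x U hU hk _ ih =>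
    intro H₀ R hinj hR hdom
    have hdom' : ∀ e ∈ H₀, (∀ y ∈ e, h y ≠ x) →
        ∃ e' ∈ insert (U.erase x) {e | e ∈ H ∧ x ∉ e}, ∀ y ∈ e, h y ∈ e' := by
      intro e he hne
      obtain ⟨e', he', h1⟩ := hdom e he
      by_cases hx : x ∈ e'
      · exact ⟨_, Or.inl rfl, fun y hy => Finset.mem_erase.2 ⟨hne y hy, hU e' he' hx (h1 y hy)⟩⟩
      · exact ⟨e', Or.inr ⟨he', hx⟩, h1⟩
    -- If `x = h r`, then `r` is eliminated, and `h` maps its bag injectively into `U`. Otherwise no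
    -- remaining variable lies over `x` and the step is skipped.
    by_cases hr : ∃ r ∈ R, h r = x
    · obtain ⟨r, hrR, rfl⟩ := hr
      have hbag : ∀ y ∈ bag N r H₀, y ∈ R ∧ h y ∈ U := by
        intro y hy
        obtain ⟨-, e, he, hre, hye⟩ := mem_bag.1 hy
        obtain ⟨e', he', h1⟩ := hdom e he
        exact ⟨hR e he y hye, hU e' he' (h1 r hre) (h1 y hye)⟩
      have hne : ∀ y ∈ R, y ≠ r → h y ≠ h r := fun y hy hyr hh => hyr (hinj hy hrR hh)
      obtain ⟨l₀, hn, hl, hc, hd, he⟩ := ih (elimEdges N H₀ r) (R.erase r)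
        (hinj.mono (by simp)) (by
          intro e he y hy
          rw [elimEdges, List.mem_cons] at he
          rcases he with rfl | he
          · rw [List.mem_filter] at hy
            exact Finset.mem_erase.2 ⟨by simpa using hy.2, (hbag y hy.1).1⟩
          · rw [List.mem_filter] at he
            exact Finset.mem_erase.2 ⟨fun hh => by simp [← hh, hy] at he, hR e he.1 y hy⟩)
        (by
          intro e he
          rw [elimEdges, List.mem_cons] at he
          rcases he with rfl | he
          · refine ⟨_, Or.inl rfl, fun y hy => ?_⟩
            rw [List.mem_filter] at hy
            exact Finset.mem_erase.2
              ⟨hne y (hbag y hy.1).1 (by simpa using hy.2), (hbag y hy.1).2⟩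
          · rw [List.mem_filter] at he
            exact hdom' e he.1 fun y hy => hne y (hR e he.1 y hy)
              fun hh => by simp [← hh, hy] at he)
      refine ⟨r :: l₀, ?_, fun y => ?_, ?_, hd, fun e hee y hy => ?_⟩
      · rw [List.nodup_cons]
        exact ⟨fun hh => by simp [hl] at hh, hn⟩
      · simp only [List.mem_cons, hl, Finset.mem_erase]
        constructor
        · rintro (rfl | hh)
          · exact ⟨hrR, Or.inl rfl⟩
          · exact ⟨hh.1.2, Or.inr hh.2⟩
        · rintro ⟨hy, hh | hh⟩
          · exact Or.inl (hinj hy hrR hh)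
          · by_cases hyr : y = r
            · exact Or.inl hyr
            · exact Or.inr ⟨⟨hyr, hy⟩, hh⟩
      · rw [elimCost, max_le_iff]
        refine ⟨(length_le_of_injOn (bag_nodup N r H₀) (fun y hy => (hbag y hy).2) ?_).trans hk, hc⟩
        exact fun y hy z hz => hinj (hbag y hy).1 (hbag z hz).1
      · obtain ⟨h1, h2⟩ := he e hee y hy
        rw [Finset.mem_erase] at h1
        exact ⟨h1.2, by simp [h1.1, h2]⟩
    · push Not at hr
      obtain ⟨l₀, hn, hl, hc, hd, he⟩ := ih H₀ R hinj hR
        fun e he => hdom' e he fun y hy => hr y (hR e he y hy)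
      refine ⟨l₀, hn, fun y => ?_, hc, hd, he⟩
      rw [hl, List.mem_cons]
      constructor
      · exact fun hh => ⟨hh.1, Or.inr hh.2⟩
      · exact fun hh => ⟨hh.1, hh.2.resolve_left (hr y hh.1)⟩

/-! ### Candidates: endomorphisms with elimination orders -/

/-- The function given by the list of its values. -/
def listFun (e : List ℕ) (x : ℕ) : ℕ := e.getD x 0

/-- The edges of the image of `A` under `h`. -/
def imageEdges (N : ℕ) (A : List QAtom) (h : ℕ → ℕ) : List (List ℕ) :=
  A.map fun a => (List.range N).filter fun y => y ∈ a.2.map h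

/-- A candidate for the query with liberal variables `V` and atoms `A` consists of an endomorphism
that permutes `V`, an elimination order for the quantified variables in its image, and an order of
`V`. -/
structure IsCandidate (V : List ℕ) (A : List QAtom) (c : List ℕ × List ℕ × List ℕ) : Prop where
  hom : ∀ a ∈ A, a.map (listFun c.1) ∈ A
  maps : ∀ v ∈ V, listFun c.1 v ∈ V
  surj : ∀ v ∈ V, ∃ u ∈ V, listFun c.1 u = v
  bound_notMem : ∀ x ∈ c.2.1, x ∉ V
  cover : ∀ a ∈ A, ∀ x ∈ a.2, listFun c.1 x ∈ V ∨ listFun c.1 x ∈ c.2.1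
  lib_subset : ∀ v ∈ V, v ∈ c.2.2
  length_eq : c.2.2.length = V.length

/-- The width of the formula constructed from a candidate. -/
def candidateCost (N : ℕ) (A : List QAtom) (c : List ℕ × List ℕ × List ℕ) : ℕ :=
  max (((imageEdges N A (listFun c.1)).map List.length).foldr max 0)
    (elimCost N (imageEdges N A (listFun c.1)) (c.2.1 ++ c.2.2))

theorem foldr_max_le {l : List ℕ} {k : ℕ} : l.foldr max 0 ≤ k ↔ ∀ x ∈ l, x ≤ k := by
  induction l with
  | nil => simp
  | cons x l ih => simp [ih]

theorem QAtom.map_map (h g : ℕ → ℕ) (a : QAtom) : (a.map h).map g = a.map (g ∘ h) := by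
  simp [QAtom.map]

theorem QAtom.map_congr {h g : ℕ → ℕ} {a : QAtom} (hh : ∀ x ∈ a.2, h x = g x) :
    a.map h = a.map g := by
  simp only [QAtom.map]
  rw [List.map_congr_left hh]

theorem length_le_of_nodup_of_lt {l : List ℕ} {N : ℕ} (hl : l.Nodup) (h : ∀ x ∈ l, x < N) :
    l.length ≤ N := by
  simpa using (hl.subperm (l₂ := List.range N) fun x hx => List.mem_range.2 (h x hx)).length_le

/-- If the answers of a query are counted by a query with an elimination of width `k`, then there
is a candidate of cost at most `k`. -/
theorem exists_candidate {M k m : ℕ} {V : List ℕ} {A : List QAtom} (hVn : V.Nodup)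
    (hV : ∀ v ∈ V, v < M + 1) (hA : ∀ a ∈ A, ∀ x ∈ a.2, x < M + 1) {q : WeightedQuery}
    (hq : q.Fits k 0 m ∅)
    (hcount : ∀ B, queryCount V.toFinset A B = queryCount q.lib.toFinset q.atoms B) :
    ∃ c : List ℕ × List ℕ × List ℕ, IsCandidate V A c ∧ candidateCost (M + 1) A c ≤ k ∧
      (∀ l ∈ [c.1, c.2.1, c.2.2], l.length ≤ M + 1 ∧ ∀ x ∈ l, x < M + 1) := by
  -- Equal counts give homomorphisms `g` from `q` to `A` and `h` from `A` to `q`, both bijective on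
  -- liberal variables.
  obtain ⟨g, -, hgA, hgV⟩ := exists_hom_of_queryCount_eq M (by simpa using hV) hA hcount
  obtain ⟨h, -, hhA, hhV⟩ := exists_hom_of_queryCount_eq (V := q.lib.toFinset) (A := q.atoms) m
    (fun x hx => by have := hq.lib_mem x (List.mem_toFinset.1 hx); omega)
    (fun a ha x hx => by
      rcases hq.vars a ha x hx with h | h | h
      · simp at h
      · have := hq.lib_mem x h; omega
      · have := hq.bound_mem x h; omega) (fun B => (hcount B).symm)
  let P : Set (ℕ → ℕ) := {e | (∀ x, e x < M + 1) ∧ (∀ a ∈ A, a.map e ∈ A) ∧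
    Set.BijOn e V.toFinset V.toFinset}
  have hP : P.Nonempty := by
    -- The identity, cut off so that all values stay below `M + 1`.
    refine ⟨fun x => if x < M + 1 then x else 0, fun x => by dsimp only; split_ifs <;> omega, ?_, ?_⟩
    · intro a ha
      have : a.map (fun x => if x < M + 1 then x else 0) = a.map id :=
        QAtom.map_congr fun x hx => by simp only [id]; rw [if_pos (hA a ha x hx)]
      rw [this]
      simpa [QAtom.map] using ha
    · refine (Set.bijOn_id _).congr fun x hx => ?_
      simp only [id]; rw [if_pos (hV x (by simpa using hx))]
  -- The image of `e` plays the role of a core of the query, relative to permutations of the liberal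
  -- variables.
  obtain ⟨e, ⟨heM, heA, heV⟩, hmin⟩ := WellFounded.has_min
    (measure fun e : ℕ → ℕ => ((Finset.range (M + 1)).image e).card).wf P hP
  set I := (Finset.range (M + 1)).image e with hI
  have hinj : Set.InjOn h I := by
    -- By minimality the image of this endomorphism, which is `(e ∘ g ∘ h)(I)`, is no smaller than
    -- `I`. So `e ∘ g ∘ h` is injective on `I`, and then so is `h`.
    have hf : e ∘ g ∘ h ∘ e ∈ P := by
      refine ⟨fun x => heM _, fun a ha => ?_, heV.comp (hgV.comp (hhV.comp heV))⟩
      have := heA _ (hgA _ (hhA _ (heA a ha)))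
      simpa only [QAtom.map_map] using this
    have h1 : I.card ≤ (I.image (e ∘ g ∘ h)).card := by
      rw [hI, Finset.image_image]
      exact not_lt.1 (hmin _ hf)
    have h2 : Set.InjOn (e ∘ g ∘ h) I :=
      Finset.card_image_iff.1 (le_antisymm Finset.card_image_le h1)
    intro x hx y hy hxy
    exact h2 hx hy (by simp [hxy])
  have hIM : ∀ x ∈ I, x < M + 1 := by
    simp only [hI, Finset.forall_mem_image]; exact fun x _ => heM x
  have hVI : ∀ v ∈ V, v ∈ I := by
    intro v hv
    obtain ⟨u, hu, rfl⟩ := heV.surjOn (show v ∈ (V.toFinset : Set ℕ) by simpa using hv)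
    exact Finset.mem_image_of_mem e (Finset.mem_range.2 (hV u (by simpa using hu)))
  have hhlib : ∀ v ∈ V, h v ∈ q.lib := fun v hv => by
    simpa using hhV.mapsTo (show v ∈ (V.toFinset : Set ℕ) by simpa using hv)
  -- A liberal variable of `q` is already hit from `V`; by injectivity no other element of `I` lies
  -- over it.
  have hlibV : ∀ x ∈ I, h x ∈ q.lib → x ∈ V := by
    intro x hx hl
    obtain ⟨v, hv, hvx⟩ := hhV.surjOn (show h x ∈ (q.lib.toFinset : Set ℕ) by simpa using hl)
    have hv' : v ∈ V := by simpa using hv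
    rw [← hinj (hVI v hv') hx hvx]; exact hv'
  set c₁ : List ℕ := (List.range (M + 1)).map e with hc₁
  have hfun : ∀ x < M + 1, listFun c₁ x = e x := fun x hx => by
    simp [listFun, c₁, List.getD_eq_getElem?_getD, hx]
  have heI : ∀ a ∈ A, ∀ x ∈ a.2, e x ∈ I := fun a ha x hx =>
    Finset.mem_image_of_mem e (Finset.mem_range.2 (hA a ha x hx))
  have hmapfun : ∀ a ∈ A, a.2.map (listFun c₁) = a.2.map e := fun a ha =>
    List.map_congr_left fun x hx => hfun x (hA a ha x hx)
  set E := imageEdges (M + 1) A (listFun c₁) with hE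
  have hEmem : ∀ l ∈ E, l.Nodup ∧ (∀ y ∈ l, y ∈ I) ∧
      ∃ a ∈ q.atoms, ∀ y ∈ l, h y ∈ a.2.toFinset := by
    intro l hl
    obtain ⟨a, ha, rfl⟩ := List.mem_map.1 hl
    rw [hmapfun a ha]
    refine ⟨List.Nodup.filter _ List.nodup_range, fun y hy => ?_, _, hhA _ (heA a ha),
      fun y hy => ?_⟩
    · obtain ⟨x, hx, rfl⟩ := by simpa using (List.mem_filter.1 hy).2
      exact heI a ha x hx
    · obtain ⟨x, hx, rfl⟩ := by simpa using (List.mem_filter.1 hy).2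
      simp only [QAtom.map, List.map_map, List.mem_toFinset]
      exact List.mem_map_of_mem (f := h ∘ e) hx
  obtain ⟨H, -, hE1, hE2⟩ := hq.elim
  -- `h` sends the atoms of the image to atoms of `q`. Pulling back the two stages of the
  -- elimination gives the order `p` of the quantified variables and then the order `r` of the
  -- liberal ones.
  obtain ⟨p, hpn, hp, hpc, hpd, hpe⟩ := hE1.pullback (N := M + 1) E I hinj
    (fun l hl => (hEmem l hl).2.1) fun l hl => by
      obtain ⟨a, ha, hy⟩ := (hEmem l hl).2.2
      exact ⟨_, ⟨a, ha, rfl⟩, hy⟩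
  obtain ⟨r, hrn, hr, hrc, -, -⟩ := hE2.pullback (N := M + 1) _ (I \ p.toFinset)
    (hinj.mono (by simp))
    (fun l hl x hx => by simpa using hpe l hl x hx) hpd
  have hrV : ∀ x, x ∈ r ↔ x ∈ V := by
    intro x
    rw [hr]
    simp only [Finset.mem_sdiff, List.mem_toFinset, hp, not_and]
    constructor
    · exact fun hx => hlibV x hx.1.1 hx.2
    · exact fun hx => ⟨⟨hVI x hx, fun _ hb => hq.disj _ hb (hhlib x hx)⟩, hhlib x hx⟩
  refine ⟨(c₁, p, r), ⟨?_, ?_, ?_, ?_, ?_, ?_, ?_⟩, ?_, ?_⟩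
  · intro a ha
    rw [QAtom.map_congr fun x hx => hfun x (hA a ha x hx)]
    exact heA a ha
  · intro v hv
    rw [hfun v (hV v hv)]
    simpa using heV.mapsTo (show v ∈ (V.toFinset : Set ℕ) by simpa using hv)
  · intro v hv
    obtain ⟨u, hu, huv⟩ := heV.surjOn (show v ∈ (V.toFinset : Set ℕ) by simpa using hv)
    have hu' : u ∈ V := by simpa using hu
    exact ⟨u, hu', by rw [hfun u (hV u hu'), huv]⟩
  · intro x hx hxV
    exact hq.disj _ ((hp x).1 hx).2 (hhlib x hxV)
  · intro a ha x hx
    rw [hfun x (hA a ha x hx)]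
    have h1 := heI a ha x hx
    have h2 : h (e x) ∈ ((a.map e).map h).2 := by
      simp only [QAtom.map, List.map_map]
      exact List.mem_map_of_mem (f := h ∘ e) hx
    rcases hq.vars _ (hhA _ (heA a ha)) _ h2 with h3 | h3 | h3
    · simp at h3
    · exact Or.inl (hlibV _ h1 h3)
    · exact Or.inr ((hp _).2 ⟨h1, h3⟩)
  · exact fun v hv => (hrV v).2 hv
  · exact ((List.perm_ext_iff_of_nodup hrn hVn).2 hrV).length_eq
  · rw [candidateCost, max_le_iff, foldr_max_le, elimCost_append]
    refine ⟨?_, max_le hpc hrc⟩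
    simp only [List.forall_mem_map]
    intro l hl
    obtain ⟨h1, h2, a, ha, h3⟩ := hEmem l hl
    exact (length_le_of_injOn h1 h3 fun x hx y hy => hinj (h2 x hx) (h2 y hy)).trans
      (hq.card_le a ha)
  · simp only [List.mem_cons, List.not_mem_nil, or_false, forall_eq_or_imp, forall_eq]
    have hpM : ∀ x ∈ p, x < M + 1 := fun x hx => hIM x ((hp x).1 hx).1
    have hrM : ∀ x ∈ r, x < M + 1 := fun x hx => hV x ((hrV x).1 hx)
    refine ⟨⟨by simp [c₁], ?_⟩, ⟨length_le_of_nodup_of_lt hpn hpM, hpM⟩,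
      ⟨length_le_of_nodup_of_lt hrn hrM, hrM⟩⟩
    simp only [c₁, List.forall_mem_map]
    exact fun x _ => heM x


/-! ### Elimination with labelled edges -/

section elimStep

variable {α : Type}

/-- Elimination of a variable in a list of edges with labels; the new edge is labelled using `c`. -/
def elimStep (N : ℕ) (c : ℕ → List ℕ → List (List ℕ × α) → α) (F : List (List ℕ × α)) (x : ℕ) :
    List (List ℕ × α) :=
  ((bag N x (F.map Prod.fst)).filter (fun y => y ≠ x),
    c x (bag N x (F.map Prod.fst)) (F.filter fun f => x ∈ f.1)) :: F.filter fun f => x ∉ f.1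

/-- Labels do not influence edges, so `elimCost` also controls the bags of a labelled elimination.
-/
theorem map_fst_elimStep (N : ℕ) (c : ℕ → List ℕ → List (List ℕ × α) → α)
    (F : List (List ℕ × α)) (x : ℕ) :
    (elimStep N c F x).map Prod.fst = elimEdges N (F.map Prod.fst) x := by
  simp only [elimStep, elimEdges, List.map_cons, List.filter_map]
  rfl

theorem map_fst_foldl_elimStep (N : ℕ) (c : ℕ → List ℕ → List (List ℕ × α) → α) (l : List ℕ) :
    ∀ F : List (List ℕ × α), (l.foldl (elimStep N c) F).map Prod.fst =
      l.foldl (elimEdges N) (F.map Prod.fst) := by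
  induction l with
  | nil => intro F; rfl
  | cons x l ih => intro F; rw [List.foldl_cons, List.foldl_cons, ih, map_fst_elimStep]

/-- Eliminated variables never reappear and no new ones arise, so nothing survives the elimination
of all variables. -/
theorem foldl_elimEdges_mem {N : ℕ} {l : List ℕ} : ∀ {H : List (List ℕ)},
    ∀ e ∈ l.foldl (elimEdges N) H, ∀ y ∈ e, y ∉ l ∧ ∃ e' ∈ H, y ∈ e' := by
  induction l with
  | nil => intro H e he y hy; exact ⟨by simp, e, he, hy⟩
  | cons x l ih =>
    intro H e he y hy
    obtain ⟨h1, e', he', hy'⟩ := ih e he y hy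
    rw [elimEdges, List.mem_cons] at he'
    rcases he' with rfl | he'
    · rw [List.mem_filter, mem_bag] at hy'
      obtain ⟨e'', h2, -, h3⟩ := hy'.1.2
      exact ⟨by simpa [h1] using hy'.2, e'', h2, h3⟩
    · rw [List.mem_filter] at he'
      refine ⟨?_, e', he'.1, hy'⟩
      rw [List.mem_cons, not_or]
      exact ⟨fun h => by simp [← h, hy'] at he', h1⟩

end elimStep

/-- Increasing lists of numbers below `N`. -/
structure IsVarList (N : ℕ) (l : List ℕ) : Prop where
  sorted : l.Pairwise (· < ·)
  lt : ∀ x ∈ l, x < N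

theorem isVarList_range_filter (N : ℕ) (p : ℕ → Bool) :
    IsVarList N ((List.range N).filter p) :=
  ⟨List.Pairwise.filter _ List.pairwise_lt_range,
    fun _ hx => List.mem_range.1 (List.mem_filter.1 hx).1⟩

theorem IsVarList.filter {N : ℕ} {l : List ℕ} (h : IsVarList N l) (p : ℕ → Bool) :
    IsVarList N (l.filter p) :=
  ⟨List.Pairwise.filter _ h.sorted, fun x hx => h.lt x (List.mem_filter.1 hx).1⟩

theorem IsVarList.nodup {N : ℕ} {l : List ℕ} (h : IsVarList N l) : l.Nodup :=
  h.sorted.imp fun h => h.ne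

theorem IsVarList.card_toFinset {N : ℕ} {l : List ℕ} (h : IsVarList N l) :
    l.toFinset.card = l.length :=
  List.toFinset_card_of_nodup h.nodup

theorem isVarList_bag (N x : ℕ) (H : List (List ℕ)) : IsVarList N (bag N x H) :=
  isVarList_range_filter N _

/-! ### Elimination of quantified variables -/

/-- The atom as a formula. -/
def QAtom.formula (a : QAtom) : FOFormula := .atom a.symbol a.2.get

theorem QAtom.free_formula (a : QAtom) : a.formula.free = a.2.toFinset := by
  ext x
  simp [QAtom.formula, FOFormula.free, QAtom.symbol, List.mem_iff_get]

theorem QAtom.sat_formula (a : QAtom) (B : FinStructure) (g : ℕ → B.carrier) :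
    a.formula.Sat B g ↔ B.Holds a.1 (a.2.map g) := by
  conv_rhs => rw [← List.ofFn_get a.2, List.map_ofFn, B.holds_ofFn]
  rfl

/-- Conjunction of labels. -/
def conjLabels (T : List (List ℕ × FOFormula)) : FOFormula :=
  T.foldr (fun f φ => .and f.2 φ) .tru

/-- The formula that results from the elimination of a quantified variable. -/
def exLabel (x : ℕ) (_ : List ℕ) (T : List (List ℕ × FOFormula)) : FOFormula :=
  .ex x (conjLabels T)

theorem sat_conjLabels (T : List (List ℕ × FOFormula)) (B : FinStructure) (g : ℕ → B.carrier) :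
    (conjLabels T).Sat B g ↔ ∀ f ∈ T, f.2.Sat B g := by
  induction T with
  | nil => simp [conjLabels, FOFormula.Sat]
  | cons f T ih => simpa [conjLabels, FOFormula.Sat] using fun _ => ih

/-- A pp-formula of width at most `k` with symbols in `S`, labelled with its free variables. -/
structure IsPPLabel (N k : ℕ) (S : Set RelSymbol) (f : List ℕ × FOFormula) : Prop where
  isPP : f.2.IsPP
  free_eq : f.2.free = f.1.toFinset
  isVarList : IsVarList N f.1
  length_le : f.1.length ≤ k
  width_le : f.2.width ≤ k
  symbols_subset : f.2.symbols ⊆ S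

/-- Every partial conjunction has its free variables inside the bag `U`, so the bag together with
the labels bounds the width. -/
theorem isPPLabel_conj {N k : ℕ} {S : Set RelSymbol} {U : Finset ℕ} (hU : U.card ≤ k)
    (T : List (List ℕ × FOFormula)) (hT : ∀ f ∈ T, IsPPLabel N k S f)
    (hTU : ∀ f ∈ T, ∀ x ∈ f.1, x ∈ U) :
    (conjLabels T).IsPP ∧ (conjLabels T).width ≤ k ∧ (conjLabels T).symbols ⊆ S ∧
      (∀ x, x ∈ (conjLabels T).free ↔ ∃ f ∈ T, x ∈ f.1) := by
  induction T with
  | nil => simp [conjLabels, FOFormula.IsPP, FOFormula.width, FOFormula.symbols, FOFormula.free]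
  | cons f T ih =>
    obtain ⟨h1, h2, h3, h4⟩ := ih (fun f hf => hT f (List.mem_cons_of_mem _ hf))
      fun f hf => hTU f (List.mem_cons_of_mem _ hf)
    have hf := hT f List.mem_cons_self
    have hfree : ∀ x, x ∈ (conjLabels (f :: T)).free ↔ ∃ f' ∈ f :: T, x ∈ f'.1 := by
      intro x
      have : (conjLabels (f :: T)).free = f.2.free ∪ (conjLabels T).free := rfl
      rw [this, Finset.mem_union, h4, hf.free_eq]
      simp
    refine ⟨⟨hf.isPP, h1⟩, ?_, Set.union_subset hf.symbols_subset h3, hfree⟩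
    refine max_le ((Finset.card_le_card fun x hx => ?_).trans hU) (max_le hf.width_le h2)
    obtain ⟨f', hf', hx'⟩ := (hfree x).1 hx
    exact hTU f' hf' x hx'

theorem isPPLabel_elimStep {N k : ℕ} {S : Set RelSymbol} {F : List (List ℕ × FOFormula)} {x : ℕ}
    (hF : ∀ f ∈ F, IsPPLabel N k S f) (hk : (bag N x (F.map Prod.fst)).length ≤ k) :
    ∀ f ∈ elimStep N exLabel F x, IsPPLabel N k S f := by
  intro f hf
  rw [elimStep, List.mem_cons] at hf
  rcases hf with rfl | hf
  · have hb := isVarList_bag N x (F.map Prod.fst)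
    obtain ⟨h1, h2, h3, h4⟩ := isPPLabel_conj (U := (bag N x (F.map Prod.fst)).toFinset)
      (hb.card_toFinset.trans_le hk) (F.filter fun f => x ∈ f.1)
      (fun f hf => hF f (List.mem_filter.1 hf).1) fun f hf y hy => by
        rw [List.mem_filter] at hf
        rw [List.mem_toFinset, mem_bag]
        exact ⟨(hF f hf.1).isVarList.lt y hy, f.1, List.mem_map_of_mem hf.1,
          by simpa using hf.2, hy⟩
    have h5 : ((conjLabels (F.filter fun f => x ∈ f.1)).ex x).free =
        ((bag N x (F.map Prod.fst)).filter (fun y => y ≠ x)).toFinset := by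
      ext y
      simp only [FOFormula.free, Finset.mem_erase, h4, List.mem_toFinset, List.mem_filter, mem_bag,
        List.mem_map, decide_eq_true_eq]
      constructor
      · rintro ⟨hyx, f, ⟨hf, hx⟩, hy⟩
        exact ⟨⟨(hF f hf).isVarList.lt y hy, _, ⟨f, hf, rfl⟩, hx, hy⟩, hyx⟩
      · rintro ⟨⟨-, _, ⟨f, hf, rfl⟩, hx, hy⟩, hyx⟩
        exact ⟨hyx, f, ⟨hf, hx⟩, hy⟩
    have h6 := (List.length_filter_le (fun y => decide (y ≠ x)) (bag N x (F.map Prod.fst))).trans hk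
    refine ⟨h1, h5, hb.filter _, h6, ?_, h3⟩
    refine max_le ?_ h2
    rw [h5, (hb.filter _).card_toFinset]
    exact h6
  · exact hF f (List.mem_filter.1 hf).1

/-- The quantifier moves past the labels in which `x` is not free. -/
theorem sat_elimStep {N k : ℕ} {S : Set RelSymbol} {F : List (List ℕ × FOFormula)} {x : ℕ}
    (hF : ∀ f ∈ F, IsPPLabel N k S f) (B : FinStructure) (g : ℕ → B.carrier) :
    (∀ f ∈ elimStep N exLabel F x, f.2.Sat B g) ↔
      ∃ b, ∀ f ∈ F, f.2.Sat B (Function.update g x b) := by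
  have h : ∀ f ∈ F, x ∉ f.1 → ∀ b, (f.2.Sat B (Function.update g x b) ↔ f.2.Sat B g) := by
    intro f hf hx b
    refine FOFormula.sat_congr B f.2 _ _ fun y hy => ?_
    rw [(hF f hf).free_eq, List.mem_toFinset] at hy
    exact Function.update_of_ne (by rintro rfl; exact hx hy) _ _
  simp only [elimStep, List.forall_mem_cons, exLabel, FOFormula.Sat, sat_conjLabels,
    List.mem_filter, decide_eq_true_eq]
  constructor
  · rintro ⟨⟨b, h1⟩, h2⟩
    refine ⟨b, fun f hf => ?_⟩
    by_cases hx : x ∈ f.1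
    · exact h1 f ⟨hf, hx⟩
    · exact (h f hf hx b).2 (h2 f ⟨hf, hx⟩)
  · rintro ⟨b, h1⟩
    exact ⟨⟨b, fun f hf => h1 f hf.1⟩, fun f hf => (h f hf.1 hf.2 b).1 (h1 f hf.1)⟩

theorem foldl_elimStep_exLabel {N k : ℕ} {S : Set RelSymbol} {l : List ℕ} :
    ∀ {F : List (List ℕ × FOFormula)}, (∀ f ∈ F, IsPPLabel N k S f) →
    elimCost N (F.map Prod.fst) l ≤ k →
    (∀ f ∈ l.foldl (elimStep N exLabel) F, IsPPLabel N k S f) ∧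
    ∀ (B : FinStructure) (g : ℕ → B.carrier),
      (∀ f ∈ l.foldl (elimStep N exLabel) F, f.2.Sat B g) ↔
        ∃ g' : ℕ → B.carrier, (∀ y ∉ l, g' y = g y) ∧ ∀ f ∈ F, f.2.Sat B g' := by
  induction l with
  | nil =>
    intro F hF _
    refine ⟨hF, fun B g => ⟨fun h => ⟨g, fun _ _ => rfl, h⟩, ?_⟩⟩
    rintro ⟨g', hg', h⟩
    obtain rfl : g' = g := funext fun y => hg' y (by simp)
    exact h
  | cons x l ih =>
    intro F hF hk
    rw [elimCost, max_le_iff, ← map_fst_elimStep N exLabel] at hk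
    obtain ⟨h1, h2⟩ := ih (isPPLabel_elimStep hF hk.1) hk.2
    refine ⟨h1, fun B g => (h2 B g).trans ?_⟩
    simp only [sat_elimStep hF, List.mem_cons, not_or]
    constructor
    · rintro ⟨g', hg', b, h⟩
      refine ⟨_, fun y hy => ?_, h⟩
      rw [Function.update_of_ne hy.1, hg' y hy.2]
    · rintro ⟨g', hg', h⟩
      -- The later eliminations must start from an assignment that agrees with `g` outside of `l`,
      -- hence the reset at `x`; `g' x` is the witness for `x`.
      refine ⟨Function.update g' x (g x), fun y hy => ?_, g' x, by simpa using h⟩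
      by_cases hyx : y = x
      · subst hyx; simp
      · rw [Function.update_of_ne hyx, hg' y ⟨hyx, hy⟩]

/-! ### Elimination of liberal variables -/

/-- The product of the labels, all expanded to the variables in `U`. -/
def prodLabels (U : List ℕ) (T : List (List ℕ × SharpFormula)) : SharpFormula :=
  T.foldr (fun f ψ => .mul (.expand (U.filter fun y => y ∉ f.1).toFinset f.2) ψ)
    (.cast .tru U.toFinset)

/-- The formula that results from the elimination of a liberal variable. -/
def projLabel (x : ℕ) (U : List ℕ) (T : List (List ℕ × SharpFormula)) : SharpFormula :=
  .proj {x} (prodLabels U T)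

/-- A ♯PP-formula of width at most `k` with symbols in `S` and closed variables in `D`, labelled with
its free variables. -/
structure IsSharpLabel (N k : ℕ) (S : Set RelSymbol) (D : Finset ℕ) (f : List ℕ × SharpFormula) :
    Prop where
  wf : f.2.WellFormed
  castsPP : f.2.CastsPP
  free_eq : f.2.free = f.1.toFinset
  isVarList : IsVarList N f.1
  length_le : f.1.length ≤ k
  width_le : f.2.width ≤ k
  symbols_subset : f.2.symbols ⊆ S
  closed_subset : f.2.closed ⊆ D
  notMem : ∀ x ∈ f.1, x ∉ D

/-- Expansion to the bag `U` equalizes the free variables, as products require. Since `U` avoids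
`D`, expansion cannot meet closed variables. The empty product is `⊤` cast to the bag, with value
`1`. -/
theorem isSharpLabel_prod {N k : ℕ} {S : Set RelSymbol} {D : Finset ℕ} {U : List ℕ}
    (hU : U.toFinset.card ≤ k) (hUD : ∀ x ∈ U, x ∉ D)
    (T : List (List ℕ × SharpFormula)) (hT : ∀ f ∈ T, IsSharpLabel N k S D f)
    (hd : T.Pairwise fun f f' => Disjoint f.2.closed f'.2.closed)
    (hTU : ∀ f ∈ T, ∀ x ∈ f.1, x ∈ U) :
    (prodLabels U T).WellFormed ∧ (prodLabels U T).CastsPP ∧ (prodLabels U T).free = U.toFinset ∧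
      (prodLabels U T).width ≤ k ∧ (prodLabels U T).symbols ⊆ S ∧
      (∀ x ∈ (prodLabels U T).closed, ∃ f ∈ T, x ∈ f.2.closed) ∧
      ∀ (B : FinStructure) (g : ℕ → B.carrier),
        (prodLabels U T).eval B g = (T.map fun f => f.2.eval B g).prod := by
  induction T with
  | nil =>
    refine ⟨?_, trivial, rfl, max_le hU (by simp [FOFormula.width]), ?_, ?_, fun B g => ?_⟩
    · simp [prodLabels, SharpFormula.WellFormed, FOFormula.free]
    · simp [prodLabels, SharpFormula.symbols, FOFormula.symbols]
    · simp [prodLabels, SharpFormula.closed]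
    · simp [prodLabels, SharpFormula.eval, FOFormula.Sat]
  | cons f T ih =>
    rw [List.pairwise_cons] at hd
    obtain ⟨h1, h2, h3, h4, h5, h6, h7⟩ := ih (fun f hf => hT f (List.mem_cons_of_mem _ hf)) hd.2
      fun f hf => hTU f (List.mem_cons_of_mem _ hf)
    have hf := hT f List.mem_cons_self
    have hfU := hTU f List.mem_cons_self
    have hfree : (U.filter fun y => y ∉ f.1).toFinset ∪ f.2.free = U.toFinset := by
      rw [hf.free_eq]
      ext y
      simp only [Finset.mem_union, List.mem_toFinset, List.mem_filter, decide_eq_true_eq]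
      have := hfU y
      tauto
    have hcl : Disjoint f.2.closed (prodLabels U T).closed := by
      rw [Finset.disjoint_left]
      intro x hx hx'
      obtain ⟨f', hf', hx''⟩ := h6 x hx'
      exact Finset.disjoint_left.1 (hd.1 f' hf') hx hx''
    refine ⟨⟨⟨hf.wf, ?_⟩, h1, hfree.trans h3.symm, hcl⟩, ⟨hf.castsPP, h2⟩, hfree, ?_,
      Set.union_subset hf.symbols_subset h5, ?_, fun B g => ?_⟩
    · rw [Finset.disjoint_union_right]
      refine ⟨?_, ?_⟩ <;> rw [Finset.disjoint_left] <;> intro x hx hx'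
      · rw [hf.free_eq] at hx'
        simp only [List.mem_toFinset, List.mem_filter, decide_eq_true_eq] at hx hx'
        exact hx.2 hx'
      · simp only [List.mem_toFinset, List.mem_filter, decide_eq_true_eq] at hx
        exact hUD x hx.1 (hf.closed_subset hx')
    · have hc : ((U.filter fun y => y ∉ f.1).toFinset ∪ f.2.free).card ≤ k := by rwa [hfree]
      exact max_le hc (max_le (max_le hc hf.width_le) h4)
    · intro x hx
      rcases Finset.mem_union.1 hx with hx | hx
      · exact ⟨f, List.mem_cons_self, hx⟩
      · obtain ⟨f', hf', hx'⟩ := h6 x hx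
        exact ⟨f', List.mem_cons_of_mem _ hf', hx'⟩
    · rw [List.map_cons, List.prod_cons, ← h7]
      rfl

theorem eval_proj_singleton (x : ℕ) (ψ : SharpFormula) (B : FinStructure) (g : ℕ → B.carrier) :
    (SharpFormula.proj {x} ψ).eval B g = ∑ b, ψ.eval B (Function.update g x b) := by
  have := sumOver_insert (Finset.notMem_empty x) (fun g => ψ.eval B g) g
  simp only [sumOver_empty] at this
  exact this

theorem prod_map_filter_mul {α : Type*} (p : α → Prop) [DecidablePred p] (f : α → ℤ) (l : List α) :
    ((l.filter fun a => p a).map f).prod * ((l.filter fun a => ¬ p a).map f).prod =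
      (l.map f).prod := by
  induction l with
  | nil => simp
  | cons a l ih =>
    by_cases h : p a
    · simp [h, mul_assoc, ← ih]
    · simp [h, mul_left_comm, ← ih]

/-- The labels have pairwise disjoint sets of closed variables. -/
structure AreSharpLabels (N k : ℕ) (S : Set RelSymbol) (D : Finset ℕ)
    (F : List (List ℕ × SharpFormula)) : Prop where
  label : ∀ f ∈ F, IsSharpLabel N k S D f
  disj : F.Pairwise fun f f' => Disjoint f.2.closed f'.2.closed

/-- Distributivity: labels without `x` do not change with the value of `x` and can be taken out of
the sum. `D` collects the variables already projected away; as `x` is not among them, the projection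
is well-formed. -/
theorem AreSharpLabels.elimStep {N k : ℕ} {S : Set RelSymbol} {D : Finset ℕ}
    {F : List (List ℕ × SharpFormula)} (hF : AreSharpLabels N k S D F) {x : ℕ} (hx : x ∉ D)
    (hk : (bag N x (F.map Prod.fst)).length ≤ k) :
    AreSharpLabels N k S (insert x D) (elimStep N projLabel F x) ∧
    ∀ (B : FinStructure) (g : ℕ → B.carrier),
      ((SharpLogic.elimStep N projLabel F x).map fun f => f.2.eval B g).prod =
        ∑ b, (F.map fun f => f.2.eval B (Function.update g x b)).prod := by
  set U := bag N x (F.map Prod.fst) with hUdef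
  have hb : IsVarList N U := isVarList_bag N x _
  have hT : ∀ f ∈ F.filter fun f => x ∈ f.1, f ∈ F ∧ x ∈ f.1 := fun f hf => by
    simpa using List.mem_filter.1 hf
  have hR : ∀ f ∈ F.filter fun f => x ∉ f.1, f ∈ F ∧ x ∉ f.1 := fun f hf => by
    simpa using List.mem_filter.1 hf
  have hmemU : ∀ y, y ∈ U ↔ ∃ f ∈ F, x ∈ f.1 ∧ y ∈ f.1 := by
    intro y
    rw [hUdef, mem_bag]
    simp only [List.mem_map]
    constructor
    · rintro ⟨-, _, ⟨f, hf, rfl⟩, h⟩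
      exact ⟨f, hf, h⟩
    · rintro ⟨f, hf, h⟩
      exact ⟨(hF.label f hf).isVarList.lt y h.2, _, ⟨f, hf, rfl⟩, h⟩
  have hUD : ∀ y ∈ U, y ∉ D := by
    intro y hy
    obtain ⟨f, hf, -, h⟩ := (hmemU y).1 hy
    exact (hF.label f hf).notMem y h
  obtain ⟨h1, h2, h3, h4, h5, h6, h7⟩ := isSharpLabel_prod (U := U) (hb.card_toFinset.trans_le hk)
    hUD (F.filter fun f => x ∈ f.1) (fun f hf => hF.label f (hT f hf).1) (hF.disj.filter _)
    fun f hf y hy => (hmemU y).2 ⟨f, (hT f hf).1, (hT f hf).2, hy⟩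
  have hclD : (prodLabels U (F.filter fun f => x ∈ f.1)).closed ⊆ D := fun y hy => by
    obtain ⟨f, hf, hy'⟩ := h6 y hy
    exact (hF.label f (hT f hf).1).closed_subset hy'
  have hfree : (SharpFormula.proj {x} (prodLabels U (F.filter fun f => x ∈ f.1))).free =
      (U.filter fun y => y ≠ x).toFinset := by
    rw [SharpFormula.free, h3]
    ext y
    simp
  have hlen := (List.length_filter_le (fun y => decide (y ≠ x)) U).trans hk
  refine ⟨⟨?_, ?_⟩, fun B g => ?_⟩
  · intro f hf
    rw [SharpLogic.elimStep, List.mem_cons] at hf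
    rcases hf with rfl | hf
    · refine ⟨⟨h1, ?_⟩, h2, hfree, hb.filter _, hlen, max_le ?_ h4, h5, ?_, ?_⟩
      · rw [Finset.disjoint_singleton_left]
        exact fun h => hx (hclD h)
      · rw [hfree, (hb.filter _).card_toFinset]; exact hlen
      · intro y hy
        rcases Finset.mem_union.1 hy with hy | hy
        · exact Finset.mem_insert.2 (Or.inl (Finset.mem_singleton.1 hy))
        · exact Finset.mem_insert_of_mem (hclD hy)
      · intro y hy
        rw [List.mem_filter] at hy
        rw [Finset.mem_insert, not_or]
        exact ⟨by simpa using hy.2, hUD y hy.1⟩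
    · obtain ⟨hf, hxf⟩ := hR f hf
      have := hF.label f hf
      refine ⟨this.wf, this.castsPP, this.free_eq, this.isVarList, this.length_le, this.width_le,
        this.symbols_subset, this.closed_subset.trans (Finset.subset_insert _ _), fun y hy => ?_⟩
      rw [Finset.mem_insert, not_or]
      exact ⟨fun h => hxf (h ▸ hy), this.notMem y hy⟩
  · rw [SharpLogic.elimStep, List.pairwise_cons]
    refine ⟨fun f' hf' => ?_, hF.disj.filter _⟩
    obtain ⟨hf', hxf'⟩ := hR f' hf'
    rw [Finset.disjoint_left]
    intro y hy hy'
    rcases Finset.mem_union.1 hy with hy | hy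
    · rw [Finset.mem_singleton] at hy
      exact hx ((hF.label f' hf').closed_subset (hy ▸ hy'))
    · obtain ⟨f, hf, hyf⟩ := h6 y hy
      -- Only `f` contains `x`, so these are different members of the list and their closed
      -- variables are disjoint.
      have hne : f ≠ f' := fun h => hxf' (h ▸ (hT f hf).2)
      have : Std.Symm fun f f' : List ℕ × SharpFormula => Disjoint f.2.closed f'.2.closed :=
        ⟨fun _ _ h => h.symm⟩
      have := hF.disj.forall (hT f hf).1 hf' hne
      exact Finset.disjoint_left.1 this hyf hy'
  · rw [SharpLogic.elimStep, List.map_cons, List.prod_cons]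
    simp only [projLabel]
    rw [eval_proj_singleton, Finset.sum_mul]
    refine Finset.sum_congr rfl fun b _ => ?_
    rw [h7, ← prod_map_filter_mul (fun f => x ∈ f.1) (fun f => f.2.eval B (Function.update g x b)) F]
    congr 2
    refine List.map_congr_left fun f hf => ?_
    obtain ⟨hf, hxf⟩ := hR f hf
    refine SharpFormula.eval_congr B f.2 (hF.label f hf).wf _ _ fun y hy => ?_
    rw [(hF.label f hf).free_eq, List.mem_toFinset] at hy
    exact (Function.update_of_ne (by rintro rfl; exact hxf hy) _ _).symm

theorem AreSharpLabels.foldl_elimStep {N k : ℕ} {S : Set RelSymbol} {l : List ℕ} :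
    ∀ {D : Finset ℕ} {F : List (List ℕ × SharpFormula)}, AreSharpLabels N k S D F → l.Nodup →
    (∀ x ∈ l, x ∉ D) → elimCost N (F.map Prod.fst) l ≤ k →
    (∃ D', AreSharpLabels N k S D' (l.foldl (SharpLogic.elimStep N projLabel) F)) ∧
    ∀ (B : FinStructure) (g : ℕ → B.carrier),
      ((l.foldl (SharpLogic.elimStep N projLabel) F).map fun f => f.2.eval B g).prod =
        sumOver l.toFinset (fun g => (F.map fun f => f.2.eval B g).prod) g := by
  induction l with
  | nil =>
    intro D F hF _ _ _
    exact ⟨⟨D, hF⟩, fun B g => by rw [List.toFinset_nil, sumOver_empty]; rfl⟩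
  | cons x l ih =>
    intro D F hF hl hD hk
    rw [elimCost, max_le_iff, ← map_fst_elimStep N projLabel] at hk
    rw [List.nodup_cons] at hl
    obtain ⟨h1, h2⟩ := hF.elimStep (hD x List.mem_cons_self) hk.1
    obtain ⟨h3, h4⟩ := ih h1 hl.2 (fun y hy => by
      rw [Finset.mem_insert, not_or]
      exact ⟨fun h => hl.1 (h ▸ hy), hD y (List.mem_cons_of_mem _ hy)⟩) hk.2
    refine ⟨h3, fun B g => (h4 B g).trans ?_⟩
    have hu : (x :: l).toFinset = l.toFinset ∪ insert x ∅ := by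
      ext y; simp
    rw [hu, sumOver_union (by simpa using hl.1)]
    refine sumOver_congr fun f _ => ?_
    rw [h2, sumOver_insert (Finset.notMem_empty x)]
    simp only [sumOver_empty]

/-! ### The formula of a candidate -/

/-- The atoms of the image of `A` under `h`, labelled with their variables. -/
def initialLabels (N : ℕ) (A : List QAtom) (h : ℕ → ℕ) : List (List ℕ × FOFormula) :=
  A.map fun a => ((List.range N).filter fun y => y ∈ a.2.map h, (a.map h).formula)

/-- The ♯PP-formula constructed from a candidate. -/
def candidateFormula (N : ℕ) (A : List QAtom) (c : List ℕ × List ℕ × List ℕ) : SharpFormula :=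
  prodLabels [] (c.2.2.foldl (elimStep N projLabel)
    ((c.2.1.foldl (elimStep N exLabel) (initialLabels N A (listFun c.1))).map
      fun f => (f.1, .cast f.2 f.1.toFinset)))

/-- The image atoms are among the atoms of `A`, so answers of `A` are answers of the image.
Conversely, composition with the endomorphism turns answers of the image into answers of `A`,
injectively because it permutes `V`. -/
theorem IsCandidate.queryCount_map {V : List ℕ} {A : List QAtom} {c : List ℕ × List ℕ × List ℕ}
    (hc : IsCandidate V A c) (B : FinStructure) :
    queryCount V.toFinset (A.map (QAtom.map (listFun c.1))) B = queryCount V.toFinset A B := by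
  set e := listFun c.1
  have hsurj : Function.Surjective fun v : V.toFinset =>
      (⟨e v, by simpa using hc.maps v (List.mem_toFinset.1 v.2)⟩ : V.toFinset) := by
    rintro ⟨v, hv⟩
    obtain ⟨u, hu, huv⟩ := hc.surj v (by simpa using hv)
    exact ⟨⟨u, by simpa using hu⟩, Subtype.ext huv⟩
  apply le_antisymm
  · refine Set.ncard_le_ncard_of_injOn (fun k v => k ⟨e v, by
      simpa using hc.maps v (List.mem_toFinset.1 v.2)⟩) ?_ ?_ (Set.toFinite _)
    · rintro k ⟨g, hg, hA⟩
      exact ⟨g ∘ e, fun v => hg ⟨e v, _⟩, (FinStructure.models_map e).1 hA⟩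
    · intro k _ k' _ h
      refine funext fun v => ?_
      obtain ⟨u, rfl⟩ := hsurj v
      exact congrFun h u
  · refine Set.ncard_le_ncard ?_ (Set.toFinite _)
    rintro k ⟨g, hg, hA⟩
    refine ⟨g, hg, ?_⟩
    intro a ha
    obtain ⟨a', ha', rfl⟩ := List.mem_map.1 ha
    exact hA _ (hc.hom a' ha')

/-- Casting the labels left after the quantified variables gives factors `0` or `1`, whose product
indicates solvability of the image query. Summation over the liberal variables counts its answers,
and `queryCount_map` returns to `A`. All bags and atoms are bounded by the cost. -/
theorem IsCandidate.formula_spec {M : ℕ} {V : List ℕ} {A : List QAtom}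
    {c : List ℕ × List ℕ × List ℕ} (hc : IsCandidate V A c) (hV : V.Nodup)
    (hA : ∀ a ∈ A, ∀ x ∈ a.2, x < M) :
    (candidateFormula M A c).IsSharpPP ∧ (candidateFormula M A c).free = ∅ ∧
      (candidateFormula M A c).symbols ⊆ {R | ∃ a ∈ A, R = a.symbol} ∧
      (candidateFormula M A c).width ≤ candidateCost M A c ∧
      ∀ (B : FinStructure) (g : ℕ → B.carrier),
        (candidateFormula M A c).eval B g = queryCount V.toFinset A B := by
  set e := listFun c.1 with he
  set k := candidateCost M A c with hk
  set S : Set RelSymbol := {R | ∃ a ∈ A, R = a.symbol}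
  set F₀ := initialLabels M A e with hF₀
  have hF₀map : F₀.map Prod.fst = imageEdges M A e := by
    simp [F₀, initialLabels, imageEdges]
  obtain ⟨hk0, hk1, hk2⟩ : (∀ l ∈ F₀.map Prod.fst, l.length ≤ k) ∧
      elimCost M (F₀.map Prod.fst) c.2.1 ≤ k ∧
      elimCost M (c.2.1.foldl (elimEdges M) (F₀.map Prod.fst)) c.2.2 ≤ k := by
    have : candidateCost M A c ≤ k := le_rfl
    rw [candidateCost, max_le_iff, foldr_max_le, elimCost_append, max_le_iff, ← he, ← hF₀map,
      List.forall_mem_map] at this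
    exact this
  have hF₀label : ∀ f ∈ F₀, IsPPLabel M k S f := by
    intro f hf
    have hlen := hk0 f.1 (List.mem_map_of_mem hf)
    obtain ⟨a, ha, rfl⟩ := List.mem_map.1 hf
    have hfree : (a.map e).formula.free =
        ((List.range M).filter fun y => y ∈ a.2.map e).toFinset := by
      rw [QAtom.free_formula]
      ext y
      simp only [List.mem_toFinset, List.mem_filter, List.mem_range, decide_eq_true_eq, QAtom.map]
      -- The image atom is itself an atom of `A`, so its variables are below `M` and the filter
      -- loses none.
      exact ⟨fun h => ⟨hA _ (hc.hom a ha) y h, h⟩, fun h => h.2⟩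
    have hv := isVarList_range_filter M fun y => y ∈ a.2.map e
    refine ⟨trivial, hfree, hv, hlen, ?_, ?_⟩
    · change (a.map e).formula.free.card ≤ k
      rw [hfree, hv.card_toFinset]
      exact hlen
    · rintro R rfl
      exact ⟨a.map e, hc.hom a ha, rfl⟩
  obtain ⟨hF₁, hs₁⟩ := foldl_elimStep_exLabel hF₀label hk1
  set F₁ := c.2.1.foldl (elimStep M exLabel) F₀ with hF₁def
  have hF₁map : F₁.map Prod.fst = c.2.1.foldl (elimEdges M) (F₀.map Prod.fst) :=
    map_fst_foldl_elimStep M exLabel c.2.1 F₀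
  set G : List (List ℕ × SharpFormula) := F₁.map fun f => (f.1, .cast f.2 f.1.toFinset) with hG
  have hGmap : G.map Prod.fst = F₁.map Prod.fst := by simp [G]
  have hGlabel : AreSharpLabels M k S ∅ G := by
    constructor
    · simp only [hG, List.forall_mem_map]
      intro f hf
      have := hF₁ f hf
      exact ⟨this.free_eq.subset, this.isPP, rfl, this.isVarList, this.length_le,
        max_le (this.isVarList.card_toFinset.trans_le this.length_le) this.width_le,
        this.symbols_subset, by simp [SharpFormula.closed], by simp⟩
    · rw [hG, List.pairwise_map]
      exact List.pairwise_of_forall (by simp [SharpFormula.closed])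
  -- A list that covers the repetition-free `V` and has its length is a permutation of it; so no
  -- variable is projected twice.
  have hperm : V.Perm c.2.2 :=
    (hV.subperm hc.lib_subset).perm_of_length_le hc.length_eq.le
  obtain ⟨⟨D, hF₂⟩, hs₂⟩ := hGlabel.foldl_elimStep (hperm.nodup_iff.1 hV) (by simp)
    (by rw [hGmap, hF₁map]; exact hk2)
  set F₂ := c.2.2.foldl (elimStep M projLabel) G with hF₂def
  -- Every variable of the image has been eliminated, so the final product, over an empty bag, is a
  -- sentence.
  have hempty : ∀ f ∈ F₂, ∀ x ∈ f.1, x ∈ ([] : List ℕ) := by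
    intro f hf x hx
    have h1 : f.1 ∈ c.2.2.foldl (elimEdges M) (G.map Prod.fst) := by
      rw [← map_fst_foldl_elimStep M projLabel]
      exact List.mem_map_of_mem hf
    obtain ⟨h2, l, hl, hxl⟩ := foldl_elimEdges_mem _ h1 x hx
    rw [hGmap, hF₁map] at hl
    obtain ⟨h3, l', hl', hxl'⟩ := foldl_elimEdges_mem _ hl x hxl
    rw [hF₀map] at hl'
    obtain ⟨a, ha, rfl⟩ := List.mem_map.1 hl'
    obtain ⟨y, hy, rfl⟩ := by simpa using (List.mem_filter.1 hxl').2
    rcases hc.cover a ha y hy with h | h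
    · exact absurd (hc.lib_subset _ h) h2
    · exact absurd h h3
  obtain ⟨h1, h2, h3, h4, h5, -, h7⟩ := isSharpLabel_prod (U := []) (by simp) (by simp) F₂
    hF₂.label hF₂.disj hempty
  have hdef : candidateFormula M A c = prodLabels [] F₂ := rfl
  rw [hdef]
  refine ⟨⟨h1, h2⟩, h3, h5, h4, fun B g => ?_⟩
  have hVρ : V.toFinset = c.2.2.toFinset := by
    ext x; simp [hperm.mem_iff]
  rw [h7, hs₂, ← hVρ, ← hc.queryCount_map, ← solutionCount_eq_queryCount B (l := c.2.1)
    (fun x hx => by simpa using hc.bound_notMem x hx) ?_ g]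
  · refine sumOver_congr fun f _ => ?_
    have hsolve : B.Solves (A.map (QAtom.map e)) c.2.1 f ↔ ∀ f' ∈ F₁, f'.2.Sat B f := by
      rw [hs₁]
      simp only [hF₀, initialLabels, List.forall_mem_map, QAtom.sat_formula]
      simp only [FinStructure.Solves, FinStructure.Models, List.forall_mem_map]
    rw [hsolve]
    simp only [hG, List.map_map]
    -- A product of indicators is the indicator of the conjunction.
    generalize F₁ = F
    induction F with
    | nil => simp
    | cons f' F ih =>
      rw [List.map_cons, List.prod_cons, ih]
      simp only [Function.comp_apply, SharpFormula.eval]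
      have hcons : (∀ f'' ∈ f' :: F, f''.2.Sat B f) ↔ f'.2.Sat B f ∧ ∀ f'' ∈ F, f''.2.Sat B f :=
        List.forall_mem_cons (p := fun f'' : List ℕ × FOFormula => f''.2.Sat B f)
      by_cases h : f'.2.Sat B f
      · by_cases h' : ∀ f'' ∈ F, f''.2.Sat B f
        · rw [if_pos h, if_pos h', if_pos (hcons.2 ⟨h, h'⟩), one_mul]
        · rw [if_neg h', if_neg fun h'' => h' (hcons.1 h'').2, mul_zero]
      · rw [if_neg h, if_neg fun h'' => h (hcons.1 h'').1, zero_mul]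
  · simp only [List.forall_mem_map, QAtom.map]
    intro a ha x hx
    simpa using hc.cover a ha x hx


/-! ### Construction of codes -/

/-- An increasing list is the sorted list of its own elements, so the algorithm can code sets of
variables without sorting. -/
theorem codeVars_toFinset {N : ℕ} {l : List ℕ} (hl : IsVarList N l) :
    codeVars l.toFinset = Encodable.encode l := by
  rw [codeVars, List.toFinset_sort (· ≤ ·) hl.nodup |>.2 (hl.sorted.imp fun h => h.le)]

/-- Application of a function to the labels. -/
def mapLabels {α β : Type} (φ : α → β) (F : List (List ℕ × α)) : List (List ℕ × β) :=
  F.map fun f => (f.1, φ f.2)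

theorem map_fst_mapLabels {α β : Type} (φ : α → β) (F : List (List ℕ × α)) :
    (mapLabels φ F).map Prod.fst = F.map Prod.fst := by
  simp [mapLabels]

theorem mapLabels_filter {α β : Type} (φ : α → β) (F : List (List ℕ × α)) (p : List ℕ → Bool) :
    mapLabels φ (F.filter fun f => p f.1) = (mapLabels φ F).filter fun f => p f.1 := by
  simp only [mapLabels, List.filter_map]
  rfl

/-- The course of an elimination depends on the edges alone. Hence a map of labels commutes with it
once it commutes with the formation of one label. -/
theorem mapLabels_foldl_elimStep {α β : Type} {N : ℕ} (φ : α → β)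
    {c : ℕ → List ℕ → List (List ℕ × α) → α} {c' : ℕ → List ℕ → List (List ℕ × β) → β}
    (h : ∀ x U T, IsVarList N U → φ (c x U T) = c' x U (mapLabels φ T)) (l : List ℕ) :
    ∀ F, mapLabels φ (l.foldl (elimStep N c) F) = l.foldl (elimStep N c') (mapLabels φ F) := by
  induction l with
  | nil => intro F; rfl
  | cons x l ih =>
    intro F
    rw [List.foldl_cons, List.foldl_cons, ih]
    congr 1
    have h1 : ∀ (f : List ℕ × α) F', mapLabels φ (f :: F') = (f.1, φ f.2) :: mapLabels φ F' :=
      fun _ _ => rfl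
    rw [elimStep, elimStep, h1, h _ _ _ (isVarList_bag N x _), mapLabels_filter φ F fun e => x ∈ e,
      mapLabels_filter φ F fun e => x ∉ e, map_fst_mapLabels]

/-- The code of a conjunction of labels. -/
def conjCode (T : List (List ℕ × ℕ)) : ℕ :=
  T.foldr (fun f n => Nat.pair 3 (Nat.pair f.2 n)) (Nat.pair 0 0)

/-- The code of the label introduced by the elimination of a quantified variable. -/
def exCode (x : ℕ) (_ : List ℕ) (T : List (List ℕ × ℕ)) : ℕ := Nat.pair 5 (Nat.pair x (conjCode T))

/-- The code of a product of labels. -/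
def prodCode (U : List ℕ) (T : List (List ℕ × ℕ)) : ℕ :=
  T.foldr (fun f n => Nat.pair 3 (Nat.pair
      (Nat.pair 2 (Nat.pair (Encodable.encode (U.filter fun y => y ∉ f.1)) f.2)) n))
    (Nat.pair 0 (Nat.pair (Nat.pair 0 0) (Encodable.encode U)))

/-- The code of the label introduced by the elimination of a liberal variable. -/
def projCode (x : ℕ) (U : List ℕ) (T : List (List ℕ × ℕ)) : ℕ :=
  Nat.pair 1 (Nat.pair (Encodable.encode [x]) (prodCode U T))

/-- The codes of the atoms of an image, labelled with their variables. -/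
def initialCodes (N : ℕ) (A : List QAtom) (h : ℕ → ℕ) : List (List ℕ × ℕ) :=
  A.map fun a => ((List.range N).filter fun y => y ∈ a.2.map h,
    Nat.pair 1 (Nat.pair a.1 (Encodable.encode (a.2.map h))))

/-- The code of the formula of a candidate. -/
def candidateCode (N : ℕ) (A : List QAtom) (c : List ℕ × List ℕ × List ℕ) : ℕ :=
  prodCode [] (c.2.2.foldl (elimStep N projCode)
    ((c.2.1.foldl (elimStep N exCode) (initialCodes N A (listFun c.1))).map
      fun f => (f.1, Nat.pair 0 (Nat.pair f.2 (Encodable.encode f.1)))))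

theorem code_conjLabels (T : List (List ℕ × FOFormula)) :
    (conjLabels T).code = conjCode (mapLabels FOFormula.code T) := by
  induction T with
  | nil => rfl
  | cons f T ih => exact congrArg (fun n => Nat.pair 3 (Nat.pair f.2.code n)) ih

theorem code_prodLabels {N : ℕ} {U : List ℕ} (hU : IsVarList N U)
    (T : List (List ℕ × SharpFormula)) :
    (prodLabels U T).code = prodCode U (mapLabels SharpFormula.code T) := by
  induction T with
  | nil =>
    change Nat.pair 0 (Nat.pair _ (codeVars U.toFinset)) = _
    rw [codeVars_toFinset hU]; rfl
  | cons f T ih =>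
    change Nat.pair 3 (Nat.pair (Nat.pair 2 (Nat.pair (codeVars _) f.2.code))
      (prodLabels U T).code) = _
    rw [ih, codeVars_toFinset (hU.filter _)]; rfl

theorem code_candidateFormula (N : ℕ) (A : List QAtom) (c : List ℕ × List ℕ × List ℕ) :
    (candidateFormula N A c).code = candidateCode N A c := by
  have h0 : IsVarList N [] := ⟨List.Pairwise.nil, by simp⟩
  rw [candidateFormula, code_prodLabels h0, mapLabels_foldl_elimStep (c' := projCode)]
  · rw [candidateCode]
    congr 2
    have h1 : mapLabels FOFormula.code (initialLabels N A (listFun c.1)) =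
        initialCodes N A (listFun c.1) := by
      simp only [mapLabels, initialLabels, initialCodes, List.map_map]
      refine List.map_congr_left fun a _ => Prod.ext rfl ?_
      simp [QAtom.formula, FOFormula.code, QAtom.symbol, QAtom.map]
    rw [← h1, ← mapLabels_foldl_elimStep (c := exLabel)]
    · simp only [mapLabels, List.map_map]
      refine List.map_congr_left fun f hf => Prod.ext rfl ?_
      have hv : ∀ (l : List ℕ) (F : List (List ℕ × FOFormula)), (∀ f ∈ F, IsVarList N f.1) →
          ∀ f ∈ l.foldl (elimStep N exLabel) F, IsVarList N f.1 := by
        intro l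
        induction l with
        | nil => exact fun F hF => hF
        | cons x l ih =>
          refine fun F hF => ih _ fun f hf => ?_
          rw [elimStep, List.mem_cons] at hf
          rcases hf with rfl | hf
          · exact (isVarList_bag N x _).filter _
          · exact hF f (List.mem_filter.1 hf).1
      have := hv _ _ (by
        simp only [initialLabels, List.forall_mem_map]
        exact fun a _ => isVarList_range_filter N _) f hf
      simp [SharpFormula.code, codeVars_toFinset this]
    · intro x U T _
      exact congrArg (fun n => Nat.pair 5 (Nat.pair x n)) (code_conjLabels T)
  · intro x U T hU
    change Nat.pair 1 (Nat.pair (codeVars {x}) (prodLabels U T).code) = _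
    rw [code_prodLabels hU, codeVars, Finset.sort_singleton]; rfl

/-! ### Primitive recursion -/

section Primrec

open Primrec

variable {α β σ : Type} [Primcodable α] [Primcodable β] [Primcodable σ]

theorem primrec_filter {f : α → List β} {p : α → β → Prop} [∀ a, DecidablePred (p a)]
    (hf : Primrec f) (hp : PrimrecRel p) : Primrec fun a => (f a).filter fun b => p a b := by
  have : DecidableRel fun (b : β) (a : α) => p a b := fun b a => inferInstance
  have h := (PrimrecRel.listFilter (R := fun (b : β) (a : α) => p a b) hp.swap).comp hf Primrec.id
  exact h.of_eq fun a => List.filter_congr fun b _ => decide_eq_decide.2 Iff.rfl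

theorem primrecPred_exists_mem {f : α → List β} {p : α → β → Prop} (hf : Primrec f)
    (hp : PrimrecRel p) : PrimrecPred fun a => ∃ b ∈ f a, p a b :=
  (PrimrecRel.exists_mem_list (R := fun b a => p a b) hp.swap).comp hf Primrec.id

theorem primrecPred_forall_mem {f : α → List β} {p : α → β → Prop} (hf : Primrec f)
    (hp : PrimrecRel p) : PrimrecPred fun a => ∀ b ∈ f a, p a b :=
  (PrimrecRel.forall_mem_list (R := fun b a => p a b) hp.swap).comp hf Primrec.id

theorem primrecPred_mem {f : α → β} {g : α → List β} (hf : Primrec f) (hg : Primrec g) :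
    PrimrecPred fun a => f a ∈ g a :=
  (primrecPred_exists_mem hg (p := fun a b => b = f a)
    (Primrec.eq.comp Primrec.snd (hf.comp Primrec.fst))).of_eq fun a => by simp

theorem primrec_listFun : Primrec₂ listFun := Primrec.list_getD 0

theorem primrec_natPair {f g : α → ℕ} (hf : Primrec f) (hg : Primrec g) :
    Primrec fun a => Nat.pair (f a) (g a) := Primrec₂.natPair.comp hf hg

theorem primrec_bag : Primrec fun p : ℕ × ℕ × List (List ℕ) => bag p.1 p.2.1 p.2.2 := by
  refine primrec_filter (Primrec.list_range.comp Primrec.fst) ?_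
  refine primrecPred_exists_mem (α := (ℕ × ℕ × List (List ℕ)) × ℕ)
    (f := fun q => q.1.2.2) (p := fun q e => q.1.2.1 ∈ e ∧ q.2 ∈ e)
    (snd.comp (snd.comp fst)) ?_
  exact (primrecPred_mem (fst.comp (snd.comp (fst.comp fst))) snd).and
    (primrecPred_mem (snd.comp fst) snd)

theorem primrec_elimEdges : Primrec fun p : ℕ × List (List ℕ) × ℕ => elimEdges p.1 p.2.1 p.2.2 := by
  refine Primrec.list_cons.comp (primrec_filter (p := fun (p : ℕ × List (List ℕ) × ℕ) y => y ≠ p.2.2)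
    (primrec_bag.comp (pair fst (pair (snd.comp snd) (fst.comp snd)))) ?_)
    (primrec_filter (p := fun (p : ℕ × List (List ℕ) × ℕ) e => p.2.2 ∉ e) (fst.comp snd) ?_)
  · exact (Primrec.eq.comp snd (snd.comp (snd.comp fst))).not
  · exact (primrecPred_mem (snd.comp (snd.comp fst)) snd).not

theorem primrec_elimStep {c : ℕ → List ℕ → List (List ℕ × β) → β}
    (hc : Primrec fun p : ℕ × List ℕ × List (List ℕ × β) => c p.1 p.2.1 p.2.2) :
    Primrec fun p : ℕ × List (List ℕ × β) × ℕ => elimStep p.1 c p.2.1 p.2.2 := by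
  have hb : Primrec fun p : ℕ × List (List ℕ × β) × ℕ => bag p.1 p.2.2 (p.2.1.map Prod.fst) :=
    primrec_bag.comp (pair fst (pair (snd.comp snd)
      (Primrec.list_map (fst.comp snd) (fst.comp snd).to₂)))
  refine Primrec.list_cons.comp (pair ?_ (hc.comp (pair (snd.comp snd) (pair hb ?_)))) ?_
  · exact primrec_filter (p := fun (p : ℕ × List (List ℕ × β) × ℕ) y => y ≠ p.2.2) hb
      (Primrec.eq.comp snd (snd.comp (snd.comp fst))).not
  · exact primrec_filter (p := fun (p : ℕ × List (List ℕ × β) × ℕ) (f : List ℕ × β) => p.2.2 ∈ f.1)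
      (fst.comp snd) (primrecPred_mem (snd.comp (snd.comp fst)) (fst.comp snd))
  · exact primrec_filter (p := fun (p : ℕ × List (List ℕ × β) × ℕ) (f : List ℕ × β) => p.2.2 ∉ f.1)
      (fst.comp snd) (primrecPred_mem (snd.comp (snd.comp fst)) (fst.comp snd)).not

theorem primrec_foldl_elimStep {c : ℕ → List ℕ → List (List ℕ × β) → β}
    (hc : Primrec fun p : ℕ × List ℕ × List (List ℕ × β) => c p.1 p.2.1 p.2.2)
    {N : α → ℕ} {l : α → List ℕ} {F : α → List (List ℕ × β)} (hN : Primrec N) (hl : Primrec l)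
    (hF : Primrec F) : Primrec fun a => (l a).foldl (elimStep (N a) c) (F a) :=
  Primrec.list_foldl (h := fun a (q : List (List ℕ × β) × ℕ) => elimStep (N a) c q.1 q.2) hl hF
    ((primrec_elimStep hc).comp (pair (hN.comp fst) snd))

theorem primrec_conjCode : Primrec conjCode :=
  Primrec.list_foldr (h := fun _ (q : (List ℕ × ℕ) × ℕ) => Nat.pair 3 (Nat.pair q.1.2 q.2))
    Primrec.id (Primrec.const _) (primrec_natPair (Primrec.const 3)
      (primrec_natPair (snd.comp (fst.comp snd)) (snd.comp snd)))

theorem primrec_exCode :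
    Primrec fun p : ℕ × List ℕ × List (List ℕ × ℕ) => exCode p.1 p.2.1 p.2.2 :=
  primrec_natPair (Primrec.const 5) (primrec_natPair fst (primrec_conjCode.comp (snd.comp snd)))

theorem primrec_prodCode : Primrec fun p : List ℕ × List (List ℕ × ℕ) => prodCode p.1 p.2 := by
  refine Primrec.list_foldr (h := fun (p : List ℕ × List (List ℕ × ℕ)) (q : (List ℕ × ℕ) × ℕ) =>
    Nat.pair 3 (Nat.pair (Nat.pair 2 (Nat.pair
      (Encodable.encode (p.1.filter fun y => y ∉ q.1.1)) q.1.2)) q.2)) snd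
    (primrec_natPair (Primrec.const 0)
      (primrec_natPair (Primrec.const _) (Primrec.encode.comp fst))) ?_
  refine primrec_natPair (Primrec.const 3) (primrec_natPair (primrec_natPair (Primrec.const 2)
    (primrec_natPair (Primrec.encode.comp ?_) (snd.comp (fst.comp snd)))) (snd.comp snd))
  exact primrec_filter
    (p := fun (r : (List ℕ × List (List ℕ × ℕ)) × ((List ℕ × ℕ) × ℕ)) y => y ∉ r.2.1.1)
    (fst.comp fst) (primrecPred_mem snd (fst.comp (fst.comp (snd.comp fst)))).not

theorem primrec_projCode :
    Primrec fun p : ℕ × List ℕ × List (List ℕ × ℕ) => projCode p.1 p.2.1 p.2.2 :=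
  primrec_natPair (Primrec.const 1) (primrec_natPair
    (Primrec.encode.comp (Primrec.list_cons.comp fst (Primrec.const [])))
    (primrec_prodCode.comp snd))

/-- Bounds, atoms and candidates. -/
abbrev CandidateData : Type := (ℕ × List QAtom) × (List ℕ × List ℕ × List ℕ)

theorem primrec_imageVars : Primrec₂ fun (p : CandidateData) (a : QAtom) =>
    a.2.map (listFun p.2.1) :=
  Primrec.list_map (snd.comp snd)
    (primrec_listFun.comp (fst.comp (snd.comp (fst.comp fst))) snd)

theorem primrec_imageEdge : Primrec₂ fun (p : CandidateData) (a : QAtom) =>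
    (List.range p.1.1).filter fun y => y ∈ a.2.map (listFun p.2.1) :=
  primrec_filter (p := fun (q : CandidateData × QAtom) y => y ∈ q.2.2.map (listFun q.1.2.1))
    (Primrec.list_range.comp (fst.comp (fst.comp fst)))
    (primrecPred_mem snd (primrec_imageVars.comp (fst.comp fst) (snd.comp fst)))

theorem primrec_candidateCode :
    Primrec fun p : CandidateData => candidateCode p.1.1 p.1.2 p.2 := by
  have h1 : Primrec fun p : CandidateData => initialCodes p.1.1 p.1.2 (listFun p.2.1) :=
    Primrec.list_map (snd.comp fst) (pair primrec_imageEdge (primrec_natPair (Primrec.const 1)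
      (primrec_natPair (fst.comp snd) (Primrec.encode.comp primrec_imageVars))))
  have h2 : Primrec fun p : CandidateData =>
      p.2.2.1.foldl (elimStep p.1.1 exCode) (initialCodes p.1.1 p.1.2 (listFun p.2.1)) :=
    primrec_foldl_elimStep primrec_exCode (fst.comp fst) (fst.comp (snd.comp snd)) h1
  have h3 : Primrec fun p : CandidateData =>
      (p.2.2.1.foldl (elimStep p.1.1 exCode) (initialCodes p.1.1 p.1.2 (listFun p.2.1))).map
        fun f => (f.1, Nat.pair 0 (Nat.pair f.2 (Encodable.encode f.1))) :=
    Primrec.list_map h2 (pair (fst.comp snd) (primrec_natPair (Primrec.const 0)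
      (primrec_natPair (snd.comp snd) (Primrec.encode.comp (fst.comp snd)))))
  have h4 : Primrec fun p : CandidateData => p.2.2.2.foldl (elimStep p.1.1 projCode)
      ((p.2.2.1.foldl (elimStep p.1.1 exCode) (initialCodes p.1.1 p.1.2 (listFun p.2.1))).map
        fun f => (f.1, Nat.pair 0 (Nat.pair f.2 (Encodable.encode f.1)))) :=
    primrec_foldl_elimStep primrec_projCode (fst.comp fst) (snd.comp (snd.comp snd)) h3
  have h5 := primrec_prodCode.comp (pair (Primrec.const []) h4)
  exact h5.of_eq fun p => by rw [candidateCode]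

/-- A fold that carries the current edges and the largest bag so far is visibly primitive recursive;
the accumulator `m` makes the induction work. -/
theorem elimCost_eq_foldl (N : ℕ) (l : List ℕ) : ∀ (H : List (List ℕ)) (m : ℕ),
    max m (elimCost N H l) = (l.foldl (fun (s : List (List ℕ) × ℕ) x =>
      (elimEdges N s.1 x, max s.2 (bag N x s.1).length)) (H, m)).2 := by
  induction l with
  | nil => intro H m; simp [elimCost]
  | cons x l ih => intro H m; rw [List.foldl_cons, ← ih, elimCost, max_assoc]

theorem primrec_elimCost :
    Primrec fun p : ℕ × List (List ℕ) × List ℕ => elimCost p.1 p.2.1 p.2.2 := by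
  have h : Primrec fun p : ℕ × List (List ℕ) × List ℕ =>
      (p.2.2.foldl (fun (s : List (List ℕ) × ℕ) x =>
        (elimEdges p.1 s.1 x, max s.2 (bag p.1 x s.1).length)) (p.2.1, 0)).2 := by
    refine snd.comp (Primrec.list_foldl (h := fun (p : ℕ × List (List ℕ) × List ℕ)
      (q : (List (List ℕ) × ℕ) × ℕ) => (elimEdges p.1 q.1.1 q.2,
        max q.1.2 (bag p.1 q.2 q.1.1).length)) (snd.comp snd)
      (pair (fst.comp snd) (Primrec.const 0)) (pair ?_ ?_))
    · exact primrec_elimEdges.comp (pair (fst.comp fst)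
        (pair (fst.comp (fst.comp snd)) (snd.comp snd)))
    · exact Primrec.nat_max.comp (snd.comp (fst.comp snd)) (Primrec.list_length.comp
        (primrec_bag.comp (pair (fst.comp fst) (pair (snd.comp snd) (fst.comp (fst.comp snd))))))
  exact h.of_eq fun p => by rw [← elimCost_eq_foldl]; simp

theorem primrec_candidateCost :
    Primrec fun p : CandidateData => candidateCost p.1.1 p.1.2 p.2 := by
  have hE : Primrec fun p : CandidateData => imageEdges p.1.1 p.1.2 (listFun p.2.1) :=
    Primrec.list_map (snd.comp fst) primrec_imageEdge
  refine Primrec.nat_max.comp ?_ (primrec_elimCost.comp (pair (fst.comp fst) (pair hE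
    (Primrec.list_append.comp (fst.comp (snd.comp snd)) (snd.comp (snd.comp snd))))))
  exact Primrec.list_foldr (h := fun _ (q : ℕ × ℕ) => max q.1 q.2)
    (Primrec.list_map hE (Primrec.list_length.comp snd)) (Primrec.const 0)
    (Primrec.nat_max.comp (fst.comp snd) (snd.comp snd))

theorem primrecPred_isCandidate :
    PrimrecPred fun p : (List ℕ × List QAtom) × (List ℕ × List ℕ × List ℕ) =>
      IsCandidate p.1.1 p.1.2 p.2 := by
  have hV : Primrec fun p : (List ℕ × List QAtom) × (List ℕ × List ℕ × List ℕ) => p.1.1 :=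
    fst.comp fst
  have hA : Primrec fun p : (List ℕ × List QAtom) × (List ℕ × List ℕ × List ℕ) => p.1.2 :=
    snd.comp fst
  have he : Primrec fun p : (List ℕ × List QAtom) × (List ℕ × List ℕ × List ℕ) => p.2.1 :=
    fst.comp snd
  have hb : Primrec fun p : (List ℕ × List QAtom) × (List ℕ × List ℕ × List ℕ) => p.2.2.1 :=
    fst.comp (snd.comp snd)
  have hr : Primrec fun p : (List ℕ × List QAtom) × (List ℕ × List ℕ × List ℕ) => p.2.2.2 :=
    snd.comp (snd.comp snd)
  have h1 : PrimrecPred fun p : (List ℕ × List QAtom) × (List ℕ × List ℕ × List ℕ) =>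
      ∀ a ∈ p.1.2, a.map (listFun p.2.1) ∈ p.1.2 := by
    refine primrecPred_forall_mem hA (primrecPred_mem (pair (fst.comp snd) ?_) (hA.comp fst))
    exact Primrec.list_map (snd.comp snd)
      (primrec_listFun.comp (he.comp (fst.comp fst)) snd)
  have h2 : PrimrecPred fun p : (List ℕ × List QAtom) × (List ℕ × List ℕ × List ℕ) =>
      ∀ v ∈ p.1.1, listFun p.2.1 v ∈ p.1.1 :=
    primrecPred_forall_mem hV (primrecPred_mem (primrec_listFun.comp (he.comp fst) snd)
      (hV.comp fst))
  have h3 : PrimrecPred fun p : (List ℕ × List QAtom) × (List ℕ × List ℕ × List ℕ) =>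
      ∀ v ∈ p.1.1, ∃ u ∈ p.1.1, listFun p.2.1 u = v :=
    primrecPred_forall_mem hV (primrecPred_exists_mem (hV.comp fst)
      (Primrec.eq.comp (primrec_listFun.comp (he.comp (fst.comp fst)) snd) (snd.comp fst)))
  have h4 : PrimrecPred fun p : (List ℕ × List QAtom) × (List ℕ × List ℕ × List ℕ) =>
      ∀ x ∈ p.2.2.1, x ∉ p.1.1 :=
    primrecPred_forall_mem hb (primrecPred_mem snd (hV.comp fst)).not
  have h5 : PrimrecPred fun p : (List ℕ × List QAtom) × (List ℕ × List ℕ × List ℕ) =>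
      ∀ a ∈ p.1.2, ∀ x ∈ a.2, listFun p.2.1 x ∈ p.1.1 ∨ listFun p.2.1 x ∈ p.2.2.1 := by
    refine primrecPred_forall_mem hA (primrecPred_forall_mem (snd.comp snd) ?_)
    exact (primrecPred_mem (primrec_listFun.comp (he.comp (fst.comp fst)) snd)
      (hV.comp (fst.comp fst))).or (primrecPred_mem
        (primrec_listFun.comp (he.comp (fst.comp fst)) snd) (hb.comp (fst.comp fst)))
  have h6 : PrimrecPred fun p : (List ℕ × List QAtom) × (List ℕ × List ℕ × List ℕ) =>
      ∀ v ∈ p.1.1, v ∈ p.2.2.2 :=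
    primrecPred_forall_mem hV (primrecPred_mem snd (hr.comp fst))
  have h7 : PrimrecPred fun p : (List ℕ × List QAtom) × (List ℕ × List ℕ × List ℕ) =>
      p.2.2.2.length = p.1.1.length :=
    Primrec.eq.comp (Primrec.list_length.comp hr) (Primrec.list_length.comp hV)
  refine (h1.and (h2.and (h3.and (h4.and (h5.and (h6.and h7)))))).of_eq fun p => ?_
  exact ⟨fun ⟨h1, h2, h3, h4, h5, h6, h7⟩ => ⟨h1, h2, h3, h4, h5, h6, h7⟩,
    fun ⟨h1, h2, h3, h4, h5, h6, h7⟩ => ⟨h1, h2, h3, h4, h5, h6, h7⟩⟩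

/-- All lists of length at most `n` of numbers below `N`. -/
def listsBelow (N : ℕ) : ℕ → List (List ℕ)
  | 0 => [[]]
  | n + 1 => [] :: (listsBelow N n).flatMap fun l => (List.range N).map fun x => x :: l

theorem mem_listsBelow {N n : ℕ} : ∀ {l : List ℕ}, l.length ≤ n → (∀ x ∈ l, x < N) →
    l ∈ listsBelow N n := by
  induction n with
  | zero => intro l hl _; rw [listsBelow, List.mem_singleton]; exact List.length_eq_zero_iff.1 (by omega)
  | succ n ih =>
    intro l hl h
    rw [listsBelow, List.mem_cons]
    cases l with
    | nil => exact Or.inl rfl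
    | cons x l =>
      refine Or.inr (List.mem_flatMap.2 ⟨l, ih (by simpa using hl)
        fun y hy => h y (List.mem_cons_of_mem _ hy), List.mem_map.2 ⟨x, ?_, rfl⟩⟩)
      exact List.mem_range.2 (h x List.mem_cons_self)

theorem primrec_listsBelow : Primrec₂ listsBelow := by
  have h : Primrec₂ fun (N n : ℕ) => (Nat.rec [[]] (fun _ s =>
      [] :: s.flatMap fun l => (List.range N).map fun x => x :: l) n : List (List ℕ)) := by
    refine Primrec.nat_rec (f := fun _ => [[]]) (g := fun N (q : ℕ × List (List ℕ)) =>
      [] :: q.2.flatMap fun l => (List.range N).map fun x => x :: l) (Primrec.const _) ?_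
    refine Primrec.list_cons.comp (Primrec.const []) (Primrec.list_flatMap (snd.comp snd) ?_)
    exact Primrec.list_map (Primrec.list_range.comp (fst.comp fst))
      (Primrec.list_cons.comp snd (snd.comp fst))
  refine h.of_eq fun N n => ?_
  induction n with
  | zero => rfl
  | succ n ih => rw [listsBelow, ← ih]

/-- All triples of lists of length at most `N` of numbers below `N`. -/
def triplesBelow (N : ℕ) : List (List ℕ × List ℕ × List ℕ) :=
  (listsBelow N N).flatMap fun a => (listsBelow N N).flatMap fun b =>
    (listsBelow N N).map fun c => (a, b, c)

theorem mem_triplesBelow {N : ℕ} {c : List ℕ × List ℕ × List ℕ}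
    (h : ∀ l ∈ [c.1, c.2.1, c.2.2], l.length ≤ N ∧ ∀ x ∈ l, x < N) : c ∈ triplesBelow N := by
  simp only [List.mem_cons, List.not_mem_nil, or_false, forall_eq_or_imp, forall_eq] at h
  simp only [triplesBelow, List.mem_flatMap, List.mem_map]
  exact ⟨_, mem_listsBelow h.1.1 h.1.2, _, mem_listsBelow h.2.1.1 h.2.1.2, _,
    mem_listsBelow h.2.2.1 h.2.2.2, rfl⟩

theorem primrec_triplesBelow : Primrec triplesBelow := by
  have h : Primrec fun N => listsBelow N N := primrec_listsBelow.comp Primrec.id Primrec.id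
  exact Primrec.list_flatMap h (Primrec.list_flatMap (h.comp fst)
    (Primrec.list_map (h.comp (fst.comp fst)) (pair (snd.comp (fst.comp fst))
      (pair (snd.comp fst) snd))))

/-- The first pair with minimum first component in a list. -/
def minPair (l : List (ℕ × ℕ)) : ℕ × ℕ :=
  l.foldl (fun b r => if r.1 < b.1 then r else b) l.headI

theorem primrec_minPair : Primrec minPair :=
  Primrec.list_foldl (h := fun _ (q : (ℕ × ℕ) × ℕ × ℕ) => if q.2.1 < q.1.1 then q.2 else q.1)
    Primrec.id Primrec.list_headI (Primrec.ite (Primrec.nat_lt.comp (fst.comp (snd.comp snd))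
      (fst.comp (fst.comp snd))) (snd.comp snd) (fst.comp snd))

theorem minPair_spec {l : List (ℕ × ℕ)} (hl : l ≠ []) :
    minPair l ∈ l ∧ ∀ r ∈ l, (minPair l).1 ≤ r.1 := by
  have key : ∀ (l : List (ℕ × ℕ)) (b : ℕ × ℕ),
      l.foldl (fun b r => if r.1 < b.1 then r else b) b ∈ b :: l ∧
      ∀ r ∈ b :: l, (l.foldl (fun b r => if r.1 < b.1 then r else b) b).1 ≤ r.1 := by
    intro l
    induction l with
    | nil => intro b; simp
    | cons a l ih =>
      intro b
      obtain ⟨h1, h2⟩ := ih (if a.1 < b.1 then a else b)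
      rw [List.foldl_cons]
      have h3 := h2 _ List.mem_cons_self
      constructor
      · rcases List.mem_cons.1 h1 with h | h
        · rw [h]; split_ifs <;> simp
        · simp [h]
      · intro r hr
        rcases List.mem_cons.1 hr with rfl | hr
        · refine h3.trans ?_; split_ifs <;> omega
        · rcases List.mem_cons.1 hr with rfl | hr
          · refine h3.trans ?_; split_ifs <;> omega
          · exact h2 r (List.mem_cons_of_mem _ hr)
  obtain ⟨a, l, rfl⟩ := List.exists_cons_of_ne_nil hl
  obtain ⟨h1, h2⟩ := key (a :: l) a
  refine ⟨?_, fun r hr => h2 r (List.mem_cons_of_mem _ hr)⟩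
  -- The fold starts from the head, which is itself a member of the list.
  rcases List.mem_cons.1 h1 with h | h
  · exact List.mem_cons.2 (Or.inl h)
  · exact h

end Primrec


/-! ### Decoding of formulas -/

/-- The list with a given code. -/
def decodeList (n : ℕ) : List ℕ := (Encodable.decode n).getD []

theorem decodeList_encode (l : List ℕ) : decodeList (Encodable.encode l) = l := by
  simp [decodeList]

/-- The quantified variables and the atoms of a formula that is given by its code. -/
def parse (n : ℕ) : List ℕ × List QAtom :=
  if n.unpair.1 = 1 then ([], [(n.unpair.2.unpair.1, decodeList n.unpair.2.unpair.2)])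
  else if n.unpair.1 = 3 then
    ((parse n.unpair.2.unpair.1).1 ++ (parse n.unpair.2.unpair.2).1,
      (parse n.unpair.2.unpair.1).2 ++ (parse n.unpair.2.unpair.2).2)
  else if n.unpair.1 = 5 then
    (n.unpair.2.unpair.1 :: (parse n.unpair.2.unpair.2).1, (parse n.unpair.2.unpair.2).2)
  else ([], [])
termination_by n
decreasing_by
  all_goals
    -- Recursive calls occur only for the tags `3` and `5`; as these are positive, the second
    -- component is strictly below `n`.
    have h1 := Nat.add_le_pair n.unpair.1 n.unpair.2
    rw [Nat.pair_unpair] at h1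
    have h2 := Nat.unpair_left_le n.unpair.2
    have h3 := Nat.unpair_right_le n.unpair.2
    omega

section Primrec

open Primrec

theorem primrec_decodeList : Primrec decodeList :=
  Primrec.option_getD.comp Primrec.decode (Primrec.const [])

/-- One step of the recursion of `parse`, given the list of the previous values. -/
def parseStep (l : List (List ℕ × List QAtom)) : List ℕ × List QAtom :=
  if l.length.unpair.1 = 1 then
    ([], [(l.length.unpair.2.unpair.1, decodeList l.length.unpair.2.unpair.2)])
  else if l.length.unpair.1 = 3 then
    ((l.getD l.length.unpair.2.unpair.1 ([], [])).1 ++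
        (l.getD l.length.unpair.2.unpair.2 ([], [])).1,
      (l.getD l.length.unpair.2.unpair.1 ([], [])).2 ++
        (l.getD l.length.unpair.2.unpair.2 ([], [])).2)
  else if l.length.unpair.1 = 5 then
    (l.length.unpair.2.unpair.1 :: (l.getD l.length.unpair.2.unpair.2 ([], [])).1,
      (l.getD l.length.unpair.2.unpair.2 ([], [])).2)
  else ([], [])

theorem primrec_parseStep : Primrec parseStep := by
  have hn : Primrec fun l : List (List ℕ × List QAtom) => l.length := Primrec.list_length
  have ht : Primrec fun l : List (List ℕ × List QAtom) => l.length.unpair.1 :=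
    fst.comp (Primrec.unpair.comp hn)
  have ha : Primrec fun l : List (List ℕ × List QAtom) => l.length.unpair.2.unpair.1 :=
    fst.comp (Primrec.unpair.comp (snd.comp (Primrec.unpair.comp hn)))
  have hb : Primrec fun l : List (List ℕ × List QAtom) => l.length.unpair.2.unpair.2 :=
    snd.comp (Primrec.unpair.comp (snd.comp (Primrec.unpair.comp hn)))
  have hA : Primrec fun l : List (List ℕ × List QAtom) =>
      l.getD l.length.unpair.2.unpair.1 ([], []) :=
    (Primrec.list_getD ([], [])).comp Primrec.id ha
  have hB : Primrec fun l : List (List ℕ × List QAtom) =>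
      l.getD l.length.unpair.2.unpair.2 ([], []) :=
    (Primrec.list_getD ([], [])).comp Primrec.id hb
  have htag : ∀ m : ℕ, PrimrecPred fun l : List (List ℕ × List QAtom) => l.length.unpair.1 = m :=
    fun m => Primrec.eq.comp ht (Primrec.const m)
  refine Primrec.ite (htag 1) (pair (Primrec.const []) (Primrec.list_cons.comp
    (pair ha (primrec_decodeList.comp hb)) (Primrec.const []))) (Primrec.ite (htag 3) ?_
      (Primrec.ite (htag 5) ?_ (Primrec.const _)))
  · exact pair (Primrec.list_append.comp (fst.comp hA) (fst.comp hB))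
      (Primrec.list_append.comp (snd.comp hA) (snd.comp hB))
  · exact pair (Primrec.list_cons.comp ha (fst.comp hB)) (snd.comp hB)

/-- Course-of-values recursion: the length of the list of earlier values is the argument, and the
codes of subformulas are smaller. -/
theorem parseStep_map_range (n : ℕ) : parseStep ((List.range n).map parse) = parse n := by
  have hget : ∀ i < n, ((List.range n).map parse).getD i ([], []) = parse i := fun i hi => by
    simp [List.getD_eq_getElem?_getD, hi]
  have h1 := Nat.add_le_pair n.unpair.1 n.unpair.2
  rw [Nat.pair_unpair] at h1
  have h2 := Nat.unpair_left_le n.unpair.2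
  have h3 := Nat.unpair_right_le n.unpair.2
  rw [parse, parseStep]
  simp only [List.length_map, List.length_range]
  split_ifs with h4 h5 h6
  · rfl
  · rw [hget _ (by omega), hget _ (by omega)]
  · rw [hget _ (by omega)]
  · rfl

theorem primrec_parse : Primrec parse := by
  have h : Primrec₂ fun (_ : Unit) n => parse n :=
    Primrec.nat_strong_rec _ (g := fun _ l => some (parseStep l))
      (Primrec.option_some.comp (primrec_parseStep.comp snd))
      fun _ n => congrArg some (parseStep_map_range n)
  exact h.comp (Primrec.const ()) Primrec.id

end Primrec

theorem parse_tru : parse FOFormula.tru.code = ([], []) := by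
  rw [parse]; simp [FOFormula.code]

theorem parse_atom (R : RelSymbol) (v : Fin R.arity → Var) :
    parse (FOFormula.atom R v).code = ([], [(R.name, List.ofFn v)]) := by
  rw [parse]; simp [FOFormula.code, decodeList_encode]

theorem parse_and (φ ψ : FOFormula) : parse (FOFormula.and φ ψ).code =
    ((parse φ.code).1 ++ (parse ψ.code).1, (parse φ.code).2 ++ (parse ψ.code).2) := by
  rw [parse]; simp [FOFormula.code]

theorem parse_ex (x : Var) (φ : FOFormula) : parse (FOFormula.ex x φ).code =
    (x :: (parse φ.code).1, (parse φ.code).2) := by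
  rw [parse]; simp [FOFormula.code]

/-- The result of parsing a quantifier-free pp-formula. -/
theorem parse_qf {θ : FOFormula} : θ.IsPP → θ.IsQF → (parse θ.code).1 = [] ∧
    (∀ a ∈ (parse θ.code).2, a.symbol ∈ θ.symbols ∧ ∀ x ∈ a.2, x ∈ θ.free) ∧
    ∀ (B : FinStructure) (g : ℕ → B.carrier), θ.Sat B g ↔ B.Models g (parse θ.code).2 := by
  induction θ with
  | tru => intro _ _; simp [parse_tru, FinStructure.Models, FOFormula.Sat]
  | atom R v =>
    intro _ _
    rw [parse_atom]
    refine ⟨rfl, ?_, fun B g => ?_⟩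
    · simp [QAtom.symbol, FOFormula.symbols, FOFormula.free]
    · simp only [FinStructure.Models, List.forall_mem_singleton, List.map_ofFn, B.holds_ofFn]
      rfl
  | and φ ψ ih ih' =>
    intro hpp hqf
    obtain ⟨h1, h2, h3⟩ := ih hpp.1 hqf.1
    obtain ⟨h1', h2', h3'⟩ := ih' hpp.2 hqf.2
    rw [parse_and]
    refine ⟨by simp [h1, h1'], fun a ha => ?_, fun B g => ?_⟩
    · rcases List.mem_append.1 ha with h | h
      · exact ⟨Or.inl (h2 a h).1, fun x hx => Finset.mem_union_left _ ((h2 a h).2 x hx)⟩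
      · exact ⟨Or.inr (h2' a h).1, fun x hx => Finset.mem_union_right _ ((h2' a h).2 x hx)⟩
    · rw [FinStructure.models_append, ← h3, ← h3']; rfl
  | neg φ _ => intro h; exact h.elim
  | or φ ψ _ _ => intro h; exact h.elim
  | all x φ _ => intro h; exact h.elim
  | ex x φ _ => intro _ h; exact h.elim

/-- The result of parsing a prenex pp-formula. -/
theorem parse_prenex {θ : FOFormula} (hpr : θ.IsPrenex) : θ.IsPP →
    (∀ a ∈ (parse θ.code).2, a.symbol ∈ θ.symbols ∧
      ∀ x ∈ a.2, x ∈ θ.free ∨ x ∈ (parse θ.code).1) ∧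
    ∀ (B : FinStructure) (g : ℕ → B.carrier),
      θ.Sat B g ↔ B.Solves (parse θ.code).2 (parse θ.code).1 g := by
  -- In a prenex formula every atom lies in the scope of all quantifiers, so one list of quantified
  -- variables suffices without renaming.
  induction hpr with
  | qf h =>
    intro hpp
    obtain ⟨h1, h2, h3⟩ := parse_qf hpp h
    refine ⟨fun a ha => ⟨(h2 a ha).1, fun x hx => Or.inl ((h2 a ha).2 x hx)⟩, fun B g => ?_⟩
    rw [h3, h1]
    constructor
    · exact fun h => ⟨g, fun _ _ => rfl, h⟩
    · rintro ⟨g', hg', h⟩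
      obtain rfl : g' = g := funext fun x => hg' x (by simp)
      exact h
  | @ex x φ _ ih =>
    intro hpp
    obtain ⟨h2, h3⟩ := ih hpp
    rw [parse_ex]
    refine ⟨fun a ha => ⟨(h2 a ha).1, fun y hy => ?_⟩, fun B g => ?_⟩
    · rcases (h2 a ha).2 y hy with h | h
      · by_cases hyx : y = x
        · right; simp [hyx]
        · exact Or.inl (Finset.mem_erase.2 ⟨hyx, h⟩)
      · right; simp [h]
    · simp only [FOFormula.Sat, h3]
      constructor
      · rintro ⟨b, g', hg', h⟩
        refine ⟨g', fun y hy => ?_, h⟩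
        rw [List.mem_cons, not_or] at hy
        rw [hg' y hy.2, Function.update_of_ne hy.1]
      · rintro ⟨g', hg', h⟩
        refine ⟨g' x, g', fun y hy => ?_, h⟩
        by_cases hyx : y = x
        · subst hyx; simp
        · rw [Function.update_of_ne hyx]
          exact hg' y (by simp [hyx, hy])
  | all x h _ => intro h; exact h.elim

/-! ### The query of a prenex pp-formula -/

/-- Quantified variables are renamed to odd numbers and free variables to even numbers. -/
def splitVar (X : List ℕ) (x : ℕ) : ℕ := if x ∈ X then 2 * x + 1 else 2 * x

/-- The atoms of the query with the given code. -/
def queryAtoms (n : ℕ) : List QAtom :=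
  (parse n.unpair.1).2.map fun a => (a.1, a.2.map (splitVar (parse n.unpair.1).1))

/-- The liberal variables of the query with the given code. -/
def queryVars (n : ℕ) : List ℕ := (decodeList n.unpair.2).map fun x => 2 * x

/-- A strict bound for the variables of the query with the given code. -/
def queryBound (n : ℕ) : ℕ := (queryVars n ++ (queryAtoms n).flatMap fun a => a.2).sum + 1

theorem lt_queryBound (n : ℕ) : (∀ v ∈ queryVars n, v < queryBound n) ∧
    ∀ a ∈ queryAtoms n, ∀ x ∈ a.2, x < queryBound n := by
  have h : ∀ x ∈ queryVars n ++ (queryAtoms n).flatMap fun a => a.2, x < queryBound n :=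
    fun x hx => Nat.lt_succ_of_le (List.single_le_sum (by simp) x hx)
  exact ⟨fun v hv => h v (List.mem_append_left _ hv), fun a ha x hx =>
    h x (List.mem_append_right _ (List.mem_flatMap.2 ⟨a, ha, hx⟩))⟩

namespace PrenexPP

theorem queryVars_code (φ : PrenexPP) :
    queryVars φ.code = (φ.lib.sort (· ≤ ·)).map fun x => 2 * x := by
  rw [queryVars, code, Nat.unpair_pair, codeVars, decodeList_encode]

theorem queryVars_nodup (φ : PrenexPP) : (queryVars φ.code).Nodup := by
  rw [queryVars_code]
  exact (Finset.sort_nodup _ _).map fun a b h => by simpa using h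

theorem mem_queryVars (φ : PrenexPP) {y : ℕ} :
    y ∈ (queryVars φ.code).toFinset ↔ ∃ x ∈ φ.lib, 2 * x = y := by
  simp [queryVars_code]

theorem symbol_mem_of_mem_queryAtoms (φ : PrenexPP) {a : QAtom} (ha : a ∈ queryAtoms φ.code) :
    a.symbol ∈ φ.formula.symbols := by
  rw [queryAtoms, code, Nat.unpair_pair] at ha
  obtain ⟨a, ha', rfl⟩ := List.mem_map.1 ha
  have ha : a ∈ (parse φ.formula.code).2 := ha'
  simpa [QAtom.symbol] using ((parse_prenex φ.isPrenex φ.isPP).1 a ha).1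

theorem queryCount_code (φ : PrenexPP) (B : FinStructure) :
    queryCount (queryVars φ.code).toFinset (queryAtoms φ.code) B = (φ.answers B).ncard := by
  -- A variable in `lib` may also be quantified in the formula; the odd and even names of `splitVar`
  -- keep the two roles apart.
  set X := (parse φ.formula.code).1 with hX
  have hatoms : queryAtoms φ.code = (parse φ.formula.code).2.map (QAtom.map (splitVar X)) := by
    rw [queryAtoms, code, Nat.unpair_pair]; rfl
  have hsat := (parse_prenex φ.isPrenex φ.isPP).2
  have hmem : ∀ x : φ.lib, 2 * (x : ℕ) ∈ (queryVars φ.code).toFinset :=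
    fun x => φ.mem_queryVars.2 ⟨x, x.2, rfl⟩
  refine Set.ncard_congr (fun k _ x => k ⟨2 * x, hmem x⟩) ?_ ?_ ?_
  · rintro k ⟨G, hG, hA⟩
    rw [hatoms, FinStructure.models_map] at hA
    refine ⟨fun x => G (2 * x), fun x => hG ⟨2 * x, hmem x⟩, (hsat B _).2 ⟨_, fun x hx => ?_, hA⟩⟩
    rw [← hX] at hx
    simp [splitVar, hx]
  · intro k k' _ _ h
    funext ⟨y, hy⟩
    obtain ⟨x, hx, rfl⟩ := φ.mem_queryVars.1 hy
    exact congrFun h ⟨x, hx⟩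
  · rintro f ⟨g, hg, hs⟩
    obtain ⟨g', hg', hA⟩ := (hsat B g).1 hs
    -- Odd names read the witnesses `g'`, even names the given assignment `g`.
    refine ⟨fun y => g (y.1 / 2), ⟨fun y => if y % 2 = 1 then g' (y / 2) else g (y / 2), ?_, ?_⟩, ?_⟩
    · rintro ⟨y, hy⟩
      obtain ⟨x, hx, rfl⟩ := φ.mem_queryVars.1 hy
      simp
    · rw [hatoms, FinStructure.models_map]
      convert hA using 1
      funext x
      by_cases hx : x ∈ X
      · have h1 : (2 * x + 1) % 2 = 1 := by omega
        have h2 : (2 * x + 1) / 2 = x := by omega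
        simp [splitVar, hx, h1, h2]
      · simp [splitVar, hx, hg' x hx]
    · funext x
      simp [hg]

/-- The ♯PP-formula that counts the answers directly. -/
def directFormula (φ : PrenexPP) : SharpFormula := .proj φ.lib (.cast φ.formula φ.lib)

theorem directFormula_spec (φ : PrenexPP) :
    φ.directFormula.IsSharpPP ∧ φ.directFormula.Represents φ := by
  classical
  have hwf : φ.directFormula.WellFormed :=
    ⟨φ.free_subset, by simp [SharpFormula.closed]⟩
  refine ⟨⟨hwf, φ.isPP⟩, hwf, by simp [directFormula, SharpFormula.free], fun B h => ?_⟩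
  have key : ∀ k : φ.lib → B.carrier,
      φ.formula.Sat B (override h φ.lib k) ↔ k ∈ φ.answers B := by
    intro k
    constructor
    · exact fun hs => ⟨_, fun x => by simp [override], hs⟩
    · rintro ⟨g, hg, hs⟩
      refine (FOFormula.sat_congr B φ.formula _ _ fun x hx => ?_).1 hs
      have hx' := φ.free_subset hx
      simpa [override, hx'] using hg ⟨x, hx'⟩
  simp only [directFormula, SharpFormula.eval, key]
  rw [Finset.sum_boole, Set.ncard_eq_toFinset_card']
  congr 2
  ext k
  simp

end PrenexPP

/-! ### The algorithm -/

open Classical in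
/-- The candidates for the query with the given code. -/
noncomputable def candidates (n : ℕ) : List (List ℕ × List ℕ × List ℕ) :=
  (triplesBelow (queryBound n)).filter fun c => IsCandidate (queryVars n) (queryAtoms n) c

/-- The algorithm selects a candidate of minimum cost. -/
noncomputable def minWidthCode (n : ℕ) : ℕ :=
  (minPair ((candidates n).map fun c =>
    (candidateCost (queryBound n) (queryAtoms n) c,
      candidateCode (queryBound n) (queryAtoms n) c))).2

section Primrec

open Primrec

theorem primrec_splitVar : Primrec₂ splitVar :=
  Primrec.ite (primrecPred_mem snd fst)
    (Primrec.succ.comp (Primrec.nat_mul.comp (Primrec.const 2) snd))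
    (Primrec.nat_mul.comp (Primrec.const 2) snd)

theorem primrec_queryAtoms : Primrec queryAtoms := by
  have hp : Primrec fun n : ℕ => parse n.unpair.1 :=
    primrec_parse.comp (fst.comp Primrec.unpair)
  refine Primrec.list_map (snd.comp hp) (pair (fst.comp snd) (Primrec.list_map (snd.comp snd) ?_))
  exact primrec_splitVar.comp (fst.comp (hp.comp (fst.comp fst))) snd

theorem primrec_queryVars : Primrec queryVars :=
  Primrec.list_map (primrec_decodeList.comp (snd.comp Primrec.unpair))
    (Primrec.nat_mul.comp (Primrec.const 2) snd)

theorem primrec_queryBound : Primrec queryBound := by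
  have h : Primrec fun n => queryVars n ++ (queryAtoms n).flatMap fun a => a.2 :=
    Primrec.list_append.comp primrec_queryVars
      (Primrec.list_flatMap primrec_queryAtoms (snd.comp snd))
  exact Primrec.succ.comp (Primrec.list_foldr (h := fun _ (q : ℕ × ℕ) => q.1 + q.2) h
    (Primrec.const 0) (Primrec.nat_add.comp (fst.comp snd) (snd.comp snd)))

/-- The classical decision in `candidates` is harmless: primitive recursiveness concerns only the
resulting function, and being a candidate is a primitive recursive predicate. -/
theorem primrec_candidates : Primrec candidates := by
  classical
  refine primrec_filter (p := fun n c => IsCandidate (queryVars n) (queryAtoms n) c)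
    (primrec_triplesBelow.comp primrec_queryBound) ?_
  exact primrecPred_isCandidate.comp
    (pair (pair (primrec_queryVars.comp fst) (primrec_queryAtoms.comp fst)) snd)

theorem primrec_minWidthCode : Primrec minWidthCode := by
  have h : Primrec₂ fun (n : ℕ) (c : List ℕ × List ℕ × List ℕ) =>
      (((queryBound n, queryAtoms n), c) : CandidateData) :=
    pair (pair (primrec_queryBound.comp fst) (primrec_queryAtoms.comp fst)) snd
  exact snd.comp (primrec_minPair.comp (Primrec.list_map primrec_candidates
    (pair (primrec_candidateCost.comp h) (primrec_candidateCode.comp h))))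

end Primrec

/-- The lower bound: each representation gives rise to a candidate. -/
theorem PrenexPP.exists_mem_candidates (φ : PrenexPP) {ψ : SharpFormula} (hψ : ψ.IsSharpPP)
    (hr : ψ.Represents φ) : ∃ c ∈ candidates φ.code,
      candidateCost (queryBound φ.code) (queryAtoms φ.code) c ≤ ψ.width := by
  obtain ⟨q, m, hq, hc⟩ := ψ.exists_query hψ hr.2.1 (V := (queryVars φ.code).toFinset)
    (A := queryAtoms φ.code) fun B g => by rw [hr.2.2, φ.queryCount_code]
  -- Here `M` is the sum of all variable occurrences, so that `M + 1` is `queryBound φ.code`.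
  obtain ⟨c, h1, h2, h3⟩ := exists_candidate φ.queryVars_nodup (lt_queryBound φ.code).1
    (lt_queryBound φ.code).2 hq hc
  exact ⟨c, List.mem_filter.2 ⟨mem_triplesBelow h3, by simpa using h1⟩, h2⟩

end SharpLogic

/-- There is a computable function `alg` on Gödel numbers that maps every prenex pp-formula `φ` to a
♯PP-representation `ψ` of `φ`, over the vocabulary of `φ`, whose width is minimum among all
♯PP-representations of `φ`. -/
theorem theorem4p2 :
    ∃ alg : ℕ → ℕ, Computable alg ∧
      ∀ φ : SharpLogic.PrenexPP, ∃ ψ : SharpLogic.SharpFormula,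
        alg φ.code = ψ.code ∧
        ψ.IsSharpPP ∧ ψ.Represents φ ∧ ψ.symbols ⊆ φ.formula.symbols ∧
        ∀ ψ' : SharpLogic.SharpFormula, ψ'.IsSharpPP → ψ'.Represents φ → ψ.width ≤ ψ'.width := by
  refine ⟨SharpLogic.minWidthCode, SharpLogic.primrec_minWidthCode.to_comp, fun φ => ?_⟩
  set l := (SharpLogic.candidates φ.code).map fun c =>
    (SharpLogic.candidateCost (SharpLogic.queryBound φ.code) (SharpLogic.queryAtoms φ.code) c,
      SharpLogic.candidateCode (SharpLogic.queryBound φ.code) (SharpLogic.queryAtoms φ.code) c)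
    with hl
  have hne : l ≠ [] := by
    -- The search space is nonempty because the direct formula is a representation and so yields a
    -- candidate.
    obtain ⟨c, hc, -⟩ := φ.exists_mem_candidates φ.directFormula_spec.1 φ.directFormula_spec.2
    exact List.ne_nil_of_mem (List.mem_map_of_mem hc)
  obtain ⟨hmem, hmin⟩ := SharpLogic.minPair_spec hne
  obtain ⟨c, hc, hcl⟩ := List.mem_map.1 hmem
  have hcand : SharpLogic.IsCandidate (SharpLogic.queryVars φ.code)
      (SharpLogic.queryAtoms φ.code) c := by
    simpa using (List.mem_filter.1 hc).2
  obtain ⟨h1, h2, h3, h4, h5⟩ := hcand.formula_spec φ.queryVars_nodup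
    (SharpLogic.lt_queryBound φ.code).2
  refine ⟨SharpLogic.candidateFormula (SharpLogic.queryBound φ.code)
    (SharpLogic.queryAtoms φ.code) c, ?_, h1, ⟨h1.1, h2, fun B h => ?_⟩, ?_, ?_⟩
  · rw [SharpLogic.code_candidateFormula]
    exact (congrArg Prod.snd hcl).symm
  · rw [h5, φ.queryCount_code]
  · refine h3.trans ?_
    rintro R ⟨a, ha, rfl⟩
    exact φ.symbol_mem_of_mem_queryAtoms ha
  · intro ψ' hψ' hr
    obtain ⟨c', hc', hcost⟩ := φ.exists_mem_candidates hψ' hr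
    have h6 := hmin _ (List.mem_map_of_mem hc')
    rw [← hcl] at h6
    -- The width of the output is at most its cost, which is at most the cost of the candidate
    -- obtained from `ψ'`, which is at most the width of `ψ'`.
    exact h4.trans (h6.trans hcost)
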